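/- Let $\mathcal B$ be a pointed braided fusion category over $\mathbb C$: a $\mathbb C$-linear abelian, semisimple, rigid braided monoidal category with bilinear tensor product, finite-dimensional hom spaces, finitely many simple objects up to isomorphism and simple unit object, in which every simple object is invertible. Let $A$ be the finite abelian group of isomorphism classes of invertible objects of $\mathcal B$ and let $q(a)$ be the scalar by which the braiding $c_{X,X}$ acts on $X\otimes X$, for $X$ in the class $a\in A$. Let $O(A,q)$ be the group of automorphisms $\sigma$ of $A$ with $q\circ\sigma=q$, and let $\mathrm{Aut}^{br}_\otimes(\mathcal B)$ be the group of $\mathbb C$-linear braided tensor autoequivalences of $\mathcal B$ up to tensor natural isomorphism, under composition. (1) Sending $F$ to the automorphism $[X]\mapsto[F(X)]$ of $A$ defines a group isomorphism $\mathrm{Aut}^{br}_\otimes(\mathcal B)\cong O(A,q)$. (2) $\mathcal B$ can be identified with some $\mathrm{Vec}_A^{\omega,c}$ with $\omega,c$ valued in $U(1)$; that is, there are representatives $X_a$ of the classes $a\in A$ and isomorphisms $X_a\otimes X_b\cong X_{ab}$ in terms of which the associativity isomorphism $X_a\otimes(X_b\otimes X_d)\to(X_a\otimes X_b)\otimes X_d$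 is the scalar $\omega(a,b,d)\in U(1)$ and the braiding $X_a\otimes X_b\to X_b\otimes X_a$ is the scalar $c(a,b)\in U(1)$. Fix any such identification, a group $G$ and a homomorphism $\rho:G\to O(A,q)$. Let $G$ act from the right on functions on $A$, on functions on $A\times A$, and on $\hat A=\mathrm{Hom}(A,U(1))$, by $f\mapsto f\circ\rho(g)$, and let $\delta_G$ be the inhomogeneous differential for right $G$-modules; so $(\delta_G\psi)(g,h)=\psi_h\,\psi_{gh}^{-1}\,(\psi_g\circ\rho(h))$ and $(\delta_G\theta)(g,h,l)=\theta(h,l)\,\theta(gh,l)^{-1}\,\theta(g,hl)\,(\theta(g,h)\circ\rho(l))^{-1}$. Put $(\delta_A f)(a,b)=f(b)f(ab)^{-1}f(a)$. Then there are maps $\psi:G\to C^2(A,U(1))$ and $\theta:G\times G\to C^1(A,U(1))$ such that, for all $g,h\in G$ and $a,b,d\in A$, $$\frac{\omega(a,b,d)}{\omega(\rho(g)a,\rho(g)b,\rho(g)d)}=\frac{\psi_g(b,d)\,\psi_g(a,bd)}{\psi_g(ab,d)\,\psi_g(a,b)},\qquad \frac{c(a,b)}{c(\rho(g)a,\rho(g)b)}=\frac{\psi_g(a,b)}{\psi_g(b,a)},\qquad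 (\delta_G\psi)(g,h)=\delta_A(\theta(g,h))^{-1}.$$ For every such pair $(\psi,\theta)$, $\delta_G(\theta)$ takes values in $\hat A$, is a 3-cocycle in $Z^3(G,\hat A)$, and represents the $H^3$-obstruction $[O_3(\rho)]\in H^3(G,\hat A)$ of $\rho$. Here the $H^3$-obstruction is defined as follows. Choose braided autoequivalences $F_g$ of $\mathcal B$ inducing $\rho(g)$ on $A$ and tensor natural isomorphisms $\theta_{g,h}:F_g\circ F_h\to F_{gh}$; then $O_3(\rho)(g,h,l)\in\mathrm{Aut}_\otimes(F_{ghl})\cong\hat A$ is determined by $O_3(\rho)(g,h,l)\circ\theta_{gh,l}\circ(\theta_{g,h})_{F_l}=\theta_{g,hl}\circ F_g(\theta_{h,l})$, where $\chi\in\hat A$ corresponds to the automorphism acting by $\chi(a)$ on $F_{ghl}(X)$ for $X$ in the class $a$. Such choices exist, and all of them give cocycles in $Z^3(G,\hat A)$ of the same class, namely that of $\delta_G(\theta)$. -/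

import Mathlib

open CategoryTheory MonoidalCategory

universe u v w

/-! ### Pointed braided fusion categories over `ℂ` -/

/-- A braided fusion category over `ℂ` (abelian, `ℂ`-linear, finite-dimensional hom spaces,
semisimple with finitely many simple objects, rigid, bilinear tensor product, simple unit) which is
pointed: every simple object is invertible. -/
class IsPointedBraidedFusion (B : Type u) [Category.{v} B] [Abelian B] [Linear ℂ B]
    [MonoidalCategory B] [MonoidalPreadditive B] [MonoidalLinear ℂ B] [BraidedCategory B] :
    Prop where
  finite_hom : ∀ X Y : B, FiniteDimensional ℂ (X ⟶ Y)
  semisimple : ∀ X : B, ∃ (n : ℕ) (S : Fin n → B) (b : Limits.Bicone S),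
    (∀ i, Simple (S i)) ∧ Nonempty b.IsBilimit ∧ Nonempty (b.pt ≅ X)
  finite_simple : ∃ (n : ℕ) (S : Fin n → B), ∀ X : B, Simple X → ∃ i, Nonempty (X ≅ S i)
  rigid : Nonempty (RigidCategory B)
  simple_unit : Simple (𝟙_ B)
  pointed : ∀ X : B, Simple X → ∃ Y : B, Nonempty (X ⊗ Y ≅ 𝟙_ B)

/-- The abelian group of isomorphism classes of invertible objects; `Skeleton B` is the commutative
monoid of isomorphism classes of objects under `⊗`. -/
abbrev InvClasses (B : Type u) [Category.{v} B] [MonoidalCategory B] [BraidedCategory B] : Type u :=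
  (Skeleton B)ˣ

/-- The function `q` of the pre-metric group: `q a` is the scalar by which the self-braiding of an
object in the class `a` acts. -/
noncomputable def selfBraiding (B : Type u) [Category.{v} B] [Preadditive B] [Linear ℂ B]
    [MonoidalCategory B] [BraidedCategory B] (a : InvClasses B) : ℂ :=
  Classical.epsilon fun z : ℂ =>
    (β_ ((fromSkeleton B).obj (a : Skeleton B)) ((fromSkeleton B).obj (a : Skeleton B))).hom =
      z • 𝟙 _

/-- `O(A, q)`: the automorphisms of `A` that fix `q`. -/
def orthogonalGroup (A : Type u) [CommGroup A] (q : A → ℂ) : Subgroup (MulAut A) where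
  carrier := {σ | ∀ a, q (σ a) = q a}
  one_mem' _ := rfl
  mul_mem' {σ τ} hσ hτ a := (hσ (τ a)).trans (hτ a)
  inv_mem' {σ} hσ a := by
    have h := hσ (σ⁻¹ a)
    rw [MulAut.apply_inv_self] at h
    exact h.symm

/-! ### The group of braided autoequivalences -/

theorem inverse_isMonoidal {C : Type u} [Category.{v} C] [MonoidalCategory C]
    (e : C ≌ C) [e.functor.Monoidal] : letI := e.inverseMonoidal; e.IsMonoidal := by
  let := e.inverseMonoidal
  constructor
  · rfl
  · intro _ _
    rfl

/-- The inverse of a braided equivalence, with its canonical monoidal structure, is braided. -/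
@[reducible] noncomputable def inverseBraided {C : Type u} [Category.{v} C] [MonoidalCategory C]
    [BraidedCategory C] (e : C ≌ C) [e.functor.Braided] : e.inverse.Braided :=
  letI := e.inverseMonoidal
  { braided := fun X Y => by
      have := inverse_isMonoidal e
      apply e.functor.map_injective
      rw [← cancel_mono (e.counitIso.hom.app (Y ⊗ X))]
      have h1 := e.functor_map_μ_inverse_comp_counitIso_hom_app_tensor X Y
      have h2 := e.functor_map_μ_inverse_comp_counitIso_hom_app_tensor Y X
      have h3 : e.functor.map (e.inverse.map (β_ X Y).hom) ≫ e.counitIso.hom.app (Y ⊗ X) =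
          e.counitIso.hom.app (X ⊗ Y) ≫ (β_ X Y).hom :=
        e.counitIso.hom.naturality (β_ X Y).hom
      rw [Functor.map_comp, Functor.map_comp, Category.assoc, Category.assoc, h3, h2,
        reassoc_of% h1, Functor.map_braiding]
      simp }

section Autoequivalences

variable (B : Type u) [Category.{v} B] [Preadditive B] [Linear ℂ B] [MonoidalCategory B]
  [BraidedCategory B]

/-- A `ℂ`-linear braided tensor autoequivalence of `B`. -/
structure BraidedAutoequiv where
  functor : B ⥤ B
  [additive : functor.Additive]
  [linear : functor.Linear ℂ]
  [braided : functor.Braided]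
  [isEquivalence : functor.IsEquivalence]

attribute [instance] BraidedAutoequiv.additive BraidedAutoequiv.linear BraidedAutoequiv.braided
  BraidedAutoequiv.isEquivalence

variable {B}

namespace BraidedAutoequiv

/-- The identity autoequivalence. -/
def refl : BraidedAutoequiv B where
  functor := 𝟭 B

/-- The composite `F ∘ F'`. -/
def comp (F F' : BraidedAutoequiv B) : BraidedAutoequiv B where
  functor := F'.functor ⋙ F.functor

noncomputable def inv (F : BraidedAutoequiv B) : BraidedAutoequiv B :=
  letI : F.functor.asEquivalence.functor.Braided := F.braided
  letI : F.functor.asEquivalence.functor.Additive := F.additive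
  letI : F.functor.asEquivalence.functor.Linear ℂ := F.linear
  { functor := F.functor.asEquivalence.inverse
    additive := inferInstance
    linear := inferInstance
    braided := inverseBraided F.functor.asEquivalence
    isEquivalence := inferInstance }

/-- Equivalence of braided autoequivalences: existence of a tensor natural isomorphism. -/
def Equivalent (F F' : BraidedAutoequiv B) : Prop :=
  ∃ e : F.functor ≅ F'.functor, NatTrans.IsMonoidal e.hom

instance setoid : Setoid (BraidedAutoequiv B) where
  r := Equivalent
  iseqv :=
    { refl := fun F => ⟨Iso.refl _, inferInstanceAs (NatTrans.IsMonoidal (𝟙 F.functor))⟩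
      symm := fun ⟨e, _⟩ => ⟨e.symm, inferInstanceAs (NatTrans.IsMonoidal e.inv)⟩
      trans := fun ⟨e, _⟩ ⟨f, _⟩ =>
        ⟨e ≪≫ f, inferInstanceAs (NatTrans.IsMonoidal (e.hom ≫ f.hom))⟩ }

theorem comp_congr {F F' H H' : BraidedAutoequiv B} (h : F ≈ F') (k : H ≈ H') :
    comp F H ≈ comp F' H' := by
  obtain ⟨e, he⟩ := h
  obtain ⟨f, hf⟩ := k
  exact ⟨NatIso.hcomp f e, inferInstanceAs (NatTrans.IsMonoidal (f.hom ◫ e.hom))⟩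

theorem inv_comp (F : BraidedAutoequiv B) : comp (inv F) F ≈ refl := by
  let : F.functor.asEquivalence.functor.Braided := F.braided
  let := F.functor.asEquivalence.inverseMonoidal
  have := inverse_isMonoidal F.functor.asEquivalence
  have : NatTrans.IsMonoidal F.functor.asEquivalence.unitIso.hom :=
    inferInstanceAs (NatTrans.IsMonoidal F.functor.asEquivalence.unit)
  exact ⟨F.functor.asEquivalence.unitIso.symm,
    inferInstanceAs (NatTrans.IsMonoidal F.functor.asEquivalence.unitIso.inv)⟩

theorem comp_inv (F : BraidedAutoequiv B) : comp F (inv F) ≈ refl := by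
  let : F.functor.asEquivalence.functor.Braided := F.braided
  let := F.functor.asEquivalence.inverseMonoidal
  have := inverse_isMonoidal F.functor.asEquivalence
  exact ⟨F.functor.asEquivalence.counitIso,
    inferInstanceAs (NatTrans.IsMonoidal F.functor.asEquivalence.counit)⟩

theorem comp_assoc (F F' F'' : BraidedAutoequiv B) :
    comp (comp F F') F'' ≈ comp F (comp F' F'') :=
  ⟨(Functor.associator _ _ _).symm, inferInstanceAs (NatTrans.IsMonoidal
    (Functor.associator F''.functor F'.functor F.functor).inv)⟩

theorem refl_comp (F : BraidedAutoequiv B) : comp refl F ≈ F :=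
  ⟨Functor.rightUnitor _, inferInstanceAs (NatTrans.IsMonoidal
    (Functor.rightUnitor F.functor).hom)⟩

theorem comp_refl (F : BraidedAutoequiv B) : comp F refl ≈ F :=
  ⟨Functor.leftUnitor _, inferInstanceAs (NatTrans.IsMonoidal
    (Functor.leftUnitor F.functor).hom)⟩

theorem inv_congr {F F' : BraidedAutoequiv B} (h : F ≈ F') : inv F ≈ inv F' :=
  calc inv F ≈ comp (inv F) refl := Setoid.symm (comp_refl _)
    _ ≈ comp (inv F) (comp F' (inv F')) :=
      comp_congr (Setoid.refl _) (Setoid.symm (comp_inv F'))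
    _ ≈ comp (comp (inv F) F') (inv F') := Setoid.symm (comp_assoc _ _ _)
    _ ≈ comp (comp (inv F) F) (inv F') :=
      comp_congr (comp_congr (Setoid.refl _) (Setoid.symm h)) (Setoid.refl _)
    _ ≈ comp refl (inv F') := comp_congr (inv_comp F) (Setoid.refl _)
    _ ≈ inv F' := refl_comp _

end BraidedAutoequiv

variable (B) in
/-- `Aut_⊗^br(B)`: braided autoequivalences up to tensor natural isomorphism, with multiplication
`[F] * [F'] = [F ∘ F']`. -/
def AutBr : Type _ := Quotient (BraidedAutoequiv.setoid (B := B))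

/-- The class of a braided autoequivalence. -/
def BraidedAutoequiv.toAutBr (F : BraidedAutoequiv B) : AutBr B := Quotient.mk _ F

noncomputable instance AutBr.instGroup : Group (AutBr B) where
  mul := Quotient.map₂ BraidedAutoequiv.comp fun _ _ h _ _ k => BraidedAutoequiv.comp_congr h k
  one := BraidedAutoequiv.refl.toAutBr
  inv := Quotient.map BraidedAutoequiv.inv fun _ _ h => BraidedAutoequiv.inv_congr h
  mul_assoc := by
    rintro ⟨F⟩ ⟨F'⟩ ⟨F''⟩
    exact Quotient.sound (BraidedAutoequiv.comp_assoc F F' F'')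
  one_mul := by
    rintro ⟨F⟩
    exact Quotient.sound (BraidedAutoequiv.refl_comp F)
  mul_one := by
    rintro ⟨F⟩
    exact Quotient.sound (BraidedAutoequiv.comp_refl F)
  inv_mul_cancel := by
    rintro ⟨F⟩
    exact Quotient.sound (BraidedAutoequiv.inv_comp F)

/-- `F` induces the automorphism `σ` of the group of classes of invertible objects. -/
def BraidedAutoequiv.Induces (F : BraidedAutoequiv B) (σ : MulAut (InvClasses B)) : Prop :=
  ∀ (X : B) (a : InvClasses B), toSkeleton X = (a : Skeleton B) →
    toSkeleton (F.functor.obj X) = (σ a : Skeleton B)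

end Autoequivalences

/-! ### Cochains and the group `H³`

Cochains on `A` carry the right `G`-action `f ↦ f ∘ σ(g)`, for `σ : G → Aut(A)`. For a right
`G`-module `M` the inhomogeneous differential is
`(δf)(g₁, …, gₙ₊₁) = f(g₂, …, gₙ₊₁) · ∏ᵢ f(…, gᵢgᵢ₊₁, …)^((-1)^i) · (f(g₁, …, gₙ) · gₙ₊₁)^((-1)^(n+1))`;
the substitution `z ↦ (g₁ ⋯ gₙ) • z(g₁, …, gₙ)` identifies this complex with the usual one for the
corresponding left module. -/

section Cohomology

variable {G : Type w} [Group G] {M : Type u} [CommGroup M] (r : Gᵐᵒᵖ →* Monoid.End M)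

/-- The differential `C¹(G, M) → C²(G, M)` of a right `G`-module. -/
def deltaG₁ (f : G → M) (g h : G) : M :=
  f h * (f (g * h))⁻¹ * r (.op h) (f g)

/-- The differential `C²(G, M) → C³(G, M)` of a right `G`-module. -/
def deltaG₂ (f : G → G → M) (g h l : G) : M :=
  f h l * (f (g * h) l)⁻¹ * f g (h * l) * (r (.op l) (f g h))⁻¹

/-- The differential `C³(G, M) → C⁴(G, M)` of a right `G`-module. -/
def deltaG₃ (f : G → G → G → M) (g h l k : G) : M :=
  f h l k * (f (g * h) l k)⁻¹ * f g (h * l) k * (f g h (l * k))⁻¹ * r (.op k) (f g h l)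

/-- The group `Z³(G, M)` of 3-cocycles. -/
def Z3 : Subgroup (G → G → G → M) where
  carrier := {f | ∀ g h l k, deltaG₃ r f g h l k = 1}
  one_mem' g h l k := by simp [deltaG₃]
  mul_mem' {f f'} hf hf' g h l k := by
    have e : deltaG₃ r (f * f') g h l k = deltaG₃ r f g h l k * deltaG₃ r f' g h l k := by
      simp only [deltaG₃, Pi.mul_apply, map_mul, mul_inv]
      ac_rfl
    rw [e, hf g h l k, hf' g h l k, one_mul]
  inv_mem' {f} hf g h l k := by
    rw [← inv_one, ← hf g h l k]
    simp only [deltaG₃, Pi.inv_apply, map_inv, mul_inv]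

/-- The group `B³(G, M)` of 3-coboundaries. -/
def B3 : Subgroup (G → G → G → M) where
  carrier := {f | ∃ t : G → G → M, f = deltaG₂ r t}
  one_mem' := ⟨1, by ext; simp [deltaG₂]⟩
  mul_mem' := by
    rintro _ _ ⟨t, rfl⟩ ⟨t', rfl⟩
    refine ⟨t * t', ?_⟩
    ext g h l
    simp only [deltaG₂, Pi.mul_apply, map_mul, mul_inv]
    ac_rfl
  inv_mem' := by
    rintro _ ⟨t, rfl⟩
    refine ⟨t⁻¹, ?_⟩
    ext g h l
    simp only [deltaG₂, Pi.inv_apply, map_inv, mul_inv]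

/-- `H³(G, M) = Z³(G, M) / B³(G, M)`. -/
abbrev H3 : Type _ := Z3 r ⧸ (B3 r).subgroupOf (Z3 r)

end Cohomology

section Actions

variable {G : Type w} [Group G] {A : Type u} [CommGroup A] (σ : G →* MulAut A)

/-- The right action of `G` on `C¹(A, U(1))`. -/
def cochainAct₁ : Gᵐᵒᵖ →* Monoid.End (A → Circle) where
  toFun g :=
    { toFun := fun f a => f (σ g.unop a)
      map_one' := rfl
      map_mul' := fun _ _ => rfl }
  map_one' := MonoidHom.ext fun f => funext fun a => congrArg f (by simp)
  map_mul' g h := MonoidHom.ext fun f => funext fun a => congrArg f (by simp)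

/-- The right action of `G` on `C²(A, U(1))`. -/
def cochainAct₂ : Gᵐᵒᵖ →* Monoid.End (A → A → Circle) where
  toFun g :=
    { toFun := fun f a b => f (σ g.unop a) (σ g.unop b)
      map_one' := rfl
      map_mul' := fun _ _ => rfl }
  map_one' := MonoidHom.ext fun f => funext fun a => funext fun b =>
    congrArg₂ f (by simp) (by simp)
  map_mul' g h := MonoidHom.ext fun f => funext fun a => funext fun b =>
    congrArg₂ f (by simp) (by simp)

/-- The right action of `G` on the character group `Â = Hom(A, U(1))`. -/
noncomputable def charAct : Gᵐᵒᵖ →* Monoid.End (A →* Circle) where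
  toFun g :=
    { toFun := fun χ => χ.comp (σ g.unop).toMonoidHom
      map_one' := rfl
      map_mul' := fun _ _ => rfl }
  map_one' := MonoidHom.ext fun χ => MonoidHom.ext fun a => congrArg χ (by simp)
  map_mul' g h := MonoidHom.ext fun χ => MonoidHom.ext fun a => congrArg χ (by simp)

/-- The differential `C¹(A, U(1)) → C²(A, U(1))` (trivial coefficients). -/
noncomputable def deltaA (f : A → Circle) (a b : A) : Circle :=
  f b * (f (a * b))⁻¹ * f a

end Actions

/-! ### The `H³`-obstruction -/

section Obstruction

variable (B : Type u) [Category.{v} B] [Preadditive B] [Linear ℂ B] [MonoidalCategory B]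
  [BraidedCategory B]

/-- An identification `B = Vec_A^{ω,c}` for `A` the group of classes of invertible objects:
representatives `X a` of the classes and isomorphisms `X a ⊗ X b ≅ X (a * b)`, in terms of which the
associator `X a ⊗ (X b ⊗ X d) ⟶ (X a ⊗ X b) ⊗ X d` is `ω a b d ∈ U(1)` and the braiding
`X a ⊗ X b ⟶ X b ⊗ X a` is `c a b ∈ U(1)`. -/
structure VecPresentation where
  X : InvClasses B → B
  class_X : ∀ a, toSkeleton (X a) = (a : Skeleton B)
  μ : ∀ a b, X a ⊗ X b ≅ X (a * b)
  ω : InvClasses B → InvClasses B → InvClasses B → Circle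
  c : InvClasses B → InvClasses B → Circle
  associator_eq : ∀ a b d,
    (α_ (X a) (X b) (X d)).inv ≫ (μ a b).hom ▷ X d ≫ (μ (a * b) d).hom =
      (ω a b d : ℂ) • (X a ◁ (μ b d).hom ≫ (μ a (b * d)).hom ≫
        eqToHom (congrArg X (mul_assoc a b d).symm))
  braiding_eq : ∀ a b,
    (β_ (X a) (X b)).hom ≫ (μ b a).hom =
      (c a b : ℂ) • ((μ a b).hom ≫ eqToHom (congrArg X (mul_comm a b)))

variable {B}
variable {G : Type w} [Group G]

/-- The action on `A` of a homomorphism `G → O(A, q)`. -/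
def actOn {A : Type u} [CommGroup A] {q : A → ℂ} (ρ : G →* orthogonalGroup A q) : G →* MulAut A :=
  (orthogonalGroup A q).subtype.comp ρ

/-- Cochains `ψ : G → C²(A, U(1))` and `θ : G × G → C¹(A, U(1))` such that each
`(ρ g, ψ g)` is a braided autoequivalence of `Vec_A^{ω,c}` and each `θ g h` is a tensor
isomorphism `(ρ g, ψ g) ∘ (ρ h, ψ h) ⟶ (ρ (g * h), ψ (g * h))`. -/
structure VecPresentation.IsCochainLift (P : VecPresentation B)
    (ρ : G →* orthogonalGroup (InvClasses B) (selfBraiding B))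
    (ψ : G → InvClasses B → InvClasses B → Circle) (θ : G → G → InvClasses B → Circle) :
    Prop where
  associator_eq : ∀ g a b d,
    P.ω a b d / P.ω (actOn ρ g a) (actOn ρ g b) (actOn ρ g d) =
      (ψ g b d * ψ g a (b * d)) / (ψ g (a * b) d * ψ g a b)
  braiding_eq : ∀ g a b,
    P.c a b / P.c (actOn ρ g a) (actOn ρ g b) = ψ g a b / ψ g b a
  tensor_eq : ∀ g h,
    deltaG₁ (cochainAct₂ (actOn ρ)) ψ g h = (deltaA (θ g h))⁻¹

/-- The choices entering the `H³`-obstruction of `ρ`: braided autoequivalences `F g` in the class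
of `ρ g` and tensor natural isomorphisms `Θ g h : F g ∘ F h ≅ F (g * h)`. -/
structure FunctorLift (ρ : G →* orthogonalGroup (InvClasses B) (selfBraiding B)) where
  F : G → BraidedAutoequiv B
  induces : ∀ g, (F g).Induces (actOn ρ g)
  Θ : ∀ g h, (F h).functor ⋙ (F g).functor ≅ (F (g * h)).functor
  isMonoidal : ∀ g h, NatTrans.IsMonoidal (Θ g h).hom

/-- `z` is the 3-cochain defined by the square
`F g ∘ F h ∘ F l ⟶ F (g * h) ∘ F l ⟶ F (g * h * l) ⟶ F (g * h * l)` versus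
`F g ∘ F h ∘ F l ⟶ F g ∘ F (h * l) ⟶ F (g * h * l)`, where `χ ∈ Â` is regarded as the tensor
automorphism of a functor which is `χ a` on the image of an object of the class `a`. -/
def FunctorLift.Represents {ρ : G →* orthogonalGroup (InvClasses B) (selfBraiding B)}
    (D : FunctorLift ρ) (z : G → G → G → (InvClasses B →* Circle)) : Prop :=
  ∀ (g h l : G) (X : B) (a : InvClasses B), toSkeleton X = (a : Skeleton B) →
    (D.Θ g h).hom.app ((D.F l).functor.obj X) ≫ (D.Θ (g * h) l).hom.app X ≫
        ((z g h l a : ℂ) • 𝟙 ((D.F (g * h * l)).functor.obj X)) =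
      (D.F g).functor.map ((D.Θ h l).hom.app X) ≫ (D.Θ g (h * l)).hom.app X ≫
        eqToHom (congrArg (fun x => (D.F x).functor.obj X) (mul_assoc g h l).symm)

/-- `κ` is the `H³`-obstruction of `ρ`: the required choices exist, and for every choice the
3-cochain it defines exists, is a cocycle, and has class `κ`. -/
def IsH3Obstruction (ρ : G →* orthogonalGroup (InvClasses B) (selfBraiding B))
    (κ : H3 (charAct (actOn ρ))) : Prop :=
  Nonempty (FunctorLift ρ) ∧
    ∀ D : FunctorLift ρ, ∃ z : Z3 (charAct (actOn ρ)),
      D.Represents z ∧ QuotientGroup.mk z = κ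

end Obstruction

section Consistency

variable {B : Type u} [Category.{v} B] [Abelian B] [Linear ℂ B]
    [MonoidalCategory B] [MonoidalPreadditive B] [MonoidalLinear ℂ B] [BraidedCategory B]
    [IsPointedBraidedFusion B]

/-- `q a` is the self-braiding scalar of every object in the class `a`. -/
theorem selfBraiding_eq {X : B} {a : InvClasses B} (hX : toSkeleton X = (a : Skeleton B)) {z : ℂ}
    (hz : (β_ X X).hom = z • 𝟙 (X ⊗ X)) : selfBraiding B a = z := by
  let Y := (fromSkeleton B).obj (a : Skeleton B)
  have hYa : toSkeleton Y = (a : Skeleton B) := toSkeleton_fromSkeleton_obj _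
  obtain ⟨e⟩ := toSkeleton_eq_toSkeleton_iff.1 (hX.trans hYa.symm)
  have h1 : (β_ Y Y).hom = z • 𝟙 (Y ⊗ Y) := by
    have := BraidedCategory.braiding_naturality e.inv e.inv
    rw [hz] at this
    have h2 : (β_ Y Y).hom = (β_ Y Y).hom ≫ (e.inv ⊗ₘ e.inv) ≫ (e.hom ⊗ₘ e.hom) := by simp
    rw [h2, ← reassoc_of% this]
    simp
  have h3 : (β_ Y Y).hom = selfBraiding B a • 𝟙 (Y ⊗ Y) :=
    Classical.epsilon_spec (p := fun z : ℂ => (β_ Y Y).hom = z • 𝟙 (Y ⊗ Y)) ⟨z, h1⟩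
  have h4 : (selfBraiding B a - z) • 𝟙 (Y ⊗ Y) = 0 := by rw [sub_smul, ← h3, ← h1, sub_self]
  rcases smul_eq_zero.1 h4 with h | h
  · exact sub_eq_zero.1 h
  · exfalso
    let W := (fromSkeleton B).obj ((a⁻¹ * a⁻¹ : InvClasses B) : Skeleton B)
    have hW : toSkeleton ((Y ⊗ Y) ⊗ W) = toSkeleton (𝟙_ B) := by
      rw [Skeleton.toSkeleton_tensorObj, Skeleton.toSkeleton_tensorObj, hYa,
        show toSkeleton W = _ from toSkeleton_fromSkeleton_obj _, ← Skeleton.one_eq,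
        ← Units.val_mul, ← Units.val_mul]
      simp
    obtain ⟨i⟩ := toSkeleton_eq_toSkeleton_iff.1 hW
    have h5 : 𝟙 ((Y ⊗ Y) ⊗ W) = 0 := by
      rw [← id_whiskerRight, h, MonoidalPreadditive.zero_whiskerRight]
    have := IsPointedBraidedFusion.simple_unit (B := B)
    apply id_nonzero (𝟙_ B)
    rw [← i.inv_hom_id, ← Category.id_comp i.hom, h5]
    simp

/-- `q a = c(a, a)`. -/
theorem VecPresentation.c_self (P : VecPresentation B) (a : InvClasses B) :
    selfBraiding B a = P.c a a := by
  apply selfBraiding_eq (P.class_X a)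
  rw [← cancel_mono (P.μ a a).hom, P.braiding_eq]
  simp

end Consistency

/-! Every object is a direct sum of invertible representatives `X a`; these have only scalar
endomorphisms, and there are no nonzero maps between distinct ones. Linear functors and natural
transformations can therefore be prescribed freely on representatives, and all remaining structure
is scalar. After a choice of isomorphisms `X a ⊗ X b ≅ X (a * b)`, the pentagon and hexagons say
that `(ω, c)` is an abelian 3-cocycle; a braided autoequivalence over `σ` is a 2-cochain `ψ` whose
abelian coboundary is the quotient of `(ω, c)` by its pullback along `σ`; a tensor isomorphism is a
1-cochain whose coboundary compares two such 2-cochains.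

Three vanishing results carry the proof. (i) `altCocyclesSplit_of_finite`: with divisible
coefficients, an abelian 3-cocycle with `c a a` trivial is a coboundary. It is proved for free
groups by adding one factor `ℤ` at a time, and then descends along a surjection from `ℤ ^ n` to `A`.
(ii) `exists_symmetric_coboundary`: with divisible coefficients, symmetric 2-cocycles are
coboundaries, because divisible groups are injective. (iii)
`IsAbelianCocycle.exists_real_coboundary`: real abelian 3-cocycles on a finite group are
coboundaries, by averaging.

By (iii) the absolute values of `ω` and `c` can be scaled away, which gives a presentation with
values in `U(1)`. Since `q a = c a a`, an automorphism preserving `q` changes `(ω, c)` by a cocycle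
with trivial quadratic function, so (i) supplies `ψ` and every `σ` in `O(A, q)` is realized. By (ii)
two autoequivalences inducing the same `σ` are isomorphic, and `θ` exists for any family `ψ`.

For the obstruction, `δ_G ψ = (δ_A θ)⁻¹` and `δ_G δ_G = 1` give `δ_A δ_G θ = 1`, so `δ_G θ` is a
cocycle of characters. Realizing `(ρ g, ψ g)` by functors and `θ` by tensor isomorphisms yields one
choice of lifts whose obstruction is exactly `δ_G θ`. For any other choice, isomorphisms `F g ≅ F'
g` are compatible with the tensor isomorphisms up to characters `χ g h`, and the obstruction changes
by `δ_G χ`. -/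

/-! ### Abelian 3-cocycles, coboundaries and normalization -/

section AbelianCocycles

variable {A K M : Type*} [AddCommGroup A] [AddCommGroup K] [AddCommGroup M]

/-- Abelian 3-cocycles in the sense of Eilenberg and MacLane. -/
structure IsAbelianCocycle (ω : A → A → A → M) (c : A → A → M) : Prop where
  pentagon : ∀ a b d e, ω b d e + ω a (b + d) e + ω a b d = ω (a + b) d e + ω a b (d + e)
  hexagon₁ : ∀ a b d, c a (b + d) + ω b a d = c a b + c a d + ω b d a + ω a b d
  hexagon₂ : ∀ a b d, c (a + b) d + ω a b d + ω d a b = c a d + c b d + ω a d b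

/-- `ψ` exhibits `(ω, c)` as the coboundary of an abelian 2-cochain. -/
structure IsAbelianCoboundary (ω : A → A → A → M) (c ψ : A → A → M) : Prop where
  assoc : ∀ a b d, ω a b d = ψ b d + ψ a (b + d) - ψ (a + b) d - ψ a b
  braid : ∀ a b, c a b = ψ a b - ψ b a

theorem IsAbelianCocycle.sub {ω ω' : A → A → A → M} {c c' : A → A → M}
    (H : IsAbelianCocycle ω c) (H' : IsAbelianCocycle ω' c') :
    IsAbelianCocycle (ω - ω') (c - c') where
  pentagon a b d e := by
    have h1 := H.pentagon a b d e
    have h2 := H'.pentagon a b d e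
    simp only [Pi.sub_apply]
    grind
  hexagon₁ a b d := by
    have h1 := H.hexagon₁ a b d
    have h2 := H'.hexagon₁ a b d
    simp only [Pi.sub_apply]
    grind
  hexagon₂ a b d := by
    have h1 := H.hexagon₂ a b d
    have h2 := H'.hexagon₂ a b d
    simp only [Pi.sub_apply]
    grind

theorem IsAbelianCoboundary.isAbelianCocycle {ω : A → A → A → M} {c ψ : A → A → M}
    (h : IsAbelianCoboundary ω c ψ) : IsAbelianCocycle ω c where
  pentagon a b d e := by
    simp only [h.assoc, add_assoc]
    abel
  hexagon₁ a b d := by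
    simp only [h.assoc, h.braid, add_comm a b, add_comm a d]
    abel
  hexagon₂ a b d := by
    simp only [h.assoc, h.braid, add_comm d b, add_comm d a]
    abel

theorem IsAbelianCocycle.comp {ω : A → A → A → M} {c : A → A → M}
    (H : IsAbelianCocycle ω c) (p : K →+ A) :
    IsAbelianCocycle (fun a b d => ω (p a) (p b) (p d)) (fun a b => c (p a) (p b)) where
  pentagon a b d e := by simpa using H.pentagon (p a) (p b) (p d) (p e)
  hexagon₁ a b d := by simpa using H.hexagon₁ (p a) (p b) (p d)
  hexagon₂ a b d := by simpa using H.hexagon₂ (p a) (p b) (p d)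

theorem IsAbelianCoboundary.add {ω ω' : A → A → A → M} {c c' ψ ψ' : A → A → M}
    (h : IsAbelianCoboundary (ω - ω') (c - c') ψ) (h' : IsAbelianCoboundary ω' c' ψ') :
    IsAbelianCoboundary ω c (ψ + ψ') where
  assoc a b d := by
    have h1 := h.assoc a b d
    have h2 := h'.assoc a b d
    simp only [Pi.sub_apply, Pi.add_apply] at *
    grind
  braid a b := by
    have h1 := h.braid a b
    have h2 := h'.braid a b
    simp only [Pi.sub_apply, Pi.add_apply] at *
    grind

/-- The coboundary of a 2-cochain. -/
theorem isAbelianCoboundary_of (ψ : A → A → M) :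
    IsAbelianCoboundary (fun a b d => ψ b d + ψ a (b + d) - ψ (a + b) d - ψ a b)
      (fun a b => ψ a b - ψ b a) ψ :=
  ⟨fun _ _ _ => rfl, fun _ _ => rfl⟩

variable (A M) in
/-- Abelian 3-cocycles on `A` whose quadratic function vanishes are coboundaries. -/
def AltCocyclesSplit : Prop :=
  ∀ (ω : A → A → A → M) (c : A → A → M), IsAbelianCocycle ω c → (∀ a, c a a = 0) →
    ∃ ψ, IsAbelianCoboundary ω c ψ

/-- A reduction step: it suffices to split the cocycle obtained by subtracting a coboundary. -/
theorem exists_coboundary_of_sub {ω : A → A → A → M} {c : A → A → M} (φ : A → A → M)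
    (h : ∃ ψ, IsAbelianCoboundary
      (ω - fun a b d => φ b d + φ a (b + d) - φ (a + b) d - φ a b)
      (c - fun a b => φ a b - φ b a) ψ) :
    ∃ ψ, IsAbelianCoboundary ω c ψ :=
  let ⟨ψ, hψ⟩ := h
  ⟨ψ + φ, hψ.add (isAbelianCoboundary_of φ)⟩

/-- The pentagon at `(a, 0, 0, d)` separates the two variables; this is what allows a single
2-cochain to remove all values with middle entry `0`. -/
theorem IsAbelianCocycle.zero_mid {ω : A → A → A → M} {c : A → A → M}
    (H : IsAbelianCocycle ω c) (a d : A) : ω a 0 d = ω 0 0 d + ω a 0 0 := by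
  have := H.pentagon a 0 0 d
  simp only [add_zero, zero_add] at this
  grind

theorem IsAbelianCocycle.zero_zero_zero {ω : A → A → A → M} {c : A → A → M}
    (H : IsAbelianCocycle ω c) : ω 0 0 0 = 0 := by
  have := H.zero_mid 0 0
  grind

/-- To split all cocycles it is enough to split those which are normalized. -/
theorem altCocyclesSplit_of_normalized
    (h : ∀ (ω : A → A → A → M) (c : A → A → M), IsAbelianCocycle ω c → (∀ a, c a a = 0) →
      (∀ a b, ω 0 a b = 0) → (∀ a b, ω a 0 b = 0) → (∀ a b, ω a b 0 = 0) →
      (∀ a, c a 0 = 0) → (∀ a, c 0 a = 0) → ∃ ψ, IsAbelianCoboundary ω c ψ) :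
    AltCocyclesSplit A M := by
  intro ω c H hc
  -- The coboundary of this cochain at `(a, 0, b)` is `ω 0 0 b + ω a 0 0`, which equals `ω a 0 b`.
  -- The pentagon and the hexagons then propagate the vanishing to the other positions of `0`.
  apply exists_coboundary_of_sub fun a b => ω 0 0 b - ω a 0 0
  have H' := H.sub (isAbelianCoboundary_of fun a b => ω 0 0 b - ω a 0 0).isAbelianCocycle
  have h2 : ∀ a b, (ω - fun a b d => ω 0 0 d - ω b 0 0 + (ω 0 0 (b + d) - ω a 0 0) -
      (ω 0 0 d - ω (a + b) 0 0) - (ω 0 0 b - ω a 0 0)) a 0 b = 0 := by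
    intro a b
    have := H.zero_mid a b
    have := H.zero_zero_zero
    simp only [Pi.sub_apply, zero_add, add_zero]
    grind
  generalize (ω - fun a b d => ω 0 0 d - ω b 0 0 + (ω 0 0 (b + d) - ω a 0 0) -
      (ω 0 0 d - ω (a + b) 0 0) - (ω 0 0 b - ω a 0 0)) = ω' at *
  have h1 : ∀ a b, ω' 0 a b = 0 := by
    intro a b
    have := H'.pentagon 0 0 a b
    simp only [zero_add, h2] at this
    grind
  have h3 : ∀ a b, ω' a b 0 = 0 := by
    intro a b
    have := H'.pentagon a b 0 0
    simp only [add_zero, h2] at this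
    grind
  apply h _ _ H' _ h1 h2 h3
  · intro a
    have := H'.hexagon₁ a 0 0
    simp only [add_zero, h1, h2] at this
    grind
  · intro a
    have := H'.hexagon₂ 0 0 a
    simp only [add_zero, h1, h2] at this
    grind
  · intro a
    simp [hc]

end AbelianCocycles

/-! ### Adding a factor `ℤ` to the group -/

section Splitting

variable {A K M : Type*} [AddCommGroup A] [AddCommGroup K] [AddCommGroup M]

/-- A normalized cocycle on `K × ℤ`, trivial on `K`, with `ω(·, ·, d)` invariant under translations
of `d` by `ℤ`, and trivial on the mixed terms, vanishes. -/
theorem IsAbelianCocycle.eq_zero_of_prod_int {ω : K × ℤ → K × ℤ → K × ℤ → M}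
    {c : K × ℤ → K × ℤ → M} (H : IsAbelianCocycle ω c) (hc : ∀ a, c a a = 0)
    (hω3 : ∀ a b, ω a b 0 = 0)
    (hinv : ∀ a b k (n : ℤ), ω a b (k, n) = ω a b (k, 0))
    (hK : ∀ h k l : K, ω (h, 0) (k, 0) (l, 0) = 0) (hcK : ∀ h k : K, c (h, 0) (k, 0) = 0)
    (hmix : ∀ (k : K) (m : ℤ) d, ω (k, 0) (0, m) d = 0)
    (hcmix : ∀ (m : ℤ) (k : K), c (0, m) (k, 0) = 0) :
    (∀ a b d, ω a b d = 0) ∧ ∀ a b, c a b = 0 := by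
  have hz : ∀ a b (n : ℤ), ω a b (0, n) = 0 := fun a b n => (hinv a b 0 n).trans (hω3 a b)
  have split : ∀ (k : K) (m : ℤ), ((k, m) : K × ℤ) = (k, 0) + (0, m) := by simp
  have split' : ∀ (k : K) (m : ℤ), ((k, m) : K × ℤ) = (0, m) + (k, 0) := by simp
  have addK : ∀ h k : K, ((h, 0) : K × ℤ) + (k, 0) = (h + k, 0) := by simp
  have addZ : ∀ m n : ℤ, ((0, m) : K × ℤ) + (0, n) = (0, m + n) := by simp
  -- In this hexagon all braidings are mixed, one associator has its last entry in `ℤ`, and one is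
  -- covered by `hmix`, so the remaining value must vanish. The next claim uses the other hexagon in
  -- the same way.
  have h1 : ∀ (m : ℤ) (h k : K), ω (0, m) (h, 0) (k, 0) = 0 := by
    intro m h k
    have := H.hexagon₁ (0, m) (h, 0) (k, 0)
    rw [addK, hcmix, hcmix, hcmix, hmix, hz] at this
    grind
  have h2 : ∀ (m n : ℤ) (h : K), ω (0, m) (0, n) (h, 0) = 0 := by
    intro m n h
    have := H.hexagon₂ (0, m) (0, n) (h, 0)
    rw [addZ, hcmix, hcmix, hcmix, hmix, hz] at this
    grind
  -- By `hinv` only last entries in `K` matter. The pentagon now splits the first two entries into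
  -- their components in `K` and `ℤ`, reducing to the cases already settled.
  have h3 : ∀ (k k' : K) (n : ℤ) (h : K), ω (k, 0) (k', n) (h, 0) = 0 := by
    intro k k' n h
    have := H.pentagon (k, 0) (k', 0) (0, n) (h, 0)
    rw [← split, ← split' h n, hinv _ _ h n, hmix, hK, hz, addK, hmix] at this
    grind
  have h4 : ∀ (k : K) (m : ℤ) b (h : K), ω (k, m) b (h, 0) = ω (0, m) b (h, 0) +
      ω (k, 0) ((0, m) + b) (h, 0) := by
    intro k m b h
    have := H.pentagon (k, 0) (0, m) b (h, 0)
    rw [← split, hmix, hmix] at this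
    grind
  have h4' : ∀ (k : K) (m : ℤ) b (h : K), ω (k, m) b (h, 0) = ω (0, m) b (h, 0) := by
    rintro k m ⟨b, n⟩ h
    rw [h4, Prod.mk_add_mk, h3, add_zero]
  have h5 : ∀ (m : ℤ) (k' : K) (n : ℤ) (h : K), ω (0, m) (k', n) (h, 0) = 0 := by
    intro m k' n h
    have := H.pentagon (0, m) (k', 0) (0, n) (h, 0)
    rw [← split, ← split' h n, ← split', hinv _ _ h n, hmix, hz, h1, h4' k' m, h2] at this
    grind
  have hω : ∀ a b d, ω a b d = 0 := by
    rintro ⟨k, m⟩ ⟨k', n⟩ ⟨h, l⟩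
    rw [hinv, h4', h5]
  refine ⟨hω, ?_⟩
  -- Once `ω = 0`, the hexagons say that `c` is biadditive, and `c a a = 0` makes it alternating.
  have add_left : ∀ a b d, c (a + b) d = c a d + c b d := by
    intro a b d
    simpa [hω] using H.hexagon₂ a b d
  have add_right : ∀ a b d, c a (b + d) = c a b + c a d := by
    intro a b d
    simpa [hω] using H.hexagon₁ a b d
  have alt : ∀ a b, c a b + c b a = 0 := by
    intro a b
    have := hc (a + b)
    rw [add_left, add_right, add_right, hc, hc] at this
    grind
  -- An alternating biadditive form on a cyclic group is determined by its value at the generator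
  -- paired with itself.
  have hZ : ∀ m n : ℤ, c (0, m) (0, n) = 0 := by
    intro m n
    let f : ℤ →+ M := AddMonoidHom.mk' (fun m => c (0, m) (0, n)) fun a b => by
      simpa using add_left (0, a) (0, b) (0, n)
    let g : ℤ →+ M := AddMonoidHom.mk' (fun n => c (0, 1) (0, n)) fun a b => by
      simpa using add_right (0, 1) (0, a) (0, b)
    have hg : g n = n • g 1 := by rw [← map_zsmul]; simp
    have hf : f m = m • f 1 := by rw [← map_zsmul]; simp
    have hg1 : g 1 = 0 := hc (0, 1)
    have hf1 : f 1 = 0 := by change g n = 0; rw [hg, hg1, smul_zero]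
    change f m = 0
    rw [hf, hf1, smul_zero]
  rintro ⟨k, m⟩ ⟨h, n⟩
  have e := alt (0, n) (k, 0)
  rw [hcmix, zero_add] at e
  rw [split k m, split h n, add_left, add_right, add_right, hcK, e, hcmix, hZ]
  simp

/-- Integer recursion: sequences with prescribed increments. -/
theorem exists_int_primitive (f : ℤ → M) : ∃ s : ℤ → M, s 0 = 0 ∧ ∀ n, s (n + 1) = s n + f n := by
  refine ⟨fun n => Int.rec (fun n => ∑ i ∈ Finset.range n, f i)
    (fun n => -∑ i ∈ Finset.range (n + 1), f (-i - 1)) n,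
    Finset.sum_range_zero (fun i : ℕ => f i), fun n => ?_⟩
  rcases n with n | n
  · exact Finset.sum_range_succ (fun i : ℕ => f i) n
  · rcases n with - | n
    · change (∑ i ∈ Finset.range 0, f i : M) = _
      simp
    · have e : Int.negSucc (n + 1) + 1 = Int.negSucc n := by omega
      rw [e]
      change -_ = -_ + _
      rw [Finset.sum_range_succ _ (n + 1)]
      have e' : -((n + 1 : ℕ) : ℤ) - 1 = Int.negSucc (n + 1) := by omega
      rw [e']
      abel

/-- Three successive coboundaries bring the cocycle into the shape required by
`IsAbelianCocycle.eq_zero_of_prod_int`. The second and third cochains depend on their second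
argument only through its component in `K`, so they preserve the invariance in the third variable
achieved by the first. -/
theorem altCocyclesSplit_prod_int (hK : AltCocyclesSplit K M) : AltCocyclesSplit (K × ℤ) M := by
  apply altCocyclesSplit_of_normalized
  intro ω c H hc n1 n2 n3 nc1 nc2
  -- make `ω` invariant in the third variable
  have key : ∀ a k, ∃ s : ℤ → M, s 0 = 0 ∧ ∀ n, s (n + 1) = s n + ω a (k, n) (0, 1) :=
    fun a k => exists_int_primitive _
  choose s s0 s1 using key
  have hs0 : ∀ a k, s a k 0 = 0 := s0
  have hsz : ∀ k n, s 0 k n = 0 := by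
    intro k n
    induction n using Int.induction_on with
    | zero => exact s0 _ _
    | succ n ih => rw [s1, ih, n1, add_zero]
    | pred n ih =>
      have := s1 0 k (-n - 1)
      rw [n1, sub_add_cancel, ih] at this
      grind
  have hs01 : ∀ a, s a 0 1 = 0 := by
    intro a
    have := s1 a 0 0
    rw [s0] at this
    have e : ω a (0, 0) (0, 1) = 0 := n2 _ _
    rw [zero_add] at this
    rw [this, e, zero_add]
  -- Since `s x 0 1 = 0`, the coboundary at `(a, (k, n), (0, 1))` is `s a k (n + 1) - s a k n`,
  -- which is `ω a (k, n) (0, 1)` by the choice of increments.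
  apply exists_coboundary_of_sub fun a b => s a b.1 b.2
  have H' := H.sub (isAbelianCoboundary_of fun a b => s a b.1 b.2).isAbelianCocycle
  have hc' : ∀ a, (c - fun a b => s a b.1 b.2 - s b a.1 a.2) a a = 0 := by simp [hc]
  have hx : ∀ a b, (ω - fun a b d => s b d.1 d.2 + s a (b + d).1 (b + d).2 -
      s (a + b) d.1 d.2 - s a b.1 b.2) a b (0, 1) = 0 := by
    rintro a ⟨b, n⟩
    simp only [Pi.sub_apply, hs01, Prod.mk_add_mk, add_zero, s1]
    abel
  have n2' : ∀ a b, (ω - fun a b d => s b d.1 d.2 + s a (b + d).1 (b + d).2 -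
      s (a + b) d.1 d.2 - s a b.1 b.2) a 0 b = 0 := by
    intro a b
    simp [n2, hs0, hsz]
  have n3' : ∀ a b, (ω - fun a b d => s b d.1 d.2 + s a (b + d).1 (b + d).2 -
      s (a + b) d.1 d.2 - s a b.1 b.2) a b 0 = 0 := by
    intro a b
    simp [n3, hs0]
  clear nc1 nc2 n1 n2 n3
  generalize (ω - fun a b d => s b d.1 d.2 + s a (b + d).1 (b + d).2 -
      s (a + b) d.1 d.2 - s a b.1 b.2) = ω₁ at *
  generalize (c - fun a b => s a b.1 b.2 - s b a.1 a.2) = c₁ at *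
  -- The pentagon with last entry `(0, 1)` keeps only two terms, the values of `ω₁` before and after
  -- the translation.
  have hinv1 : ∀ a b d, ω₁ a b (d + (0, 1)) = ω₁ a b d := by
    intro a b d
    have := H'.pentagon a b d (0, 1)
    rw [hx, hx, hx] at this
    grind
  have hinv : ∀ a b k (n : ℤ), ω₁ a b (k, n) = ω₁ a b (k, 0) := by
    intro a b k n
    induction n using Int.induction_on with
    | zero => rfl
    | succ n ih => rw [← ih, ← hinv1 _ _ (k, (n : ℤ))]; simp
    | pred n ih => rw [← ih, ← hinv1]; simp
  clear hx hinv1 hsz hs01 hs0 s1 s0 s H hc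
  -- make the cocycle trivial on `K`
  obtain ⟨ψ, hψ⟩ := hK _ _ (H'.comp (AddMonoidHom.inl K ℤ)) fun a => hc' _
  simp only [AddMonoidHom.inl_apply] at hψ
  have ψ0 : ∀ a, ψ 0 a = ψ 0 0 := by
    intro a
    have h1 := hψ.assoc 0 0 a
    have h2 : ω₁ (0, 0) (0, 0) (a, 0) = 0 := n2' _ _
    rw [h2] at h1
    simp only [zero_add] at h1
    grind
  have ψ0' : ∀ a, ψ a 0 = ψ 0 0 := by
    intro a
    have h1 := hψ.assoc a 0 0
    have h2 : ω₁ (a, 0) (0, 0) (0, 0) = 0 := n2' _ _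
    rw [h2] at h1
    simp only [add_zero] at h1
    grind
  -- Subtracting the constant makes the cochain vanish as soon as one argument has trivial
  -- `K`-component, so the normalization survives.
  apply exists_coboundary_of_sub fun a b => ψ a.1 b.1 - ψ 0 0
  have H := H'.sub (isAbelianCoboundary_of fun a b : K × ℤ => ψ a.1 b.1 - ψ 0 0).isAbelianCocycle
  have hc : ∀ a, (c₁ - fun a b : K × ℤ => ψ a.1 b.1 - ψ 0 0 - (ψ b.1 a.1 - ψ 0 0)) a a = 0 := by
    simp [hc']
  have hK : ∀ h k l : K, (ω₁ - fun a b d : K × ℤ => ψ b.1 d.1 - ψ 0 0 + (ψ a.1 (b + d).1 - ψ 0 0) -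
      (ψ (a + b).1 d.1 - ψ 0 0) - (ψ a.1 b.1 - ψ 0 0)) (h, 0) (k, 0) (l, 0) = 0 := by
    intro h k l
    simp only [Pi.sub_apply, hψ.assoc, Prod.mk_add_mk]
    abel
  have hcK : ∀ h k : K, (c₁ - fun a b : K × ℤ => ψ a.1 b.1 - ψ 0 0 - (ψ b.1 a.1 - ψ 0 0))
      (h, 0) (k, 0) = 0 := by
    intro h k
    simp only [Pi.sub_apply, hψ.braid]
    abel
  have n2 : ∀ a b, (ω₁ - fun a b d : K × ℤ => ψ b.1 d.1 - ψ 0 0 + (ψ a.1 (b + d).1 - ψ 0 0) -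
      (ψ (a + b).1 d.1 - ψ 0 0) - (ψ a.1 b.1 - ψ 0 0)) a 0 b = 0 := by
    intro a b
    simp [n2', ψ0 b.1, ψ0']
  have n3 : ∀ a b, (ω₁ - fun a b d : K × ℤ => ψ b.1 d.1 - ψ 0 0 + (ψ a.1 (b + d).1 - ψ 0 0) -
      (ψ (a + b).1 d.1 - ψ 0 0) - (ψ a.1 b.1 - ψ 0 0)) a b 0 = 0 := by
    intro a b
    simp [n3', ψ0']
  have hinv' : ∀ a b k (n : ℤ), (ω₁ - fun a b d : K × ℤ => ψ b.1 d.1 - ψ 0 0 +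
      (ψ a.1 (b + d).1 - ψ 0 0) - (ψ (a + b).1 d.1 - ψ 0 0) - (ψ a.1 b.1 - ψ 0 0)) a b (k, n) =
      (ω₁ - fun a b d : K × ℤ => ψ b.1 d.1 - ψ 0 0 +
      (ψ a.1 (b + d).1 - ψ 0 0) - (ψ (a + b).1 d.1 - ψ 0 0) - (ψ a.1 b.1 - ψ 0 0)) a b (k, 0) := by
    intro a b k n
    simp [hinv a b k n]
  generalize (ω₁ - fun a b d : K × ℤ => ψ b.1 d.1 - ψ 0 0 + (ψ a.1 (b + d).1 - ψ 0 0) -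
      (ψ (a + b).1 d.1 - ψ 0 0) - (ψ a.1 b.1 - ψ 0 0)) = ω at *
  generalize (c₁ - fun a b : K × ℤ => ψ a.1 b.1 - ψ 0 0 - (ψ b.1 a.1 - ψ 0 0)) = c at *
  clear hinv n2' n3' H' hc' hψ ψ0 ψ0'
  -- make the mixed terms trivial
  have z2 : ∀ a b (n : ℤ), ω a b (0, n) = 0 := fun a b n => (hinv' a b 0 n).trans (n3 a b)
  have z0 : ∀ a (b : K × ℤ), ω a (0, 0) b = 0 := n2
  have c1 : ∀ a, c a (0, 0) = 0 := by
    intro a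
    have := H.hexagon₁ a 0 0
    have e1 : ω 0 0 a = 0 := n2 0 a
    have e2 : ω 0 a 0 = 0 := n3 0 a
    simp only [add_zero, n3, e1] at this
    change c a 0 = 0
    grind
  have c2 : ∀ a, c (0, 0) a = 0 := by
    intro a
    have := H.hexagon₂ 0 0 a
    have e1 : ω 0 0 a = 0 := n2 0 a
    have e2 : ω 0 a 0 = 0 := n3 0 a
    simp only [add_zero, n3, e1] at this
    change c 0 a = 0
    grind
  -- The braiding term removes `c (0, m) (k, 0)`, and the associator term removes `ω (k, 0) (0, m)
  -- d`. The resulting cocycle is zero, hence the cochain `0` below.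
  apply exists_coboundary_of_sub fun a b => c (0, a.2) (b.1, 0) - ω (a.1, 0) (0, a.2) (b.1, 0)
  have H2 := H.sub (isAbelianCoboundary_of
    fun a b => c (0, a.2) (b.1, 0) - ω (a.1, 0) (0, a.2) (b.1, 0)).isAbelianCocycle
  refine ⟨0, ?_⟩
  have fin := H2.eq_zero_of_prod_int (by simp [hc])
    (by simp [n3, c1, z2]) (by intro a b k n; simp [hinv' a b k n])
    (by intro h k l; simp [hK, c2]) (by intro h k; simp [hcK, z0])
    (by
      rintro k m ⟨d, n⟩
      have h1 : ∀ a b, ω ((0, a) : K × ℤ) (0, b) (d, 0) = ω (0, a) (0, b) (d, 0) := fun _ _ => rfl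
      have h2 : ω (0, 0) (0, m) (d, 0) = 0 := by
        have e := H.pentagon 0 0 (0, m) (d, 0)
        have e1 : ω 0 0 (0, m) = 0 := n2 _ _
        have e2 : ω 0 0 ((0, m) + (d, 0)) = 0 := n2 _ _
        rw [zero_add, zero_add, e1, e2] at e
        change ω 0 (0, m) (d, 0) = 0
        grind
      simp [hinv' _ _ d n, h2, c2, z0])
    (by
      intro m k
      have h2 : ω (0, 0) (0, m) (k, 0) = 0 := by
        have e := H.pentagon 0 0 (0, m) (k, 0)
        have e1 : ω 0 0 (0, m) = 0 := n2 _ _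
        have e2 : ω 0 0 ((0, m) + (k, 0)) = 0 := n2 _ _
        rw [zero_add, zero_add, e1, e2] at e
        change ω 0 (0, m) (k, 0) = 0
        grind
      simp [h2, c2, z0])
  exact ⟨fun a b d => by rw [fin.1]; simp, fun a b => by rw [fin.2]; simp⟩

end Splitting

/-! ### Descent along surjections; divisible and real coefficients -/

section Divisible

variable {A K M : Type*} [AddCommGroup A] [AddCommGroup K] [AddCommGroup M]

/-- The underlying type of an extension of `A` by `M`. -/
@[ext] structure ExtensionPair (A M : Type*) where
  base : A
  fiber : M

/-- The abelian extension of `A` by `M` defined by a symmetric 2-cocycle. -/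
@[reducible] def symmetricExtension (f : A → A → M)
    (hf : ∀ a b d, f b d + f a (b + d) = f (a + b) d + f a b)
    (hs : ∀ a b, f a b = f b a) (h0 : f 0 0 = 0) : AddCommGroup (ExtensionPair A M) :=
  have h0' : ∀ a, f 0 a = 0 := fun a => by
    have := hf 0 0 a
    rw [zero_add, zero_add, h0] at this
    grind
  letI : Add (ExtensionPair A M) :=
    ⟨fun x y => ⟨x.base + y.base, x.fiber + y.fiber + f x.base y.base⟩⟩
  letI : Zero (ExtensionPair A M) := ⟨⟨0, 0⟩⟩
  letI : Neg (ExtensionPair A M) := ⟨fun x => ⟨-x.base, -x.fiber - f x.base (-x.base)⟩⟩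
  { AddGroup.ofLeftAxioms (G := ExtensionPair A M)
      (fun x y z => ExtensionPair.ext (add_assoc _ _ _) (by
        change x.fiber + y.fiber + f x.base y.base + z.fiber + f (x.base + y.base) z.base =
          x.fiber + (y.fiber + z.fiber + f y.base z.base) + f x.base (y.base + z.base)
        have := hf x.base y.base z.base
        grind))
      (fun x => ExtensionPair.ext (zero_add _) (by
        change 0 + x.fiber + f 0 x.base = x.fiber
        rw [h0', zero_add, add_zero]))
      (fun x => ExtensionPair.ext (neg_add_cancel _) (by
        change -x.fiber - f x.base (-x.base) + x.fiber + f (-x.base) x.base = 0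
        rw [hs (-x.base)]
        abel)) with
    add_comm := fun x y => ExtensionPair.ext (add_comm _ _) (by
      change x.fiber + y.fiber + f x.base y.base = y.fiber + x.fiber + f y.base x.base
      rw [hs, add_comm x.fiber]) }

/-- Symmetric 2-cocycles with divisible coefficients are coboundaries. -/
theorem exists_symmetric_coboundary [DivisibleBy M ℤ] (f : A → A → M)
    (hf : ∀ a b d, f b d + f a (b + d) = f (a + b) d + f a b)
    (hs : ∀ a b, f a b = f b a) : ∃ η : A → M, ∀ a b, f a b = η a + η b - η (a + b) := by
  have hf' : ∀ a b d, f b d - f 0 0 + (f a (b + d) - f 0 0) =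
      f (a + b) d - f 0 0 + (f a b - f 0 0) := by
    intro a b d
    have := hf a b d
    grind
  have h0 : ∀ a, f 0 a - f 0 0 = 0 := fun a => by
    have := hf 0 0 a
    rw [zero_add, zero_add] at this
    grind
  let := symmetricExtension (fun a b => f a b - f 0 0) hf' (fun a b => by rw [hs]) (sub_self _)
  let i : M →+ ExtensionPair A M := AddMonoidHom.mk' (fun m => ⟨0, m⟩) fun m n =>
    ExtensionPair.ext (add_zero _).symm (by
      change m + n = m + n + (f 0 0 - f 0 0)
      rw [sub_self, add_zero])
  have hi : Function.Injective i := fun m n h => congrArg ExtensionPair.fiber h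
  -- The divisible group `M` is injective, so its embedding in the extension has a retraction.
  obtain ⟨r, hr⟩ := (Module.Baer.of_divisible M).extension_property_addMonoidHom i hi
    (AddMonoidHom.id M)
  have hr' : ∀ m, r ⟨0, m⟩ = m := fun m => DFunLike.congr_fun hr m
  -- The extension was built from `f - f 0 0`; the constant `f 0 0` is its own coboundary and is
  -- added back here.
  refine ⟨fun a => r ⟨a, 0⟩ + f 0 0, fun a b => ?_⟩
  have e1 : (⟨a, 0⟩ : ExtensionPair A M) + ⟨b, 0⟩ = ⟨a + b, f a b - f 0 0⟩ :=
    ExtensionPair.ext rfl (by change 0 + 0 + (f a b - f 0 0) = _; simp)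
  have e2 : (⟨0, f a b - f 0 0⟩ : ExtensionPair A M) + ⟨a + b, 0⟩ = ⟨a + b, f a b - f 0 0⟩ :=
    ExtensionPair.ext (zero_add _) (by
      change f a b - f 0 0 + 0 + (f 0 (a + b) - f 0 0) = _
      rw [h0]
      simp)
  have e := congrArg r (e1.trans e2.symm)
  rw [map_add, map_add, hr'] at e
  grind

/-- A cochain splitting the pullback to `K` restricts to a symmetric 2-cocycle on the kernel,
because the cocycle is normalized. Divisibility makes this restriction a coboundary, so the cochain
can be corrected to vanish on the kernel and then descended through a set-theoretic section. -/
theorem AltCocyclesSplit.of_surjective [DivisibleBy M ℤ] (hK : AltCocyclesSplit K M)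
    (p : K →+ A) (hp : Function.Surjective p) : AltCocyclesSplit A M := by
  apply altCocyclesSplit_of_normalized
  intro ω c H hc n1 n2 n3 nc1 nc2
  obtain ⟨φ₀, hφ₀⟩ := hK _ _ (H.comp p) fun a => hc _
  -- normalize the cochain on the kernel
  obtain ⟨η, hη⟩ := exists_symmetric_coboundary (A := p.ker) (fun r s => φ₀ r s)
    (by
      intro r s t
      have := hφ₀.assoc r s t
      rw [p.mem_ker.1 r.2, n1] at this
      push_cast
      grind)
    (by
      intro r s
      have := hφ₀.braid r s
      rw [p.mem_ker.1 r.2, nc2] at this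
      grind)
  classical
  -- Off the kernel any extension of `η` serves. The symmetric coboundary of a 1-cochain has trivial
  -- abelian coboundary, so subtracting it from `φ₀` still splits the pullback.
  let ζ : K → M := fun k => if h : k ∈ p.ker then η ⟨k, h⟩ else 0
  have hζ : ∀ r s : K, p r = 0 → p s = 0 → φ₀ r s = ζ r + ζ s - ζ (r + s) := by
    intro r s hr hs
    have h1 : r ∈ p.ker := p.mem_ker.2 hr
    have h2 : s ∈ p.ker := p.mem_ker.2 hs
    have h3 : r + s ∈ p.ker := add_mem h1 h2
    simp only [ζ, dif_pos h1, dif_pos h2, dif_pos h3]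
    exact hη ⟨r, h1⟩ ⟨s, h2⟩
  obtain ⟨φ, hφ, hφR⟩ : ∃ φ, IsAbelianCoboundary (fun a b d => ω (p a) (p b) (p d))
      (fun a b => c (p a) (p b)) φ ∧ ∀ r s, p r = 0 → p s = 0 → φ r s = 0 := by
    refine ⟨fun k l => φ₀ k l - (ζ k + ζ l - ζ (k + l)), ⟨fun a b d => ?_, fun a b => ?_⟩,
      fun r s hr hs => sub_eq_zero.2 (hζ r s hr hs)⟩
    · have := hφ₀.assoc a b d
      simp only [add_assoc] at *
      grind
    · have := hφ₀.braid a b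
      simp only [add_comm b a] at *
      grind
  clear hζ ζ hη η hφ₀ φ₀
  choose u hu using hp
  have hr : ∀ a b, p (u a + u b - u (a + b)) = 0 := by simp [hu]
  obtain ⟨r, hr'⟩ : ∃ r : A → A → K, ∀ a b, r a b = u a + u b - u (a + b) := ⟨_, fun _ _ => rfl⟩
  simp only [← hr'] at hr
  have rsymm : ∀ a b, r a b = r b a := by
    intro a b
    rw [hr', hr', add_comm a b, add_comm (u a)]
  have ru : ∀ a b, u a + u b = r a b + u (a + b) := by
    intro a b
    rw [hr', sub_add_cancel]
  have φsymm : ∀ r k, p r = 0 → φ r k = φ k r := by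
    intro r k h
    have := hφ.braid r k
    simp only [h, nc2] at this
    grind
  -- A kernel element in the first or second place makes the pulled-back associator trivial, so it
  -- can be moved through `φ` as if `φ` were a 2-cocycle.
  have shift : ∀ r k l, p r = 0 → φ k l + φ r (k + l) = φ (r + k) l + φ r k := by
    intro r k l h
    have := hφ.assoc r k l
    simp only [h, n1] at this
    grind
  have shift' : ∀ r k l, p r = 0 → φ r l + φ k (r + l) = φ k l + φ r (k + l) := by
    intro r k l h
    have h1 := hφ.assoc k r l
    simp only [h, n2] at h1
    have h2 := shift r k l h
    rw [φsymm r k h, add_comm r k] at h2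
    grind
  -- The section `u` is additive only up to the kernel-valued defect `r`; the second term
  -- compensates for it. The `φ` values with both arguments in the kernel that arise on the two
  -- sides vanish by `hφR`.
  refine ⟨fun a b => φ (u a) (u b) - φ (r a b) (u (a + b)), fun a b d => ?_, fun a b => ?_⟩
  · have hr3 : r a b + r (a + b) d = r b d + r a (b + d) := by
      simp only [hr', add_assoc]
      abel
    have e1 := hφ.assoc (u a) (u b) (u d)
    simp only [hu] at e1
    have e2 := shift (r a b) (u (a + b)) (u d) (hr _ _)
    rw [← ru, ru (a + b) d] at e2
    have e3 := shift (r a b) (r (a + b) d) (u (a + b + d)) (hr _ _)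
    rw [hφR _ _ (hr _ _) (hr _ _), hr3] at e3
    have e4 := shift' (r b d) (u a) (u (b + d)) (hr _ _)
    rw [← ru, ru a (b + d)] at e4
    have e5 := shift (r b d) (r a (b + d)) (u (a + (b + d))) (hr _ _)
    rw [hφR _ _ (hr _ _) (hr _ _)] at e5
    rw [add_assoc] at *
    grind
  · have := hφ.braid (u a) (u b)
    simp only [hu] at this
    rw [this, rsymm a b, add_comm a b]
    abel

theorem altCocyclesSplit_of_subsingleton [Subsingleton A] : AltCocyclesSplit A M := by
  intro ω c H hc
  refine ⟨0, fun a b d => ?_, fun a b => ?_⟩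
  · rw [Subsingleton.elim a 0, Subsingleton.elim b 0, Subsingleton.elim d 0, H.zero_zero_zero]
    simp
  · rw [Subsingleton.elim a b, hc]
    simp

theorem altCocyclesSplit_pi_int [DivisibleBy M ℤ] : ∀ n : ℕ, AltCocyclesSplit (Fin n → ℤ) M
  | 0 => altCocyclesSplit_of_subsingleton
  | n + 1 => (altCocyclesSplit_prod_int (altCocyclesSplit_pi_int n)).of_surjective
      (AddMonoidHom.mk' (fun x : (Fin n → ℤ) × ℤ => (Fin.cons x.2 x.1 : Fin (n + 1) → ℤ))
        fun x y => funext fun i => by refine Fin.cases ?_ (fun i => ?_) i <;> simp)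
      fun f => ⟨(Fin.tail f, f 0), Fin.cons_self_tail f⟩

/-- **Eilenberg-MacLane.** An abelian 3-cocycle on a finite abelian group with divisible
coefficients, whose quadratic function vanishes, is a coboundary. -/
theorem altCocyclesSplit_of_finite [Finite A] [DivisibleBy M ℤ] : AltCocyclesSplit A M := by
  obtain ⟨n, f, hf⟩ := Module.Finite.exists_fin' ℤ A
  exact (altCocyclesSplit_pi_int n).of_surjective f.toAddMonoidHom hf

/-- Abelian 3-cocycles of a finite abelian group with real coefficients are coboundaries. -/
theorem IsAbelianCocycle.exists_real_coboundary [Finite A] {ω : A → A → A → ℝ} {c : A → A → ℝ}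
    (H : IsAbelianCocycle ω c) : ∃ ψ, IsAbelianCoboundary ω c ψ := by
  have := Fintype.ofFinite A
  have hN : (Fintype.card A : ℝ) ≠ 0 := by simp
  -- Averaging the pentagon over its last variable, where translation by `d` does not change the
  -- sum, exhibits `ω` as the coboundary of `-S`.
  let S : A → A → ℝ := fun a b => (∑ e, ω a b e) / Fintype.card A
  have hS : ∀ a b d, ω a b d = S (a + b) d + S a b - S b d - S a (b + d) := by
    intro a b d
    have h := Finset.sum_congr (rfl : Finset.univ = Finset.univ)
      fun e _ => H.pentagon a b d e
    simp only [Finset.sum_add_distrib, Finset.sum_const, Finset.card_univ, nsmul_eq_mul] at h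
    have h' : ∑ e, ω a b (d + e) = ∑ e, ω a b e := Equiv.sum_comp (Equiv.addLeft d) (ω a b)
    rw [h'] at h
    simp only [S]
    field_simp
    linarith
  let ψ : A → A → ℝ := fun a b => -S a b
  refine ⟨ψ, fun a b d => by rw [hS]; simp only [ψ]; ring, ?_⟩
  have H' := H.sub (isAbelianCoboundary_of ψ).isAbelianCocycle
  have hω : (ω - fun a b d => ψ b d + ψ a (b + d) - ψ (a + b) d - ψ a b) = 0 := by
    ext a b d
    simp only [Pi.sub_apply, hS a b d, ψ, Pi.zero_apply]
    ring
  rw [hω] at H'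
  intro a b
  -- With the associator removed, the hexagon makes `c` additive in its first variable; a
  -- homomorphism from a finite group to `ℝ` is zero.
  let f : A →+ ℝ := AddMonoidHom.mk' (fun a => (c - fun a b => ψ a b - ψ b a) a b) fun x y => by
    simpa using H'.hexagon₂ x y b
  have h0 : f a = 0 := by
    have : Fintype.card A • f a = 0 := by rw [← map_nsmul, card_nsmul_eq_zero, map_zero]
    simpa using this
  exact sub_eq_zero.1 h0

end Divisible

/-! ### Invertible objects: scalars, simplicity, finiteness, decompositions -/

section Invertible

variable {B : Type u} [Category.{v} B]

theorem class_congr {X Y : B} (e : X ≅ Y) : toSkeleton X = toSkeleton Y :=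
  toSkeleton_eq_toSkeleton_iff.2 ⟨e⟩

variable [MonoidalCategory B] [BraidedCategory B]

theorem exists_iso_of_class {X Y : B} {a : InvClasses B} (hX : toSkeleton X = (a : Skeleton B))
    (hY : toSkeleton Y = (a : Skeleton B)) : Nonempty (X ≅ Y) :=
  toSkeleton_eq_toSkeleton_iff.1 (hX.trans hY.symm)

theorem class_tensor {X Y : B} {a b : InvClasses B} (hX : toSkeleton X = (a : Skeleton B))
    (hY : toSkeleton Y = (b : Skeleton B)) :
    toSkeleton (X ⊗ Y) = ((a * b : InvClasses B) : Skeleton B) := by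
  rw [Skeleton.toSkeleton_tensorObj, hX, hY, Units.val_mul]

theorem class_unit : toSkeleton (𝟙_ B) = ((1 : InvClasses B) : Skeleton B) := by
  rw [Units.val_one, Skeleton.one_eq]

theorem exists_tensor_inverse {X : B} {a : InvClasses B} (hX : toSkeleton X = (a : Skeleton B)) :
    ∃ W : B, Nonempty (X ⊗ W ≅ 𝟙_ B) := by
  refine ⟨(fromSkeleton B).obj ((a⁻¹ : InvClasses B) : Skeleton B), ?_⟩
  apply exists_iso_of_class (a := 1) _ class_unit
  rw [← mul_inv_cancel a]
  exact class_tensor hX (toSkeleton_fromSkeleton_obj _)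

theorem exists_class_of_tensor_inverse {X W : B} (h : X ⊗ W ≅ 𝟙_ B) :
    ∃ a : InvClasses B, toSkeleton X = (a : Skeleton B) := by
  have h1 : toSkeleton X * toSkeleton W = 1 := by
    rw [← Skeleton.toSkeleton_tensorObj, class_congr h, Skeleton.one_eq]
  exact ⟨Units.mkOfMulEqOne _ _ h1, rfl⟩

/-- Tensoring once more with an inverse `W` of `X` and conjugating by `U ⊗ (X ⊗ W) ≅ U` recovers the
original morphism. -/
theorem whiskerRight_injective_of_class {X : B} {a : InvClasses B}
    (hX : toSkeleton X = (a : Skeleton B)) {U V : B} {f g : U ⟶ V} (h : f ▷ X = g ▷ X) :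
    f = g := by
  obtain ⟨W, ⟨i⟩⟩ := exists_tensor_inverse hX
  have key : ∀ f : U ⟶ V, f = (ρ_ U).inv ≫ U ◁ i.inv ≫ (α_ U X W).inv ≫ (f ▷ X) ▷ W ≫
      (α_ V X W).hom ≫ V ◁ i.hom ≫ (ρ_ V).hom := by
    intro f
    rw [associator_naturality_left_assoc, Iso.inv_hom_id_assoc, ← whisker_exchange_assoc]
    simp
  rw [key f, key g, h]

variable [Abelian B] [Linear ℂ B] [MonoidalPreadditive B] [MonoidalLinear ℂ B]
  [IsPointedBraidedFusion B]

theorem id_ne_zero_of_class {X : B} {a : InvClasses B} (hX : toSkeleton X = (a : Skeleton B)) :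
    𝟙 X ≠ 0 := by
  intro h
  obtain ⟨W, ⟨i⟩⟩ := exists_tensor_inverse hX
  have := IsPointedBraidedFusion.simple_unit (B := B)
  apply id_nonzero (𝟙_ B)
  have h1 : 𝟙 (X ⊗ W) = 0 := by
    rw [← id_whiskerRight, h, MonoidalPreadditive.zero_whiskerRight]
  rw [← i.inv_hom_id, ← Category.id_comp i.hom, h1]
  simp

/-- Tensoring with an inverse turns an endomorphism of `X` into one of the simple unit object, which
is a scalar by Schur's lemma. -/
theorem exists_eq_smul_id {X : B} {a : InvClasses B} (hX : toSkeleton X = (a : Skeleton B))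
    (f : X ⟶ X) : ∃ z : ℂ, f = z • 𝟙 X := by
  obtain ⟨W, ⟨i⟩⟩ := exists_tensor_inverse hX
  have := IsPointedBraidedFusion.simple_unit (B := B)
  have := IsPointedBraidedFusion.finite_hom (𝟙_ B) (𝟙_ B)
  obtain ⟨z, hz⟩ := endomorphism_simple_eq_smul_id ℂ (i.inv ≫ f ▷ W ≫ i.hom)
  refine ⟨z, ?_⟩
  have h1 : f ▷ W = (z • 𝟙 X) ▷ W := by
    rw [MonoidalLinear.smul_whiskerRight, id_whiskerRight]
    have h2 : i.hom ≫ (z • 𝟙 (𝟙_ B)) ≫ i.inv = z • 𝟙 (X ⊗ W) := by simp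
    rw [← h2, hz]
    simp
  -- Cancelling `W` requires `W` to be invertible as well; the braiding turns `X ⊗ W ≅ 𝟙_ B` around.
  obtain ⟨b, hb⟩ := exists_class_of_tensor_inverse ((β_ W X) ≪≫ i)
  exact whiskerRight_injective_of_class hb h1

theorem smul_left_injective_of_class {X Y : B} {a : InvClasses B}
    (hX : toSkeleton X = (a : Skeleton B)) {f : X ⟶ Y} [IsIso f] {y z : ℂ} (h : y • f = z • f) :
    y = z := by
  have h1 : (y - z) • 𝟙 X = 0 := by
    rw [← IsIso.hom_inv_id f, ← Linear.smul_comp, sub_smul, h, sub_self, Limits.zero_comp]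
  rcases smul_eq_zero.1 h1 with h | h
  · exact sub_eq_zero.1 h
  · exact absurd h (id_ne_zero_of_class hX)

theorem exists_eq_smul {X Y : B} {a : InvClasses B} (hX : toSkeleton X = (a : Skeleton B))
    (f g : X ⟶ Y) [IsIso g] : ∃ z : ℂ, f = z • g := by
  obtain ⟨z, hz⟩ := exists_eq_smul_id hX (f ≫ inv g)
  refine ⟨z, ?_⟩
  rw [← Category.comp_id f, ← IsIso.inv_hom_id g, ← Category.assoc, hz]
  simp

theorem exists_eq_unit_smul {X Y : B} {a : InvClasses B} (hX : toSkeleton X = (a : Skeleton B))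
    (f g : X ⟶ Y) [IsIso f] [IsIso g] : ∃ z : ℂˣ, f = (z : ℂ) • g := by
  obtain ⟨z, hz⟩ := exists_eq_smul hX f g
  refine ⟨Units.mk0 z ?_, hz⟩
  rintro rfl
  rw [zero_smul] at hz
  apply id_ne_zero_of_class hX
  rw [← IsIso.hom_inv_id f]
  exact (congrArg (· ≫ inv f) hz).trans Limits.zero_comp

/-- In a decomposition into simple objects some projector is nonzero. It is a scalar because `X` is
invertible, and an idempotent nonzero scalar is `1`, so `X` is that simple summand. -/
theorem simple_of_class {X : B} {a : InvClasses B} (hX : toSkeleton X = (a : Skeleton B)) :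
    Simple X := by
  obtain ⟨n, S, b, hS, ⟨hb⟩, ⟨e⟩⟩ := IsPointedBraidedFusion.semisimple X
  have h1 : ∃ i, b.π i ≫ b.ι i ≠ 0 := by
    by_contra! h
    apply id_ne_zero_of_class hX
    have := Limits.IsBilimit.total hb
    rw [Finset.sum_eq_zero fun i _ => h i] at this
    rw [← e.inv_hom_id, ← Category.id_comp e.hom, ← this]
    simp
  obtain ⟨i, hi⟩ := h1
  obtain ⟨z, hz⟩ := exists_eq_smul_id hX (e.inv ≫ b.π i ≫ b.ι i ≫ e.hom)
  have hz' : b.π i ≫ b.ι i = z • 𝟙 b.pt := by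
    have : b.π i ≫ b.ι i = e.hom ≫ (e.inv ≫ b.π i ≫ b.ι i ≫ e.hom) ≫ e.inv := by simp
    rw [this, hz]
    simp
  have hιπ : b.ι i ≫ b.π i = 𝟙 _ := by simp
  have hz1 : z = 1 := by
    have h2 : (b.π i ≫ b.ι i) ≫ (b.π i ≫ b.ι i) = b.π i ≫ b.ι i := by
      rw [Category.assoc, reassoc_of% hιπ]
    rw [hz'] at h2 hi
    have h3 : (z * z - z) • 𝟙 b.pt = 0 := by
      rw [sub_smul, mul_smul]
      simpa [sub_eq_zero] using h2
    rcases smul_eq_zero.1 h3 with h | h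
    · rcases mul_eq_zero.1 (show z * (z - 1) = 0 by linear_combination h) with h | h
      · simp [h] at hi
      · linear_combination h
    · simp [h] at hi
  have := hS i
  refine Simple.of_iso (Y := S i) ⟨e.inv ≫ b.π i, b.ι i ≫ e.hom, ?_, ?_⟩
  · rw [Category.assoc, reassoc_of% hz', hz1]
    simp
  · simp [hιπ]

theorem exists_class_of_simple (X : B) [Simple X] :
    ∃ a : InvClasses B, toSkeleton X = (a : Skeleton B) := by
  obtain ⟨Y, ⟨i⟩⟩ := IsPointedBraidedFusion.pointed X ‹_›
  exact exists_class_of_tensor_inverse i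

instance : Finite (InvClasses B) := by
  obtain ⟨n, S, hS⟩ := IsPointedBraidedFusion.finite_simple (B := B)
  have h : ∀ a : InvClasses B, ∃ i, Nonempty ((fromSkeleton B).obj (a : Skeleton B) ≅ S i) :=
    fun a => hS _ (simple_of_class (toSkeleton_fromSkeleton_obj _))
  choose f hf using h
  refine Finite.of_injective f fun a b hab => ?_
  obtain ⟨i⟩ := hf a
  obtain ⟨j⟩ := hf b
  apply Units.ext
  rw [← toSkeleton_fromSkeleton_obj (a : Skeleton B), ← toSkeleton_fromSkeleton_obj (b : Skeleton B)]
  exact class_congr (i ≪≫ eqToIso (by rw [hab]) ≪≫ j.symm)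

theorem eq_zero_of_class_ne {X Y : B} {a b : InvClasses B} (hX : toSkeleton X = (a : Skeleton B))
    (hY : toSkeleton Y = (b : Skeleton B)) (hab : a ≠ b) (f : X ⟶ Y) : f = 0 := by
  by_contra hf
  have := simple_of_class hX
  have := simple_of_class hY
  have := isIso_of_hom_simple hf
  exact hab (Units.ext (hX.symm.trans ((class_congr (asIso f)).trans hY)))

/-- A decomposition of an object as a direct sum of chosen representatives. -/
structure Decomposition (X : InvClasses B → B) (Y : B) where
  n : ℕ
  s : Fin n → InvClasses B
  ι : ∀ i, X (s i) ⟶ Y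
  π : ∀ i, Y ⟶ X (s i)
  total : ∑ i, π i ≫ ι i = 𝟙 Y
  ι_π : ∀ i j, ι i ≫ π j = if h : i = j then eqToHom (congrArg (fun i => X (s i)) h) else 0

theorem nonempty_decomposition {X : InvClasses B → B}
    (hX : ∀ a, toSkeleton (X a) = (a : Skeleton B)) (Y : B) : Nonempty (Decomposition X Y) := by
  obtain ⟨n, S, b, hS, ⟨hb⟩, ⟨e⟩⟩ := IsPointedBraidedFusion.semisimple Y
  have h : ∀ i, ∃ a, Nonempty (X a ≅ S i) := fun i => by
    have := hS i
    obtain ⟨a, ha⟩ := exists_class_of_simple (S i)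
    exact ⟨a, exists_iso_of_class (hX a) ha⟩
  choose s hs using h
  let t : ∀ i, X (s i) ≅ S i := fun i => (hs i).some
  refine ⟨⟨n, s, fun i => (t i).hom ≫ b.ι i ≫ e.hom, fun i => e.inv ≫ b.π i ≫ (t i).inv, ?_, ?_⟩⟩
  · have := Limits.IsBilimit.total hb
    simp only [Category.assoc, Iso.inv_hom_id_assoc]
    rw [← Preadditive.comp_sum]
    simp_rw [← Category.assoc (b.π _)]
    rw [← Preadditive.sum_comp, this]
    simp
  · intro i j
    simp only [Category.assoc, Iso.hom_inv_id_assoc]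
    rw [reassoc_of% b.ι_π i j]
    split_ifs with h
    · subst h
      simp
    · simp

end Invertible

/-! ### Frames of invertible objects and their scalars -/

section Frames

variable {A : Type u} [CommGroup A] {B : Type u} [Category.{v} B] [MonoidalCategory B]
  [BraidedCategory B]

variable (A B) in
/-- A family of invertible objects indexed by a group, with isomorphisms `X a ⊗ X b ≅ X (a * b)`. -/
structure Frame where
  X : A → B
  m : ∀ {a b e : A}, a * b = e → (X a ⊗ X b ≅ X e)
  invertible : ∀ a, ∃ a' : InvClasses B, toSkeleton (X a) = (a' : Skeleton B)

theorem Frame.whiskerLeft_m_comp_m (Z : Frame A B) {a b d e e' k : A} (h₁ : b * d = e)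
    (h₂ : a * e = k) (h₃ : b * d = e') (h₄ : a * e' = k) :
    Z.X a ◁ (Z.m h₁).hom ≫ (Z.m h₂).hom = Z.X a ◁ (Z.m h₃).hom ≫ (Z.m h₄).hom := by
  subst h₁ h₃
  rfl

theorem Frame.exists_class_triple (Z : Frame A B) (a b d : A) :
    ∃ x : InvClasses B, toSkeleton (Z.X a ⊗ Z.X b ⊗ Z.X d) = (x : Skeleton B) := by
  obtain ⟨_, hx⟩ := Z.invertible d
  obtain ⟨_, hx⟩ := (Z.invertible b).elim fun _ h => (⟨_, class_tensor h hx⟩ :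
    ∃ x : InvClasses B, toSkeleton (Z.X b ⊗ Z.X d) = (x : Skeleton B))
  exact (Z.invertible a).elim fun _ h => ⟨_, class_tensor h hx⟩

variable [Preadditive B] [Linear ℂ B]

/-- The associativity and the commutativity of the frame hold up to the scalars `ω` and `c`. -/
structure Frame.HasScalars (Z : Frame A B) (ω : A → A → A → ℂ) (c : A → A → ℂ) : Prop where
  assoc : ∀ {a b d e f k : A} (h₁ : a * b = e) (h₂ : e * d = k) (h₃ : b * d = f) (h₄ : a * f = k),
    (α_ (Z.X a) (Z.X b) (Z.X d)).inv ≫ (Z.m h₁).hom ▷ Z.X d ≫ (Z.m h₂).hom =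
      ω a b d • (Z.X a ◁ (Z.m h₃).hom ≫ (Z.m h₄).hom)
  braid : ∀ {a b e : A} (h₁ : b * a = e) (h₂ : a * b = e),
    (β_ (Z.X a) (Z.X b)).hom ≫ (Z.m h₁).hom = c a b • (Z.m h₂).hom

namespace Frame

variable {Z : Frame A B} {ω : A → A → A → ℂ} {c : A → A → ℂ}

theorem HasScalars.assoc_hom (H : Z.HasScalars ω c) {a b d e f k : A} (h₁ : a * b = e)
    (h₂ : e * d = k) (h₃ : b * d = f) (h₄ : a * f = k) :
    (Z.m h₁).hom ▷ Z.X d ≫ (Z.m h₂).hom = ω a b d •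
      ((α_ (Z.X a) (Z.X b) (Z.X d)).hom ≫ Z.X a ◁ (Z.m h₃).hom ≫ (Z.m h₄).hom) := by
  rw [← Linear.comp_smul, ← H.assoc h₁ h₂ h₃ h₄]
  simp

end Frame

end Frames

/-! ### Cocycle identities from the pentagon and hexagon axioms -/

section Cocycle

variable {A : Type u} [CommGroup A] {B : Type u} [Category.{v} B] [MonoidalCategory B]
  [BraidedCategory B] [Abelian B] [Linear ℂ B] [MonoidalPreadditive B] [MonoidalLinear ℂ B]
  [IsPointedBraidedFusion B] {Z : Frame A B} {ω : A → A → A → ℂ} {c : A → A → ℂ}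

namespace Frame

/-- The two routes around the pentagon axiom, followed by multiplication to `X (a * b * d * e)`,
produce the two products of scalars times the same isomorphism; scalars cancel because its source is
invertible. -/
theorem HasScalars.pentagon (H : Z.HasScalars ω c) (a b d e : A) :
    ω b d e * ω a (b * d) e * ω a b d = ω (a * b) d e * ω a b (d * e) := by
  obtain ⟨_, hx⟩ := Z.invertible e
  obtain ⟨_, hx⟩ := (Z.invertible d).elim fun _ h => (⟨_, class_tensor h hx⟩ :
    ∃ x : InvClasses B, toSkeleton (Z.X d ⊗ Z.X e) = (x : Skeleton B))
  obtain ⟨_, hx⟩ := (Z.invertible b).elim fun _ h => (⟨_, class_tensor h hx⟩ :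
    ∃ x : InvClasses B, toSkeleton (Z.X b ⊗ Z.X d ⊗ Z.X e) = (x : Skeleton B))
  obtain ⟨_, hx⟩ := (Z.invertible a).elim fun _ h => (⟨_, class_tensor h hx⟩ :
    ∃ x : InvClasses B, toSkeleton (Z.X a ⊗ Z.X b ⊗ Z.X d ⊗ Z.X e) = (x : Skeleton B))
  obtain ⟨k, hk⟩ : ∃ k, k = a * b * d * e := ⟨_, rfl⟩
  have e1 : a * (b * (d * e)) = k := by rw [hk]; simp only [mul_assoc]
  have e2 : a * b * (d * e) = k := by rw [hk]; simp only [mul_assoc]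
  have e3 : a * (b * d * e) = k := by rw [hk]; simp only [mul_assoc]
  have e4 : a * (b * d) * e = k := by rw [hk]; simp only [mul_assoc]
  apply smul_left_injective_of_class hx (f := Z.X a ◁ Z.X b ◁ (Z.m (rfl : d * e = _)).hom ≫
    Z.X a ◁ (Z.m rfl).hom ≫ (Z.m e1).hom)
  trans (α_ (Z.X a) (Z.X b) (Z.X d ⊗ Z.X e)).inv ≫ (α_ (Z.X a ⊗ Z.X b) (Z.X d) (Z.X e)).inv ≫
    (Z.m rfl).hom ▷ Z.X d ▷ Z.X e ≫ (Z.m (rfl : a * b * d = _)).hom ▷ Z.X e ≫ (Z.m hk.symm).hom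
  · rw [← pentagon_inv_assoc, ← comp_whiskerRight_assoc, ← comp_whiskerRight_assoc,
      Category.assoc, H.assoc rfl rfl rfl (mul_assoc a b d).symm]
    simp only [MonoidalLinear.smul_whiskerRight, comp_whiskerRight, Linear.smul_comp,
      Linear.comp_smul, Category.assoc]
    rw [← associator_inv_naturality_middle_assoc, H.assoc (mul_assoc a b d).symm hk.symm rfl e3]
    have h := congrArg (fun x => Z.X a ◁ x ≫ (Z.m e3).hom)
      (H.assoc (rfl : b * d = _) rfl rfl (mul_assoc b d e).symm)
    simp only [MonoidalLinear.whiskerLeft_smul, Linear.smul_comp, whiskerLeft_comp,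
      Category.assoc] at h
    simp only [Linear.comp_smul]
    rw [h, smul_smul, smul_smul]
    congr 1
    · ring
    · rw [Z.whiskerLeft_m_comp_m]
  · rw [← associator_inv_naturality_left_assoc, H.assoc rfl hk.symm rfl e2]
    simp only [Linear.comp_smul]
    rw [← whisker_exchange_assoc, ← associator_inv_naturality_right_assoc, H.assoc rfl e2 rfl e1]
    simp only [Linear.comp_smul, smul_smul]

theorem HasScalars.hexagon₁ (H : Z.HasScalars ω c) (a b d : A) :
    c a (b * d) * ω b a d = c a b * c a d * ω b d a * ω a b d := by
  obtain ⟨_, hx⟩ := exists_class_triple Z a b d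
  obtain ⟨k, hk⟩ : ∃ k, b * d * a = k := ⟨_, rfl⟩
  have e1 : a * (b * d) = k := by rw [← hk, mul_comm]
  have e2 : b * (a * d) = k := by rw [← hk, mul_comm a, mul_assoc]
  have e3 : b * (d * a) = k := by rw [← hk, mul_assoc]
  have e4 : a * b * d = k := by rw [← e1, mul_assoc]
  have e5 : b * a * d = k := by rw [← e2, mul_assoc]
  apply smul_left_injective_of_class hx (f := Z.X a ◁ (Z.m rfl).hom ≫ (Z.m e1).hom)
  have h1 : (β_ (Z.X a) (Z.X b ⊗ Z.X d)).hom ≫ (Z.m rfl).hom ▷ Z.X a ≫ (Z.m hk).hom =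
      c a (b * d) • (Z.X a ◁ (Z.m rfl).hom ≫ (Z.m e1).hom) := by
    rw [← BraidedCategory.braiding_naturality_right_assoc, H.braid hk e1, Linear.comp_smul]
  have h2 : (β_ (Z.X a) (Z.X b ⊗ Z.X d)).hom = (α_ _ _ _).inv ≫ (β_ (Z.X a) (Z.X b)).hom ▷ Z.X d ≫
      (α_ _ _ _).hom ≫ Z.X b ◁ (β_ (Z.X a) (Z.X d)).hom ≫ (α_ _ _ _).inv := by
    rw [← BraidedCategory.hexagon_forward_assoc]
    simp
  -- The associator of `X b, X a, X d` enters the hexagon in the direction opposite to the one that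
  -- defines `ω`; multiplying through by `ω b a d` avoids its inverse.
  have h3 : ω b a d • ((β_ (Z.X a) (Z.X b)).hom ▷ Z.X d ≫ (α_ (Z.X b) (Z.X a) (Z.X d)).hom ≫
      Z.X b ◁ (Z.m rfl).hom ≫ (Z.m e2).hom) = (c a b * ω a b d) •
        ((α_ (Z.X a) (Z.X b) (Z.X d)).hom ≫ Z.X a ◁ (Z.m rfl).hom ≫ (Z.m e1).hom) := by
    rw [← Linear.comp_smul, ← H.assoc_hom rfl e5 rfl e2, ← comp_whiskerRight_assoc,
      H.braid rfl (mul_comm a b), MonoidalLinear.smul_whiskerRight, Linear.smul_comp,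
      H.assoc_hom (mul_comm a b) e5 rfl e1, smul_smul]
  have h4 := congrArg (fun x => (ω b d a * c a d) • ((α_ (Z.X a) (Z.X b) (Z.X d)).inv ≫ x)) h3
  simp only [Linear.comp_smul, Iso.inv_hom_id_assoc, smul_smul] at h4
  rw [mul_comm, mul_smul, ← h1, h2]
  simp only [Category.assoc]
  rw [H.assoc rfl hk rfl e3]
  simp only [Linear.comp_smul]
  rw [← whiskerLeft_comp_assoc, H.braid rfl (mul_comm a d)]
  simp only [MonoidalLinear.whiskerLeft_smul, Linear.comp_smul, Linear.smul_comp, smul_smul]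
  refine Eq.trans ?_ (h4.trans ?_)
  · rw [Z.whiskerLeft_m_comp_m _ e3 rfl e2]
    congr 1
    ring
  · congr 1
    ring

theorem HasScalars.hexagon₂ (H : Z.HasScalars ω c) (a b d : A) :
    c (a * b) d * ω a b d * ω d a b = c a d * c b d * ω a d b := by
  obtain ⟨_, hx⟩ := exists_class_triple Z a b d
  obtain ⟨k, hk⟩ : ∃ k, a * b * d = k := ⟨_, rfl⟩
  have e1 : a * (b * d) = k := by rw [← hk, mul_assoc]
  have e2 : d * (a * b) = k := by rw [← hk, mul_comm]
  have e3 : d * a * b = k := by rw [← e2, mul_assoc]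
  have e4 : a * (d * b) = k := by rw [← e1, mul_comm d]
  have e5 : a * d * b = k := by rw [← e4, mul_assoc]
  apply smul_left_injective_of_class hx (f := Z.X a ◁ (Z.m rfl).hom ≫ (Z.m e1).hom)
  trans (α_ (Z.X a) (Z.X b) (Z.X d)).inv ≫ (β_ (Z.X a ⊗ Z.X b) (Z.X d)).hom ≫
    (α_ (Z.X d) (Z.X a) (Z.X b)).inv ≫ (Z.m rfl).hom ▷ Z.X b ≫ (Z.m e3).hom
  · rw [H.assoc rfl e3 rfl e2, Linear.comp_smul,
      ← BraidedCategory.braiding_naturality_left_assoc, H.braid e2 hk]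
    simp only [Linear.comp_smul]
    rw [H.assoc rfl hk rfl e1]
    simp only [smul_smul]
    congr 1
    ring
  · rw [BraidedCategory.hexagon_reverse_assoc, ← comp_whiskerRight_assoc,
      H.braid rfl (mul_comm a d)]
    simp only [MonoidalLinear.smul_whiskerRight, Linear.smul_comp, Linear.comp_smul]
    rw [H.assoc (mul_comm a d) e3 rfl e4]
    simp only [Linear.comp_smul]
    rw [← whiskerLeft_comp_assoc, H.braid rfl (mul_comm b d)]
    simp only [MonoidalLinear.whiskerLeft_smul, Linear.smul_comp, smul_smul]
    rw [Z.whiskerLeft_m_comp_m _ e4 rfl e1]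
    congr 1
    ring

end Frame

end Cocycle

/-! ### Functors and natural transformations prescribed on representatives -/

section Extension

variable {B : Type u} [Category.{v} B] [MonoidalCategory B] [BraidedCategory B]
  [Abelian B] {X : InvClasses B → B} {D : Type*} [Category* D] [Preadditive D]

/-- Morphisms out of the image of an additive functor are determined by their restrictions to
representatives. -/
theorem Decomposition.hom_ext {Y : B} (p : Decomposition X Y) (H : B ⥤ D) [H.Additive] {W : D}
    {f g : H.obj Y ⟶ W}
    (h : ∀ a (i : X a ⟶ Y), H.map i ≫ f = H.map i ≫ g) : f = g := by
  have key : ∀ f : H.obj Y ⟶ W, f = ∑ i, H.map (p.π i) ≫ H.map (p.ι i) ≫ f := by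
    intro f
    simp_rw [← Category.assoc, ← H.map_comp]
    rw [← Preadditive.sum_comp, ← H.map_sum, p.total]
    simp
  rw [key f, key g]
  simp_rw [h]

variable [Linear ℂ B] [MonoidalPreadditive B] [MonoidalLinear ℂ B] [IsPointedBraidedFusion B]

theorem hom_ext_of_reps (hX : ∀ a, toSkeleton (X a) = (a : Skeleton B)) (H : B ⥤ D)
    [H.Additive] {Y : B} {W : D} {f g : H.obj Y ⟶ W}
    (h : ∀ a (i : X a ⟶ Y), H.map i ≫ f = H.map i ≫ g) : f = g :=
  (nonempty_decomposition hX Y).some.hom_ext H h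

theorem natTrans_ext_of_reps (hX : ∀ a, toSkeleton (X a) = (a : Skeleton B)) {H K : B ⥤ D}
    [H.Additive] {s t : H ⟶ K} (h : ∀ a, s.app (X a) = t.app (X a)) : s = t := by
  ext Y
  apply hom_ext_of_reps hX H
  intro a i
  rw [s.naturality, t.naturality, h]

variable [Linear ℂ D]

/-- No condition on `t` is needed: a morphism between representatives is a scalar or zero. -/
theorem naturality_of_reps (hX : ∀ a, toSkeleton (X a) = (a : Skeleton B)) (H K : B ⥤ D)
    [H.Additive] [K.Additive] [H.Linear ℂ] [K.Linear ℂ]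
    (t : ∀ a, H.obj (X a) ⟶ K.obj (X a)) {a b : InvClasses B} (f : X a ⟶ X b) :
    H.map f ≫ t b = t a ≫ K.map f := by
  by_cases hab : a = b
  · subst hab
    obtain ⟨z, rfl⟩ := exists_eq_smul_id (hX a) f
    simp
  · rw [eq_zero_of_class_ne (hX a) (hX b) hab f]
    simp

/-- A natural transformation of linear functors can be prescribed freely on representatives. -/
theorem exists_natTrans_of_reps (hX : ∀ a, toSkeleton (X a) = (a : Skeleton B)) (H K : B ⥤ D)
    [H.Additive] [K.Additive] [H.Linear ℂ] [K.Linear ℂ]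
    (t : ∀ a, H.obj (X a) ⟶ K.obj (X a)) : ∃ s : H ⟶ K, ∀ a, s.app (X a) = t a := by
  let p := fun Y => (nonempty_decomposition hX Y).some
  -- The component at `Y` is assembled from a chosen decomposition. The claim `key` determines its
  -- restriction to every representative mapping to `Y`, and naturality follows from that alone.
  let s : ∀ Y, H.obj Y ⟶ K.obj Y := fun Y =>
    ∑ i, H.map ((p Y).π i) ≫ t ((p Y).s i) ≫ K.map ((p Y).ι i)
  have key : ∀ a {Y} (f : X a ⟶ Y), H.map f ≫ s Y = t a ≫ K.map f := by
    intro a Y f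
    simp only [s, Preadditive.comp_sum]
    have : ∀ i, H.map f ≫ H.map ((p Y).π i) ≫ t ((p Y).s i) ≫ K.map ((p Y).ι i) =
        t a ≫ K.map (f ≫ (p Y).π i ≫ (p Y).ι i) := by
      intro i
      rw [← H.map_comp_assoc, reassoc_of% naturality_of_reps hX H K t (f ≫ (p Y).π i),
        ← K.map_comp, Category.assoc]
    simp_rw [this]
    rw [← Preadditive.comp_sum, ← K.map_sum, ← Preadditive.comp_sum, (p Y).total,
      Category.comp_id]
  refine ⟨{ app := s, naturality := fun Y Z f => ?_ }, fun a => ?_⟩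
  · apply hom_ext_of_reps hX H
    intro a i
    rw [← H.map_comp_assoc, key, reassoc_of% key a i, K.map_comp]
  · have := key a (𝟙 (X a))
    simpa using this

theorem exists_natIso_of_reps (hX : ∀ a, toSkeleton (X a) = (a : Skeleton B)) (H K : B ⥤ D)
    [H.Additive] [K.Additive] [H.Linear ℂ] [K.Linear ℂ]
    (t : ∀ a, H.obj (X a) ≅ K.obj (X a)) : ∃ s : H ≅ K, ∀ a, s.app (X a) = t a := by
  obtain ⟨s, hs⟩ := exists_natTrans_of_reps hX H K fun a => (t a).hom
  obtain ⟨s', hs'⟩ := exists_natTrans_of_reps hX K H fun a => (t a).inv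
  refine ⟨⟨s, s', ?_, ?_⟩, fun a => Iso.ext (hs a)⟩
  · exact natTrans_ext_of_reps hX fun a => by simp [hs, hs']
  · exact natTrans_ext_of_reps hX fun a => by simp [hs, hs']

open Limits in
/-- A linear functor can be prescribed freely on representatives. -/
theorem exists_functor_of_reps [HasFiniteBiproducts D]
    (hX : ∀ a, toSkeleton (X a) = (a : Skeleton B)) (Y : InvClasses B → D) :
    ∃ (F : B ⥤ D) (_ : F.Additive) (_ : F.Linear ℂ), Nonempty (∀ a, F.obj (X a) ≅ Y a) := by
  classical
  choose z hz using fun a => exists_eq_smul_id (hX a)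
  have hz' : ∀ a (w : ℂ), z a (w • 𝟙 _) = w := fun a w =>
    smul_left_injective_of_class (hX a) (hz a _).symm
  -- The functor on the full subcategory of representatives: endomorphisms act by their scalar, and
  -- all other morphisms go to zero.
  let T : ∀ {a b}, (X a ⟶ X b) → (Y a ⟶ Y b) := fun {a b} f =>
    if h : a = b then z a (f ≫ eqToHom (by rw [h])) • eqToHom (by rw [h]) else 0
  have T_smul : ∀ a (w : ℂ), T (w • 𝟙 (X a)) = w • 𝟙 (Y a) := by
    intro a w
    simp [T, hz']
  have T_id : ∀ a, T (𝟙 (X a)) = 𝟙 (Y a) := fun a => by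
    simpa using T_smul a 1
  have T_lin : ∀ {a b} (w : ℂ) (f g : X a ⟶ X b), T (w • f + g) = w • T f + T g := by
    intro a b w f g
    by_cases h : a = b
    · subst h
      obtain ⟨x, rfl⟩ := exists_eq_smul_id (hX a) f
      obtain ⟨y, rfl⟩ := exists_eq_smul_id (hX a) g
      rw [smul_smul, ← add_smul, T_smul, T_smul, T_smul, add_smul, smul_smul]
    · simp [T, h]
  have T_zero : ∀ {a b}, T (0 : X a ⟶ X b) = 0 := by
    intro a b
    have := T_lin 1 (0 : X a ⟶ X b) 0
    simpa using this
  have T_add : ∀ {a b} (f g : X a ⟶ X b), T (f + g) = T f + T g := by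
    intro a b f g
    simpa using T_lin 1 f g
  have T_sum : ∀ {a b} {n : ℕ} (f : Fin n → (X a ⟶ X b)), T (∑ i, f i) = ∑ i, T (f i) := by
    intro a b n f
    exact map_sum (AddMonoidHom.mk' (T (a := a) (b := b)) T_add) f _
  have T_comp : ∀ {a b d} (f : X a ⟶ X b) (g : X b ⟶ X d), T (f ≫ g) = T f ≫ T g := by
    intro a b d f g
    by_cases h : a = b
    · subst h
      by_cases h' : a = d
      · subst h'
        obtain ⟨x, rfl⟩ := exists_eq_smul_id (hX a) f
        obtain ⟨y, rfl⟩ := exists_eq_smul_id (hX a) g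
        simp [T_smul, smul_smul, mul_comm]
      · rw [eq_zero_of_class_ne (hX a) (hX d) h' g]
        simp [T_zero]
    · rw [eq_zero_of_class_ne (hX a) (hX b) h f]
      simp [T_zero]
  let p := fun U => (nonempty_decomposition hX U).some
  -- The extension to all objects: a chosen decomposition is replaced by the direct sum of the
  -- prescribed values, and a morphism by the matrix of its components.
  let F : B ⥤ D :=
    { obj := fun U => ⨁ fun i => Y ((p U).s i)
      map := fun {U V} f => biproduct.matrix fun i j => T ((p U).ι i ≫ f ≫ (p V).π j)
      map_id := fun U => by
        apply biproduct.hom_ext'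
        intro i
        apply biproduct.hom_ext
        intro j
        rw [Category.comp_id, Category.assoc, biproduct.matrix_π, biproduct.ι_desc,
          Category.id_comp, (p U).ι_π, biproduct.ι_π]
        split_ifs with h
        · subst h
          simp [T_id]
        · exact T_zero
      map_comp := fun {U V W} f g => by
        apply biproduct.hom_ext'
        intro i
        apply biproduct.hom_ext
        intro j
        simp only [Category.assoc, biproduct.matrix_π, biproduct.ι_desc,
          biproduct.ι_matrix_assoc, biproduct.lift_desc]
        have e : (p U).ι i ≫ f ≫ g ≫ (p W).π j = ∑ k, ((p U).ι i ≫ f ≫ (p V).π k) ≫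
            (p V).ι k ≫ g ≫ (p W).π j := by
          have h := congrArg (fun x => (p U).ι i ≫ f ≫ x ≫ g ≫ (p W).π j) (p V).total
          simp only [Preadditive.comp_sum, Preadditive.sum_comp, Category.id_comp] at h
          rw [← h]
          simp only [Category.assoc]
        rw [e, T_sum]
        simp only [← T_comp] }
  refine ⟨F, ⟨fun {U V f g} => ?_⟩, ⟨fun {U V} f w => ?_⟩, ⟨fun a => ⟨?_, ?_, ?_, ?_⟩⟩⟩
  · apply biproduct.hom_ext'
    intro i
    apply biproduct.hom_ext
    intro j
    simp [F, T_add]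
  · apply biproduct.hom_ext'
    intro i
    apply biproduct.hom_ext
    intro j
    have := T_lin w ((p U).ι i ≫ f ≫ (p V).π j) 0
    simpa [F, T_zero] using this
  · exact biproduct.desc fun i => T ((p (X a)).ι i)
  · exact biproduct.lift fun i => T ((p (X a)).π i)
  · apply biproduct.hom_ext'
    intro i
    apply biproduct.hom_ext
    intro j
    rw [Category.comp_id, Category.assoc, Category.assoc, biproduct.lift_π,
      biproduct.ι_desc_assoc, ← T_comp, (p (X a)).ι_π, biproduct.ι_π]
    split_ifs with h
    · subst h
      simp [T_id]
    · exact T_zero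
  · rw [biproduct.lift_desc]
    simp_rw [← T_comp]
    rw [← T_sum, (p (X a)).total, T_id]

end Extension

/-! ### Bilinear bifunctors on representatives -/

section BraidedFunctors

variable {B : Type u} [Category.{v} B] [MonoidalCategory B] [BraidedCategory B]
  [Abelian B] [Linear ℂ B] [MonoidalPreadditive B] [MonoidalLinear ℂ B]
  [IsPointedBraidedFusion B] {X : InvClasses B → B}

/-- A natural isomorphism of bilinear bifunctors can be prescribed freely on representatives. -/
theorem exists_bifunctor_natIso_of_reps (hX : ∀ a, toSkeleton (X a) = (a : Skeleton B))
    (H K : B ⥤ B ⥤ B) [H.Additive] [K.Additive] [H.Linear ℂ] [K.Linear ℂ]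
    [∀ U, (H.obj U).Additive] [∀ U, (K.obj U).Additive] [∀ U, (H.obj U).Linear ℂ]
    [∀ U, (K.obj U).Linear ℂ]
    (t : ∀ a b, (H.obj (X a)).obj (X b) ≅ (K.obj (X a)).obj (X b)) :
    ∃ s : H ≅ K, ∀ a b, (s.app (X a)).app (X b) = t a b := by
  -- Extension in the second variable for each representative in the first; the next step extends in
  -- the first variable, with values in a functor category.
  choose s hs using fun a => exists_natIso_of_reps hX (H.obj (X a)) (K.obj (X a)) (t a)
  obtain ⟨e, he⟩ := exists_natIso_of_reps hX H K s
  exact ⟨e, fun a b => by rw [he, hs]⟩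

instance (F : B ⥤ B) [F.Additive] : (curriedTensorPre F).Additive where
  map_add := by intros; ext; simp

instance (F : B ⥤ B) [F.Additive] : (curriedTensorPost F).Additive where
  map_add := by intros; ext; simp

instance (F : B ⥤ B) [F.Additive] [F.Linear ℂ] : (curriedTensorPre F).Linear ℂ where
  map_smul := by intros; ext; simp

instance (F : B ⥤ B) [F.Additive] [F.Linear ℂ] : (curriedTensorPost F).Linear ℂ where
  map_smul := by intros; ext; simp

instance (F : B ⥤ B) [F.Additive] (U : B) : ((curriedTensorPre F).obj U).Additive where
  map_add := by intros; simp

instance (F : B ⥤ B) [F.Additive] (U : B) : ((curriedTensorPost F).obj U).Additive where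
  map_add := by intros; simp [F.map_add]

instance (F : B ⥤ B) [F.Additive] [F.Linear ℂ] (U : B) :
    ((curriedTensorPre F).obj U).Linear ℂ where
  map_smul := by intros; simp

instance (F : B ⥤ B) [F.Additive] [F.Linear ℂ] (U : B) :
    ((curriedTensorPost F).obj U).Linear ℂ where
  map_smul := by intros; simp

end BraidedFunctors

/-! ### Tensor structures without prescribed unit data -/

section Tensorators

variable {B : Type u} [Category.{v} B] [MonoidalCategory B] [BraidedCategory B]

/-- A natural, associative and commutative family of isomorphisms `F U ⊗ F V ≅ F (U ⊗ V)`. -/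
structure Tensorator (F : B ⥤ B) where
  M : ∀ U V, F.obj U ⊗ F.obj V ≅ F.obj (U ⊗ V)
  natural : ∀ {U U' V V'} (f : U ⟶ U') (g : V ⟶ V'),
    (F.map f ⊗ₘ F.map g) ≫ (M U' V').hom = (M U V).hom ≫ F.map (f ⊗ₘ g)
  assoc : ∀ U V W, (M U V).hom ▷ F.obj W ≫ (M (U ⊗ V) W).hom ≫ F.map (α_ U V W).hom =
    (α_ _ _ _).hom ≫ F.obj U ◁ (M V W).hom ≫ (M U (V ⊗ W)).hom
  braided : ∀ U V, (M U V).hom ≫ F.map (β_ U V).hom = (β_ _ _).hom ≫ (M V U).hom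

namespace Tensorator

variable {F : B ⥤ B} (T : Tensorator F)

theorem natural_left {U U' : B} (f : U ⟶ U') (V : B) :
    F.map f ▷ F.obj V ≫ (T.M U' V).hom = (T.M U V).hom ≫ F.map (f ▷ V) := by
  simpa using T.natural f (𝟙 V)

theorem natural_right (U : B) {V V' : B} (f : V ⟶ V') :
    F.obj U ◁ F.map f ≫ (T.M U V').hom = (T.M U V).hom ≫ F.map (U ◁ f) := by
  simpa using T.natural (𝟙 U) f

/-- Associativity for `𝟙_ B, 𝟙_ B, Y` transfers the identity from the unit object to `𝟙_ B ⊗ Y`;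
naturality along the left unitor then gives it at `Y`. -/
theorem left_unital {ε : 𝟙_ B ⟶ F.obj (𝟙_ B)}
    (h : ε ▷ F.obj (𝟙_ B) ≫ (T.M _ _).hom ≫ F.map (λ_ _).hom = (λ_ _).hom) (Y : B) :
    ε ▷ F.obj Y ≫ (T.M _ _).hom ≫ F.map (λ_ _).hom = (λ_ _).hom := by
  have h1 : ε ▷ F.obj (𝟙_ B ⊗ Y) ≫ (T.M _ _).hom ≫ F.map (λ_ _).hom = (λ_ _).hom := by
    rw [← cancel_epi (𝟙_ B ◁ (T.M (𝟙_ B) Y).hom), whisker_exchange_assoc]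
    have h2 : F.obj (𝟙_ B) ◁ (T.M (𝟙_ B) Y).hom ≫ (T.M (𝟙_ B) (𝟙_ B ⊗ Y)).hom =
        (α_ _ _ _).inv ≫ (T.M _ _).hom ▷ F.obj Y ≫ (T.M _ _).hom ≫ F.map (α_ _ _ _).hom := by
      rw [T.assoc]
      simp
    rw [reassoc_of% h2, ← F.map_comp, leftUnitor_tensor_hom, Iso.hom_inv_id_assoc, ← T.natural_left,
      associator_inv_naturality_left_assoc, ← comp_whiskerRight_assoc, ← comp_whiskerRight_assoc,
      Category.assoc, h]
    simp
  rw [← cancel_epi (𝟙_ B ◁ F.map (λ_ Y).hom), leftUnitor_naturality, ← h1,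
    whisker_exchange_assoc, reassoc_of% T.natural_right, ← F.map_comp, leftUnitor_naturality]
  simp

variable [Abelian B] [Linear ℂ B] [MonoidalPreadditive B] [MonoidalLinear ℂ B]
  [IsPointedBraidedFusion B] {X : InvClasses B → B}

/-- Any isomorphism `𝟙_ B ≅ F (𝟙_ B)` satisfies the left unit law at the unit object up to a scalar.
Rescaling removes it, `left_unital` extends the law to all objects, and the braiding converts it
into the right unit law. -/
theorem exists_braided (T : Tensorator F)
    (hF : toSkeleton (F.obj (𝟙_ B)) = ((1 : InvClasses B) : Skeleton B)) :
    ∃ _ : F.Braided, ∀ U V, Functor.LaxMonoidal.μ F U V = (T.M U V).hom := by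
  obtain ⟨e⟩ := exists_iso_of_class class_unit hF
  obtain ⟨z, hz⟩ := exists_eq_unit_smul (class_tensor (class_unit (B := B)) hF)
    (e.hom ▷ F.obj (𝟙_ B) ≫ (T.M _ _).hom ≫ F.map (λ_ _).hom) (λ_ _).hom
  let ε : 𝟙_ B ≅ F.obj (𝟙_ B) :=
    { hom := ((z⁻¹ : ℂˣ) : ℂ) • e.hom
      inv := (z : ℂ) • e.inv
      hom_inv_id := by simp [smul_smul]
      inv_hom_id := by simp [smul_smul] }
  have h1 : ε.hom ▷ F.obj (𝟙_ B) ≫ (T.M _ _).hom ≫ F.map (λ_ _).hom = (λ_ _).hom := by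
    simp only [ε, MonoidalLinear.smul_whiskerRight, Linear.smul_comp, hz, smul_smul]
    simp
  have h2 := T.left_unital h1
  let C : F.CoreMonoidal :=
    { εIso := ε
      μIso := T.M
      μIso_hom_natural_left := fun f V => T.natural_left f V
      μIso_hom_natural_right := fun U _ => T.natural_right U _
      associativity := T.assoc
      left_unitality := fun Y => (h2 Y).symm
      right_unitality := fun Y => by
        rw [← braiding_leftUnitor, ← braiding_leftUnitor, ← h2, F.map_comp,
          reassoc_of% T.braided, BraidedCategory.braiding_naturality_right_assoc] }
  exact ⟨{ C.toMonoidal with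
    braided := fun U V => (T.braided U V) }, fun U V => rfl⟩

end Tensorator

variable [Abelian B] [Linear ℂ B] [MonoidalPreadditive B] [MonoidalLinear ℂ B]
  [IsPointedBraidedFusion B] {X : InvClasses B → B}

theorem tensor_hom_ext (hX : ∀ a, toSkeleton (X a) = (a : Skeleton B)) (F : B ⥤ B) [F.Additive]
    {U V W : B} {f g : F.obj U ⊗ F.obj V ⟶ W}
    (h : ∀ a b (i : X a ⟶ U) (j : X b ⟶ V),
      (F.map i ⊗ₘ F.map j) ≫ f = (F.map i ⊗ₘ F.map j) ≫ g) : f = g := by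
  apply hom_ext_of_reps hX ((curriedTensorPre F).obj U)
  intro b j
  apply hom_ext_of_reps hX (F ⋙ tensorRight (F.obj (X b)))
  intro a i
  have := h a b i j
  simp only [MonoidalCategory.tensorHom_def, Category.assoc] at this
  exact this

theorem tensor_tensor_hom_ext (hX : ∀ a, toSkeleton (X a) = (a : Skeleton B)) (F : B ⥤ B)
    [F.Additive] {U V W Y : B} {f g : (F.obj U ⊗ F.obj V) ⊗ F.obj W ⟶ Y}
    (h : ∀ a b d (i : X a ⟶ U) (j : X b ⟶ V) (k : X d ⟶ W),
      ((F.map i ⊗ₘ F.map j) ⊗ₘ F.map k) ≫ f = ((F.map i ⊗ₘ F.map j) ⊗ₘ F.map k) ≫ g) : f = g := by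
  apply hom_ext_of_reps hX (F ⋙ tensorLeft (F.obj U ⊗ F.obj V))
  intro d k
  apply hom_ext_of_reps hX (F ⋙ tensorLeft (F.obj U) ⋙ tensorRight (F.obj (X d)))
  intro b j
  apply hom_ext_of_reps hX (F ⋙ tensorRight (F.obj (X b)) ⋙ tensorRight (F.obj (X d)))
  intro a i
  have := h a b d i j k
  simp only [MonoidalCategory.tensorHom_def, comp_whiskerRight, Category.assoc] at this
  exact this

end Tensorators

/-! ### Construction and comparison of braided functors -/

section Construction

variable {B : Type u} [Category.{v} B] [MonoidalCategory B] [BraidedCategory B]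

/-- The family `u` identifies the image of the frame `Z` under `F` with the frame `Y`. -/
def Frame.Compatible {A : Type u} [CommGroup A] (Z Y : Frame A B) (F : B ⥤ B) [F.Monoidal]
    (u : ∀ a, F.obj (Z.X a) ≅ Y.X a) : Prop :=
  ∀ {a b e : A} (h : a * b = e), Functor.LaxMonoidal.μ F _ _ ≫ F.map (Z.m h).hom ≫ (u e).hom =
    ((u a).hom ⊗ₘ (u b).hom) ≫ (Y.m h).hom

variable [Abelian B] [Linear ℂ B] [MonoidalPreadditive B] [MonoidalLinear ℂ B]
  [IsPointedBraidedFusion B]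

/-- A frame with the same scalars as a frame of representatives is its image under a braided
functor. -/
theorem exists_braidedFunctor_of_frame {Z Y : Frame (InvClasses B) B}
    {ω : InvClasses B → InvClasses B → InvClasses B → ℂ} {c : InvClasses B → InvClasses B → ℂ}
    (HZ : Z.HasScalars ω c) (HY : Y.HasScalars ω c)
    (hZ : ∀ a, toSkeleton (Z.X a) = (a : Skeleton B))
    (hY : toSkeleton (Y.X 1) = ((1 : InvClasses B) : Skeleton B)) :
    ∃ (F : B ⥤ B) (_ : F.Additive) (_ : F.Linear ℂ) (_ : F.Braided)
      (u : ∀ a, F.obj (Z.X a) ≅ Y.X a), Z.Compatible Y F u := by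
  have := Abelian.hasFiniteBiproducts (C := B)
  obtain ⟨F, _, _, ⟨u⟩⟩ := exists_functor_of_reps hZ Y.X
  -- Compatibility with the two frames forces this formula on representatives.
  obtain ⟨s, hs⟩ := exists_bifunctor_natIso_of_reps hZ (curriedTensorPre F) (curriedTensorPost F)
    fun a b => ((u a ⊗ᵢ u b) ≪≫ Y.m rfl ≪≫ (u (a * b)).symm ≪≫ F.mapIso (Z.m rfl).symm :)
  let M : ∀ U V, F.obj U ⊗ F.obj V ≅ F.obj (U ⊗ V) := fun U V => (s.app U).app V
  have hM : ∀ {a b e} (h : a * b = e), (M (Z.X a) (Z.X b)).hom ≫ F.map (Z.m h).hom ≫ (u e).hom =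
      ((u a).hom ⊗ₘ (u b).hom) ≫ (Y.m h).hom := by
    rintro a b e rfl
    simp only [M, hs]
    simp [← F.map_comp_assoc]
  have nat_left : ∀ {U U'} (f : U ⟶ U') (V), F.map f ▷ F.obj V ≫ (M U' V).hom =
      (M U V).hom ≫ F.map (f ▷ V) := fun f V =>
    congrArg (fun t => NatTrans.app t V) (s.hom.naturality f)
  have nat_right : ∀ (U) {V V'} (f : V ⟶ V'), F.obj U ◁ F.map f ≫ (M U V').hom =
      (M U V).hom ≫ F.map (U ◁ f) := fun U _ _ f => (s.hom.app U).naturality f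
  clear_value M
  have nat : ∀ {U U' V V'} (f : U ⟶ U') (g : V ⟶ V'),
      (F.map f ⊗ₘ F.map g) ≫ (M U' V').hom = (M U V).hom ≫ F.map (f ⊗ₘ g) := by
    intro U U' V V' f g
    rw [MonoidalCategory.tensorHom_def, MonoidalCategory.tensorHom_def, Category.assoc, nat_right,
      reassoc_of% nat_left, F.map_comp]
  -- Transported to the frame `Y`, both sides acquire the same scalar because the two frames share
  -- `c`; associativity is handled likewise with `ω`.
  have braid_reps : ∀ a b, (M (Z.X a) (Z.X b)).hom ≫ F.map (β_ _ _).hom =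
      (β_ _ _).hom ≫ (M (Z.X b) (Z.X a)).hom := by
    intro a b
    rw [← cancel_mono (F.map (Z.m (mul_comm b a)).hom ≫ (u (a * b)).hom), Category.assoc,
      Category.assoc, hM, ← F.map_comp_assoc, HZ.braid (mul_comm b a) rfl,
      ← BraidedCategory.braiding_naturality_assoc, HY.braid (mul_comm b a) rfl, F.map_smul]
    simp only [Linear.smul_comp, Linear.comp_smul, hM]
  have assoc_reps : ∀ a b d, (M (Z.X a) (Z.X b)).hom ▷ F.obj (Z.X d) ≫
      (M (Z.X a ⊗ Z.X b) (Z.X d)).hom ≫ F.map (α_ _ _ _).hom = (α_ _ _ _).hom ≫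
        F.obj (Z.X a) ◁ (M (Z.X b) (Z.X d)).hom ≫ (M (Z.X a) (Z.X b ⊗ Z.X d)).hom := by
    intro a b d
    rw [← cancel_mono (F.map (α_ _ _ _).inv), ← cancel_epi (α_ _ _ _).inv]
    simp only [Category.assoc, Iso.inv_hom_id_assoc, Iso.map_hom_inv_id, Category.comp_id]
    rw [← cancel_mono (F.map ((Z.m rfl).hom ▷ Z.X d) ≫ F.map (Z.m rfl).hom ≫
      (u (a * b * d)).hom)]
    simp only [Category.assoc]
    rw [← reassoc_of% nat_left, hM, ← F.map_comp_assoc, ← F.map_comp_assoc, Category.assoc,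
      HZ.assoc rfl rfl rfl (mul_assoc a b d).symm, F.map_smul, F.map_comp]
    simp only [Linear.smul_comp, Linear.comp_smul, Category.assoc]
    rw [← reassoc_of% nat_right, hM, ← whiskerLeft_comp_assoc, ← comp_whiskerRight_assoc]
    have e1 : ((M (Z.X a) (Z.X b)).hom ≫ F.map (Z.m rfl).hom) ▷ F.obj (Z.X d) ≫
        ((u (a * b)).hom ⊗ₘ (u d).hom) = (((u a).hom ⊗ₘ (u b).hom) ⊗ₘ (u d).hom) ≫
          (Y.m rfl).hom ▷ Y.X d := by
      rw [← MonoidalCategory.tensorHom_id, ← MonoidalCategory.tensorHom_id,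
        tensorHom_comp_tensorHom, tensorHom_comp_tensorHom, Category.assoc, hM, Category.comp_id,
        Category.id_comp]
    have e2 : F.obj (Z.X a) ◁ ((M (Z.X b) (Z.X d)).hom ≫ F.map (Z.m rfl).hom) ≫
        ((u a).hom ⊗ₘ (u (b * d)).hom) = ((u a).hom ⊗ₘ ((u b).hom ⊗ₘ (u d).hom)) ≫
          Y.X a ◁ (Y.m rfl).hom := by
      rw [← MonoidalCategory.id_tensorHom, ← MonoidalCategory.id_tensorHom,
        tensorHom_comp_tensorHom, tensorHom_comp_tensorHom, Category.assoc, hM, Category.comp_id,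
        Category.id_comp]
    rw [reassoc_of% e1, reassoc_of% e2, ← associator_inv_naturality_assoc,
      HY.assoc rfl rfl rfl (mul_assoc a b d).symm, Linear.comp_smul]
  let T : Tensorator F :=
    { M := M
      natural := nat
      assoc := fun U V W => by
        apply tensor_tensor_hom_ext hZ F
        intro a b d i j k
        rw [← MonoidalCategory.tensorHom_id, ← MonoidalCategory.id_tensorHom,
          tensorHom_comp_tensorHom_assoc, nat, Category.comp_id, associator_naturality_assoc,
          tensorHom_comp_tensorHom_assoc, nat, Category.comp_id]
        have h1 := assoc_reps a b d =≫ F.map (i ⊗ₘ j ⊗ₘ k)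
        have e1 : ((M (Z.X a) (Z.X b)).hom ≫ F.map (i ⊗ₘ j)) ⊗ₘ F.map k =
            (M _ _).hom ▷ F.obj (Z.X d) ≫ (F.map (i ⊗ₘ j) ⊗ₘ F.map k) := by
          rw [← MonoidalCategory.tensorHom_id, tensorHom_comp_tensorHom, Category.id_comp]
        have e2 : F.map i ⊗ₘ ((M (Z.X b) (Z.X d)).hom ≫ F.map (j ⊗ₘ k)) =
            F.obj (Z.X a) ◁ (M _ _).hom ≫ (F.map i ⊗ₘ F.map (j ⊗ₘ k)) := by
          rw [← MonoidalCategory.id_tensorHom, tensorHom_comp_tensorHom, Category.id_comp]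
        rw [e1, e2, Category.assoc, Category.assoc, nat, reassoc_of% nat, ← F.map_comp,
          associator_naturality, F.map_comp]
        simpa only [Category.assoc] using h1
      braided := fun U V => by
        apply tensor_hom_ext hZ F
        intro a b i j
        rw [reassoc_of% nat, ← F.map_comp, BraidedCategory.braiding_naturality,
          BraidedCategory.braiding_naturality_assoc, nat, F.map_comp, reassoc_of% braid_reps] }
  have h1 : toSkeleton (F.obj (𝟙_ B)) = ((1 : InvClasses B) : Skeleton B) := by
    obtain ⟨i⟩ := exists_iso_of_class class_unit (hZ 1)
    rw [← hY]
    exact class_congr (F.mapIso i ≪≫ u 1)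
  obtain ⟨_, hμ⟩ := T.exists_braided h1
  exact ⟨F, inferInstance, inferInstance, inferInstance, u, fun h => by rw [hμ]; exact hM h⟩

open Functor.LaxMonoidal in
/-- Compatibility with tensor products may be checked on representatives. -/
theorem isMonoidal_of_reps {X : InvClasses B → B}
    (hX : ∀ a, toSkeleton (X a) = (a : Skeleton B)) {F F' : B ⥤ B} [F.Additive] [F.Monoidal]
    [F'.Monoidal] (τ : F ≅ F')
    (h : ∀ a b, μ F (X a) (X b) ≫ τ.hom.app _ = (τ.hom.app _ ⊗ₘ τ.hom.app _) ≫ μ F' _ _) :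
    NatTrans.IsMonoidal τ.hom := by
  have tensor : ∀ U V, μ F U V ≫ τ.hom.app _ = (τ.hom.app U ⊗ₘ τ.hom.app V) ≫ μ F' U V := by
    intro U V
    apply tensor_hom_ext hX F
    intro a b i j
    rw [μ_natural_assoc, τ.hom.naturality, reassoc_of% h, tensorHom_comp_tensorHom_assoc,
      τ.hom.naturality, τ.hom.naturality, ← tensorHom_comp_tensorHom_assoc, μ_natural]
  refine ⟨?_, tensor⟩
  -- The unit condition holds up to a scalar `z`; left unitality of both functors and the tensor
  -- condition give `τ = z • τ` at the unit object, so `z = 1`.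
  obtain ⟨z, hz⟩ := exists_eq_smul class_unit (ε F ≫ τ.hom.app (𝟙_ B)) (ε F')
  have h1 : (λ_ (F.obj (𝟙_ B))).hom ≫ τ.hom.app (𝟙_ B) =
      z • ((λ_ (F.obj (𝟙_ B))).hom ≫ τ.hom.app (𝟙_ B)) := by
    conv_lhs => rw [left_unitality F (𝟙_ B)]
    rw [Category.assoc, Category.assoc, τ.hom.naturality, reassoc_of% tensor,
      MonoidalCategory.tensorHom_def', Category.assoc, ← whisker_exchange_assoc,
      ← comp_whiskerRight_assoc, hz]
    rw [MonoidalLinear.smul_whiskerRight, Linear.smul_comp, Linear.comp_smul,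
      ← left_unitality F' (𝟙_ B), leftUnitor_naturality]
  have hF : toSkeleton (F.obj (𝟙_ B)) = ((1 : InvClasses B) : Skeleton B) :=
    (class_congr (Functor.Monoidal.εIso F)).symm.trans class_unit
  have h2 := smul_left_injective_of_class (class_tensor (class_unit (B := B)) hF)
    ((one_smul ℂ _).trans h1)
  rw [hz, ← h2, one_smul]

open Functor.LaxMonoidal in
/-- Functors which are compatible with the same frame up to isomorphism are isomorphic. -/
theorem exists_monoidal_natIso {Z : Frame (InvClasses B) B}
    (hZ : ∀ a, toSkeleton (Z.X a) = (a : Skeleton B)) {F F' : B ⥤ B} [F.Additive] [F'.Additive]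
    [F.Linear ℂ] [F'.Linear ℂ] [F.Monoidal] [F'.Monoidal]
    (v : ∀ a, F.obj (Z.X a) ≅ F'.obj (Z.X a))
    (hv : ∀ {a b e} (h : a * b = e), μ F _ _ ≫ F.map (Z.m h).hom ≫ (v e).hom =
      ((v a).hom ⊗ₘ (v b).hom) ≫ μ F' _ _ ≫ F'.map (Z.m h).hom) :
    ∃ τ : F ≅ F', NatTrans.IsMonoidal τ.hom ∧ ∀ a, τ.hom.app (Z.X a) = (v a).hom := by
  obtain ⟨τ, hτ⟩ := exists_natIso_of_reps hZ F F' v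
  have hτ' : ∀ a, τ.hom.app (Z.X a) = (v a).hom := fun a => congrArg Iso.hom (hτ a)
  refine ⟨τ, isMonoidal_of_reps hZ τ fun a b => ?_, hτ'⟩
  rw [← cancel_mono (F'.map (Z.m rfl).hom), Category.assoc, Category.assoc, ← τ.hom.naturality,
    hτ', hτ', hτ', hv]

open Functor.LaxMonoidal in
/-- Two monoidal isomorphisms differ by a character. -/
theorem exists_character {F F' : B ⥤ B} [F.Monoidal] [F'.Monoidal] [F'.Linear ℂ]
    (hF : ∀ (X : B) (a : InvClasses B), toSkeleton X = (a : Skeleton B) →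
      ∃ b : InvClasses B, toSkeleton (F.obj X) = (b : Skeleton B))
    (s t : F ≅ F') [NatTrans.IsMonoidal s.hom] [NatTrans.IsMonoidal t.hom] :
    ∃ χ : InvClasses B →* Circle, ∀ (X : B) (a : InvClasses B),
      toSkeleton X = (a : Skeleton B) → s.hom.app X = (χ a : ℂ) • t.hom.app X := by
  have h : ∀ a : InvClasses B, ∃ z : ℂ, ∀ X : B, toSkeleton X = (a : Skeleton B) →
      s.hom.app X = z • t.hom.app X := by
    intro a
    have ha := toSkeleton_fromSkeleton_obj (a : Skeleton B)
    obtain ⟨b, hb⟩ := hF _ a ha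
    obtain ⟨z, hz⟩ := exists_eq_smul hb (s.hom.app _) (t.hom.app _)
    refine ⟨z, fun X hX => ?_⟩
    obtain ⟨i⟩ := exists_iso_of_class ha hX
    rw [← cancel_epi (F.map i.hom), s.hom.naturality, hz, Linear.comp_smul, t.hom.naturality,
      Linear.smul_comp]
  choose z hz using h
  have uniq : ∀ (X : B) (a : InvClasses B), toSkeleton X = (a : Skeleton B) → ∀ x y : ℂ,
      x • t.hom.app X = y • t.hom.app X → x = y := by
    intro X a hX x y hxy
    obtain ⟨b, hb⟩ := hF _ a hX
    exact smul_left_injective_of_class hb hxy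
  have map_one : z 1 = 1 := by
    have h1 := NatTrans.IsMonoidal.unit (τ := s.hom)
    rw [hz 1 _ class_unit, Linear.comp_smul, NatTrans.IsMonoidal.unit] at h1
    exact smul_left_injective_of_class class_unit (h1.trans (one_smul ℂ _).symm)
  have map_mul : ∀ a b, z (a * b) = z a * z b := by
    intro a b
    have ha := toSkeleton_fromSkeleton_obj (a : Skeleton B)
    have hb := toSkeleton_fromSkeleton_obj (b : Skeleton B)
    apply uniq _ _ (class_tensor ha hb)
    rw [← cancel_epi (μ F _ _), ← hz _ _ (class_tensor ha hb), NatTrans.IsMonoidal.tensor,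
      hz _ _ ha, hz _ _ hb, Linear.comp_smul, NatTrans.IsMonoidal.tensor]
    simp only [MonoidalCategory.tensorHom_def, MonoidalLinear.smul_whiskerRight,
      MonoidalLinear.whiskerLeft_smul, Linear.smul_comp, Linear.comp_smul, smul_smul]
    rw [mul_comm]
  let f : InvClasses B →* ℂ := ⟨⟨z, map_one⟩, map_mul⟩
  -- The group of classes is finite, so `z a` is a root of unity.
  have hf : ∀ a, ‖z a‖ = 1 := by
    intro a
    have h1 : IsOfFinOrder (f a) := f.isOfFinOrder (isOfFinOrder_of_finite a)
    exact h1.norm_eq_one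
  exact ⟨⟨⟨fun a => ⟨z a, mem_sphere_zero_iff_norm.2 (hf a)⟩, Circle.ext map_one⟩,
    fun a b => Circle.ext (map_mul a b)⟩, fun X a hX => hz a X hX⟩

end Construction

/-! ### Reindexing, mapping and rescaling frames -/

section FrameOperations

variable {A : Type u} [CommGroup A] {B : Type u} [Category.{v} B] [MonoidalCategory B]
  [BraidedCategory B]

namespace Frame

theorem exists_class_pair (Z : Frame A B) (a b : A) :
    ∃ x : InvClasses B, toSkeleton (Z.X a ⊗ Z.X b) = (x : Skeleton B) := by
  obtain ⟨_, hx⟩ := Z.invertible b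
  exact (Z.invertible a).elim fun _ h => ⟨_, class_tensor h hx⟩

theorem m_hom_eq (Z : Frame A B) {a b e e' : A} (h : a * b = e) (h' : a * b = e') (h'' : e = e') :
    (Z.m h').hom = (Z.m h).hom ≫ eqToHom (congrArg Z.X h'') := by
  subst h''
  simp

/-- Reindexing a frame along an automorphism. -/
def reindex (Z : Frame A B) (σ : MulAut A) : Frame A B where
  X a := Z.X (σ a)
  m {a b _} h := Z.m ((map_mul σ a b).symm.trans (congrArg σ h))
  invertible a := Z.invertible (σ a)

variable [Preadditive B] [Linear ℂ B]

theorem HasScalars.reindex {Z : Frame A B} {ω : A → A → A → ℂ} {c : A → A → ℂ}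
    (H : Z.HasScalars ω c) (σ : MulAut A) :
    (Z.reindex σ).HasScalars (fun a b d => ω (σ a) (σ b) (σ d)) (fun a b => c (σ a) (σ b)) :=
  ⟨fun _ _ _ _ => H.assoc _ _ _ _, fun _ _ => H.braid _ _⟩

open Functor.LaxMonoidal in
/-- The image of a frame under a braided functor. -/
noncomputable def map (Z : Frame A B) (F : B ⥤ B) [F.Monoidal]
    (hF : ∀ (X : B) (a : InvClasses B), toSkeleton X = (a : Skeleton B) →
      ∃ b : InvClasses B, toSkeleton (F.obj X) = (b : Skeleton B)) : Frame A B where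
  X a := F.obj (Z.X a)
  m h := Functor.Monoidal.μIso F _ _ ≪≫ F.mapIso (Z.m h)
  invertible a := (Z.invertible a).elim fun _ h => hF _ _ h

open Functor.LaxMonoidal in
theorem HasScalars.map {Z : Frame A B} {ω : A → A → A → ℂ} {c : A → A → ℂ}
    (H : Z.HasScalars ω c) (F : B ⥤ B) [F.Braided] [F.Linear ℂ]
    (hF : ∀ (X : B) (a : InvClasses B), toSkeleton X = (a : Skeleton B) →
      ∃ b : InvClasses B, toSkeleton (F.obj X) = (b : Skeleton B)) :
    (Z.map F hF).HasScalars ω c where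
  assoc {a b d e f k} h₁ h₂ h₃ h₄ := by
    change (α_ (F.obj (Z.X a)) (F.obj (Z.X b)) (F.obj (Z.X d))).inv ≫
      (μ F (Z.X a) (Z.X b) ≫ F.map (Z.m h₁).hom) ▷ F.obj (Z.X d) ≫
        μ F (Z.X e) (Z.X d) ≫ F.map (Z.m h₂).hom = ω a b d •
      (F.obj (Z.X a) ◁ (μ F (Z.X b) (Z.X d) ≫ F.map (Z.m h₃).hom) ≫
        μ F (Z.X a) (Z.X f) ≫ F.map (Z.m h₄).hom)
    simp only [comp_whiskerRight, whiskerLeft_comp, Category.assoc]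
    rw [μ_natural_left_assoc, μ_natural_right_assoc, ← associativity_inv_assoc,
      ← F.map_comp, ← F.map_comp, ← F.map_comp, H.assoc h₁ h₂ h₃ h₄, F.map_smul]
    simp only [Linear.comp_smul]
  braid {a b e} h₁ h₂ := by
    change (β_ (F.obj (Z.X a)) (F.obj (Z.X b))).hom ≫ μ F (Z.X b) (Z.X a) ≫ F.map (Z.m h₁).hom =
      c a b • (μ F (Z.X a) (Z.X b) ≫ F.map (Z.m h₂).hom)
    rw [← Functor.LaxBraided.braided_assoc, ← F.map_comp, H.braid h₁ h₂, F.map_smul,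
      Linear.comp_smul]

/-- Rescaling the multiplication of a frame. -/
def rescale (Z : Frame A B) (t : A → A → ℂˣ) : Frame A B where
  X := Z.X
  m {a b _} h :=
    { hom := (t a b : ℂ) • (Z.m h).hom
      inv := ((t a b)⁻¹ : ℂˣ) • (Z.m h).inv
      hom_inv_id := by simp [Units.smul_def, smul_smul]
      inv_hom_id := by simp [Units.smul_def, smul_smul] }
  invertible := Z.invertible

variable [MonoidalPreadditive B] [MonoidalLinear ℂ B]

/-- Each multiplication moved across `v` contributes a factor of `t`, so the scalars change by a
coboundary. This form covers both rescaling one frame and comparing the images of a frame under two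
functors. -/
theorem HasScalars.transfer {Y Y' : Frame A B} {ω : A → A → A → ℂ} {c : A → A → ℂ}
    (H : Y'.HasScalars ω c) (v : ∀ a, Y.X a ≅ Y'.X a) (t : A → A → ℂˣ)
    (hv : ∀ {a b e} (h : a * b = e), (Y.m h).hom ≫ (v e).hom =
      (t a b : ℂ) • (((v a).hom ⊗ₘ (v b).hom) ≫ (Y'.m h).hom)) :
    Y.HasScalars (fun a b d => t a b * t (a * b) d * ω a b d / (t b d * t a (b * d)))
      (fun a b => t b a * c a b / t a b) where
  assoc {a b d e f k} h₁ h₂ h₃ h₄ := by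
    have e1 : (Y.m h₁).hom ▷ Y.X d ≫ ((v e).hom ⊗ₘ (v d).hom) = (t a b : ℂ) •
        ((((v a).hom ⊗ₘ (v b).hom) ⊗ₘ (v d).hom) ≫ (Y'.m h₁).hom ▷ Y'.X d) := by
      rw [MonoidalCategory.tensorHom_def (v e).hom, ← comp_whiskerRight_assoc, hv h₁,
        MonoidalLinear.smul_whiskerRight, Linear.smul_comp, comp_whiskerRight, Category.assoc,
        ← whisker_exchange, MonoidalCategory.tensorHom_def _ (v d).hom, Category.assoc]
    have e2 : Y.X a ◁ (Y.m h₃).hom ≫ ((v a).hom ⊗ₘ (v f).hom) = (t b d : ℂ) •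
        (((v a).hom ⊗ₘ ((v b).hom ⊗ₘ (v d).hom)) ≫ Y'.X a ◁ (Y'.m h₃).hom) := by
      rw [MonoidalCategory.tensorHom_def' (v a).hom, ← whiskerLeft_comp_assoc, hv h₃,
        MonoidalLinear.whiskerLeft_smul, Linear.smul_comp, whiskerLeft_comp, Category.assoc,
        whisker_exchange, MonoidalCategory.tensorHom_def' (v a).hom, Category.assoc]
    subst h₁ h₃
    rw [← cancel_mono (v k).hom]
    simp only [Category.assoc, Linear.smul_comp]
    rw [hv h₂, hv h₄, Linear.comp_smul, Linear.comp_smul, Linear.comp_smul, reassoc_of% e1,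
      reassoc_of% e2, Linear.smul_comp, Linear.smul_comp, Linear.comp_smul, Category.assoc,
      Category.assoc, ← associator_inv_naturality_assoc, H.assoc rfl h₂ rfl h₄]
    simp only [Linear.comp_smul, smul_smul]
    congr 1
    field_simp
  braid {a b e} h₁ h₂ := by
    rw [← cancel_mono (v e).hom, Category.assoc, hv h₁, Linear.smul_comp, hv h₂,
      Linear.comp_smul, ← BraidedCategory.braiding_naturality_assoc, H.braid h₁ h₂]
    simp only [Linear.comp_smul, smul_smul]
    congr 1
    field_simp

theorem HasScalars.rescale {Z : Frame A B} {ω : A → A → A → ℂ} {c : A → A → ℂ}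
    (H : Z.HasScalars ω c) (t : A → A → ℂˣ) : (Z.rescale t).HasScalars
      (fun a b d => t a b * t (a * b) d * ω a b d / (t b d * t a (b * d)))
      (fun a b => t b a * c a b / t a b) :=
  H.transfer (Y := Z.rescale t) (fun a => Iso.refl (Z.X a)) t fun {a b e} h => by
    change ((t a b : ℂ) • (Z.m h).hom) ≫ 𝟙 (Z.X e) =
      (t a b : ℂ) • ((𝟙 (Z.X a) ⊗ₘ 𝟙 (Z.X b)) ≫ (Z.m h).hom)
    simp

end Frame

end FrameOperations

/-! ### Existence and uniqueness of scalars -/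

section FrameScalars

variable {A : Type u} [CommGroup A] {B : Type u} [Category.{v} B] [MonoidalCategory B]
  [BraidedCategory B] [Abelian B] [Linear ℂ B] [MonoidalPreadditive B] [MonoidalLinear ℂ B]
  [IsPointedBraidedFusion B] {Z Y : Frame A B}

namespace Frame

theorem HasScalars.unique {ω ω' : A → A → A → ℂ} {c c' : A → A → ℂ} (H : Z.HasScalars ω c)
    (H' : Z.HasScalars ω' c') : (∀ a b d, ω a b d = ω' a b d) ∧ ∀ a b, c a b = c' a b := by
  constructor
  · intro a b d
    obtain ⟨_, hx⟩ := Z.exists_class_triple a b d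
    exact smul_left_injective_of_class hx ((H.assoc rfl rfl rfl (mul_assoc a b d).symm).symm.trans
      (H'.assoc rfl rfl rfl (mul_assoc a b d).symm))
  · intro a b
    obtain ⟨_, hx⟩ := Z.exists_class_pair a b
    exact smul_left_injective_of_class hx ((H.braid (mul_comm b a) rfl).symm.trans
      (H'.braid (mul_comm b a) rfl))

theorem exists_hasScalars (Z : Frame A B) : ∃ (ω : A → A → A → ℂˣ) (c : A → A → ℂˣ),
    Z.HasScalars (fun a b d => ω a b d) (fun a b => c a b) := by
  have h1 : ∀ a b d, ∃ z : ℂˣ,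
      (α_ (Z.X a) (Z.X b) (Z.X d)).inv ≫ (Z.m rfl).hom ▷ Z.X d ≫ (Z.m rfl).hom =
        (z : ℂ) • (Z.X a ◁ (Z.m rfl).hom ≫ (Z.m (mul_assoc a b d).symm).hom) := fun a b d => by
    obtain ⟨_, hx⟩ := Z.exists_class_triple a b d
    exact exists_eq_unit_smul hx _ _
  have h2 : ∀ a b, ∃ z : ℂˣ, (β_ (Z.X a) (Z.X b)).hom ≫ (Z.m (mul_comm b a)).hom =
      (z : ℂ) • (Z.m rfl).hom := fun a b => by
    obtain ⟨_, hx⟩ := Z.exists_class_pair a b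
    exact exists_eq_unit_smul hx _ _
  choose ω hω using h1
  choose c hc using h2
  refine ⟨ω, c, ?_, ?_⟩
  · intro a b d e f k h₁ h₂ h₃ h₄
    subst h₁ h₂ h₃
    exact hω a b d
  · intro a b e h₁ h₂
    subst h₂
    exact hc a b

theorem exists_scalars_compare (v : ∀ a, Y.X a ≅ Z.X a) : ∃ t : A → A → ℂˣ,
    ∀ {a b e} (h : a * b = e), (Y.m h).hom ≫ (v e).hom =
      (t a b : ℂ) • (((v a).hom ⊗ₘ (v b).hom) ≫ (Z.m h).hom) := by
  have h : ∀ a b, ∃ t : ℂˣ, (Y.m rfl).hom ≫ (v (a * b)).hom =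
      (t : ℂ) • (((v a).hom ⊗ₘ (v b).hom) ≫ (Z.m rfl).hom) := fun a b => by
    obtain ⟨_, hx⟩ := Y.exists_class_pair a b
    exact exists_eq_unit_smul hx _ _
  choose t ht using h
  refine ⟨t, ?_⟩
  rintro a b _ rfl
  exact ht a b

end Frame

end FrameScalars

/-! ### Divisibility of `ℂˣ` and `U(1)`, and multiplicative vanishing results -/

section Coefficients

noncomputable instance : DivisibleBy (Additive ℂˣ) ℤ :=
  divisibleByOfSMulRightSurj _ _ fun {n} hn => by
    have key : ∀ m : ℕ, m ≠ 0 → ∀ x : ℂˣ, ∃ y : ℂˣ, y ^ m = x := by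
      intro m hm x
      obtain ⟨y, hy⟩ := IsAlgClosed.exists_pow_nat_eq (x : ℂ) (Nat.pos_of_ne_zero hm)
      have hy0 : y ≠ 0 := by
        rintro rfl
        rw [zero_pow hm] at hy
        exact x.ne_zero hy.symm
      exact ⟨Units.mk0 y hy0, Units.ext hy⟩
    intro x
    obtain ⟨y, hy⟩ := key n.natAbs (Int.natAbs_ne_zero.2 hn) x.toMul
    rcases Int.natAbs_eq n with h | h
    · refine ⟨Additive.ofMul y, ?_⟩
      change n • Additive.ofMul y = x
      rw [h, natCast_zsmul, ← ofMul_pow, hy, ofMul_toMul]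
    · refine ⟨Additive.ofMul y⁻¹, ?_⟩
      change n • Additive.ofMul y⁻¹ = x
      rw [h, ofMul_inv, neg_smul, smul_neg, neg_neg, natCast_zsmul, ← ofMul_pow, hy, ofMul_toMul]

noncomputable instance : DivisibleBy (Additive Circle) ℤ :=
  divisibleByOfSMulRightSurj _ _ fun {n} hn => by
    intro x
    refine ⟨Additive.ofMul (Circle.exp (Complex.arg x.toMul / n)), ?_⟩
    change n • Additive.ofMul (Circle.exp (Complex.arg x.toMul / n)) = x
    rw [← ofMul_zpow, ← Circle.exp_intCast_mul, mul_div_cancel₀ _ (by exact_mod_cast hn),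
      Circle.exp_arg, ofMul_toMul]

variable {A : Type*} [CommGroup A] {M : Type*} [CommGroup M]

/-- A symmetric 2-cocycle on an abelian group, with divisible coefficients, is a coboundary. -/
theorem exists_symmetric_coboundary_mul [DivisibleBy (Additive M) ℤ] (f : A → A → M)
    (hf : ∀ a b d, f b d * f a (b * d) = f (a * b) d * f a b) (hs : ∀ a b, f a b = f b a) :
    ∃ η : A → M, ∀ a b, f a b = η a * η b / η (a * b) :=
  exists_symmetric_coboundary (A := Additive A) (M := Additive M) f hf hs

/-- An abelian 3-cocycle on a finite abelian group, with divisible coefficients and vanishing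
quadratic function, is a coboundary. -/
theorem exists_abelian_coboundary_mul [Finite A] [DivisibleBy (Additive M) ℤ]
    (ω : A → A → A → M) (c : A → A → M)
    (pentagon : ∀ a b d e, ω b d e * ω a (b * d) e * ω a b d = ω (a * b) d e * ω a b (d * e))
    (hexagon₁ : ∀ a b d, c a (b * d) * ω b a d = c a b * c a d * ω b d a * ω a b d)
    (hexagon₂ : ∀ a b d, c (a * b) d * ω a b d * ω d a b = c a d * c b d * ω a d b)
    (alt : ∀ a, c a a = 1) :
    ∃ ψ : A → A → M, (∀ a b d, ω a b d = ψ b d * ψ a (b * d) / ψ (a * b) d / ψ a b) ∧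
      ∀ a b, c a b = ψ a b / ψ b a := by
  obtain ⟨ψ, h⟩ := altCocyclesSplit_of_finite (A := Additive A) (M := Additive M) ω c
    ⟨pentagon, hexagon₁, hexagon₂⟩ alt
  exact ⟨ψ, h.assoc, h.braid⟩

end Coefficients

/-! ### Presentations with values in `U(1)` -/

section Presentations

variable {B : Type u} [Category.{v} B] [MonoidalCategory B] [BraidedCategory B]
  [Abelian B] [Linear ℂ B]

/-- The multiplication of a presentation, with a chosen name for the product. -/
noncomputable def VecPresentation.mul (P : VecPresentation B) {a b e : InvClasses B}
    (h : a * b = e) : P.X a ⊗ P.X b ≅ P.X e :=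
  P.μ a b ≪≫ eqToIso (congrArg P.X h)

/-- The frame underlying a presentation. -/
noncomputable def VecPresentation.frame (P : VecPresentation B) : Frame (InvClasses B) B where
  X := P.X
  m h := P.mul h
  invertible a := ⟨a, P.class_X a⟩

theorem VecPresentation.hasScalars (P : VecPresentation B) :
    P.frame.HasScalars (fun a b d => P.ω a b d) (fun a b => P.c a b) where
  assoc {a b d e f k} h₁ h₂ h₃ h₄ := by
    subst h₁ h₂ h₃
    have := P.associator_eq a b d
    simp only [VecPresentation.frame, VecPresentation.mul, Iso.trans_hom, eqToIso.hom, eqToHom_refl, Category.comp_id]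
    exact this
  braid {a b e} h₁ h₂ := by
    subst h₁
    have := P.braiding_eq a b
    simp only [VecPresentation.frame, VecPresentation.mul, Iso.trans_hom, eqToIso.hom, eqToHom_refl, Category.comp_id]
    exact this

variable [MonoidalPreadditive B] [MonoidalLinear ℂ B] [IsPointedBraidedFusion B]

namespace VecPresentation

variable (P : VecPresentation B)

theorem pentagon (a b d e : InvClasses B) :
    P.ω b d e * P.ω a (b * d) e * P.ω a b d = P.ω (a * b) d e * P.ω a b (d * e) := by
  apply Circle.ext
  simpa using P.hasScalars.pentagon a b d e

theorem hexagon₁ (a b d : InvClasses B) :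
    P.c a (b * d) * P.ω b a d = P.c a b * P.c a d * P.ω b d a * P.ω a b d := by
  apply Circle.ext
  simpa using P.hasScalars.hexagon₁ a b d

theorem hexagon₂ (a b d : InvClasses B) :
    P.c (a * b) d * P.ω a b d * P.ω d a b = P.c a d * P.c b d * P.ω a d b := by
  apply Circle.ext
  simpa using P.hasScalars.hexagon₂ a b d

/-- Automorphisms preserving `q` preserve the abelian cohomology class of `(ω, c)`. -/
theorem exists_cochain {σ : MulAut (InvClasses B)}
    (hσ : ∀ a, selfBraiding B (σ a) = selfBraiding B a) :
    ∃ ψ : InvClasses B → InvClasses B → Circle,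
      (∀ a b d, P.ω a b d / P.ω (σ a) (σ b) (σ d) =
        (ψ b d * ψ a (b * d)) / (ψ (a * b) d * ψ a b)) ∧
      ∀ a b, P.c a b / P.c (σ a) (σ b) = ψ a b / ψ b a := by
  -- The quotient of two abelian cocycles is one; its quadratic function is `q a / q (σ a) = 1`.
  obtain ⟨ψ, h1, h2⟩ := exists_abelian_coboundary_mul
    (fun a b d => P.ω a b d / P.ω (σ a) (σ b) (σ d)) (fun a b => P.c a b / P.c (σ a) (σ b))
    (fun a b d e => by
      have h1 := P.pentagon a b d e
      have h2 := P.pentagon (σ a) (σ b) (σ d) (σ e)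
      simp only [map_mul, div_mul_div_comm, h1, h2])
    (fun a b d => by
      have h1 := P.hexagon₁ a b d
      have h2 := P.hexagon₁ (σ a) (σ b) (σ d)
      simp only [map_mul, div_mul_div_comm, h1, h2])
    (fun a b d => by
      have h1 := P.hexagon₂ a b d
      have h2 := P.hexagon₂ (σ a) (σ b) (σ d)
      simp only [map_mul, div_mul_div_comm, h1, h2])
    (fun a => by
      have := hσ a
      rw [P.c_self, P.c_self] at this
      rw [Circle.ext this, div_self'])
  exact ⟨ψ, fun a b d => by rw [h1, div_div], h2⟩

end VecPresentation

/-- Logarithms of absolute values turn `(ω, c)` into a real abelian cocycle, which is a coboundary;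
the positive rescaling by its exponential leaves scalars of norm one. -/
theorem nonempty_vecPresentation : Nonempty (VecPresentation B) := by
  let X : InvClasses B → B := fun a => (fromSkeleton B).obj (a : Skeleton B)
  have hX : ∀ a, toSkeleton (X a) = (a : Skeleton B) := fun a => toSkeleton_fromSkeleton_obj _
  have hm : ∀ a b, Nonempty (X a ⊗ X b ≅ X (a * b)) := fun a b =>
    exists_iso_of_class (class_tensor (hX a) (hX b)) (hX _)
  let Z : Frame (InvClasses B) B :=
    { X := X
      m := fun {a b _} h => (hm a b).some ≪≫ eqToIso (congrArg X h)
      invertible := fun a => ⟨a, hX a⟩ }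
  obtain ⟨ω, c, H⟩ := Z.exists_hasScalars
  have hlog : ∀ x y : ℂˣ, Real.log ‖((x * y : ℂˣ) : ℂ)‖ =
      Real.log ‖(x : ℂ)‖ + Real.log ‖(y : ℂ)‖ := by
    intro x y
    rw [Units.val_mul, norm_mul, Real.log_mul (by simp) (by simp)]
  have hC : IsAbelianCocycle (A := Additive (InvClasses B))
      (fun a b d => Real.log ‖(ω a.toMul b.toMul d.toMul : ℂ)‖)
      (fun a b => Real.log ‖(c a.toMul b.toMul : ℂ)‖) :=
    { pentagon := fun a b d e => by
        simp only [← hlog]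
        congr 2
        simpa using H.pentagon a.toMul b.toMul d.toMul e.toMul
      hexagon₁ := fun a b d => by
        simp only [← hlog]
        congr 2
        simpa using H.hexagon₁ a.toMul b.toMul d.toMul
      hexagon₂ := fun a b d => by
        simp only [← hlog]
        congr 2
        simpa using H.hexagon₂ a.toMul b.toMul d.toMul }
  obtain ⟨ψ, hψ⟩ := hC.exists_real_coboundary
  let t : InvClasses B → InvClasses B → ℂˣ := fun a b =>
    Units.mk0 (Real.exp (ψ (.ofMul a) (.ofMul b)) : ℂ) (by exact_mod_cast Real.exp_ne_zero _)
  have ht : ∀ a b, ‖(t a b : ℂ)‖ = Real.exp (ψ (.ofMul a) (.ofMul b)) := fun a b => by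
    simp [t, Complex.norm_exp]
  have hnorm : ∀ x : ℂˣ, ‖(x : ℂ)‖ = Real.exp (Real.log ‖(x : ℂ)‖) := fun x =>
    (Real.exp_log (by simp)).symm
  have H' := H.rescale t
  have h1 : ∀ a b d, ‖(t a b * t (a * b) d * ω a b d / (t b d * t a (b * d)) : ℂ)‖ = 1 := by
    intro a b d
    have := hψ.assoc (.ofMul a) (.ofMul b) (.ofMul d)
    simp only [toMul_ofMul] at this
    rw [norm_div, norm_mul, norm_mul, norm_mul, ht, ht, ht, ht, hnorm (ω a b d), this,
      ← Real.exp_add, ← Real.exp_add, ← Real.exp_add, ← Real.exp_sub]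
    rw [Real.exp_eq_one_iff]
    simp only [ofMul_mul]
    ring
  have h2 : ∀ a b, ‖(t b a * c a b / t a b : ℂ)‖ = 1 := by
    intro a b
    have := hψ.braid (.ofMul a) (.ofMul b)
    simp only [toMul_ofMul] at this
    rw [norm_div, norm_mul, ht, ht, hnorm (c a b), this, ← Real.exp_add, ← Real.exp_sub,
      Real.exp_eq_one_iff]
    ring
  refine ⟨{ X := X
            class_X := hX
            μ := fun a b => (Z.rescale t).m rfl
            ω := fun a b d => ⟨_, mem_sphere_zero_iff_norm.2 (h1 a b d)⟩
            c := fun a b => ⟨_, mem_sphere_zero_iff_norm.2 (h2 a b)⟩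
            associator_eq := fun a b d => ?_
            braiding_eq := fun a b => ?_ }⟩
  · refine (H'.assoc rfl rfl rfl (mul_assoc a b d).symm).trans ?_
    rw [(Z.rescale t).m_hom_eq rfl (mul_assoc a b d).symm (mul_assoc a b d).symm]
    rfl
  · have := H'.braid (rfl : b * a = _) (mul_comm a b)
    rw [(Z.rescale t).m_hom_eq rfl (mul_comm a b) (mul_comm a b)] at this
    exact this

end Presentations

/-! ### Classification of braided autoequivalences -/

section Autoequivalences

variable {B : Type u} [Category.{v} B] [MonoidalCategory B] [BraidedCategory B]

theorem exists_class_map (F : B ⥤ B) [F.Monoidal] {X : B} {a : InvClasses B}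
    (hX : toSkeleton X = (a : Skeleton B)) :
    ∃ b : InvClasses B, toSkeleton (F.obj X) = (b : Skeleton B) := by
  obtain ⟨W, ⟨i⟩⟩ := exists_tensor_inverse hX
  exact exists_class_of_tensor_inverse
    (Functor.Monoidal.μIso F X W ≪≫ F.mapIso i ≪≫ (Functor.Monoidal.εIso F).symm)

namespace BraidedAutoequiv

section Basic

variable [Preadditive B] [Linear ℂ B]

theorem Induces.unique {F : BraidedAutoequiv B} {σ τ : MulAut (InvClasses B)}
    (hσ : F.Induces σ) (hτ : F.Induces τ) : σ = τ := by
  ext a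
  have ha := toSkeleton_fromSkeleton_obj (a : Skeleton B)
  exact (hσ _ a ha).symm.trans (hτ _ a ha)

theorem Induces.comp {F F' : BraidedAutoequiv B} {σ τ : MulAut (InvClasses B)}
    (hσ : F.Induces σ) (hτ : F'.Induces τ) : (F.comp F').Induces (σ * τ) :=
  fun X a hX => hσ _ _ (hτ X a hX)

theorem Induces.congr {F F' : BraidedAutoequiv B} {σ : MulAut (InvClasses B)}
    (hσ : F.Induces σ) (h : F ≈ F') : F'.Induces σ := by
  obtain ⟨e, -⟩ := h
  exact fun X a hX => (class_congr (e.app X)).symm.trans (hσ X a hX)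

theorem induces_of_reps {X : InvClasses B → B} (hX : ∀ a, toSkeleton (X a) = (a : Skeleton B))
    {F : BraidedAutoequiv B} {σ : MulAut (InvClasses B)}
    (u : ∀ a, F.functor.obj (X a) ≅ X (σ a)) : F.Induces σ := by
  intro U a hU
  obtain ⟨i⟩ := exists_iso_of_class hU (hX a)
  exact (class_congr (F.functor.mapIso i ≪≫ u a)).trans (hX _)

end Basic

variable [Abelian B] [Linear ℂ B] [MonoidalPreadditive B] [MonoidalLinear ℂ B]
  [IsPointedBraidedFusion B]

theorem exists_induces (F : BraidedAutoequiv B) :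
    ∃ σ : orthogonalGroup (InvClasses B) (selfBraiding B), F.Induces σ := by
  have h : ∀ a : InvClasses B, ∃ b : InvClasses B, ∀ X : B, toSkeleton X = (a : Skeleton B) →
      toSkeleton (F.functor.obj X) = (b : Skeleton B) := by
    intro a
    have ha := toSkeleton_fromSkeleton_obj (a : Skeleton B)
    obtain ⟨b, hb⟩ := exists_class_map F.functor ha
    refine ⟨b, fun X hX => ?_⟩
    obtain ⟨i⟩ := exists_iso_of_class ha hX
    exact (class_congr (F.functor.mapIso i)).symm.trans hb
  choose f hf using h
  have map_mul : ∀ a b, f (a * b) = f a * f b := by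
    intro a b
    have ha := toSkeleton_fromSkeleton_obj (a : Skeleton B)
    have hb := toSkeleton_fromSkeleton_obj (b : Skeleton B)
    apply Units.ext
    rw [← hf _ _ (class_tensor ha hb), ← class_tensor (hf _ _ ha) (hf _ _ hb)]
    exact (class_congr (Functor.Monoidal.μIso F.functor _ _)).symm
  have inj : Function.Injective f := by
    intro a b hab
    have ha := toSkeleton_fromSkeleton_obj (a : Skeleton B)
    have hb := toSkeleton_fromSkeleton_obj (b : Skeleton B)
    obtain ⟨i⟩ := exists_iso_of_class (hf _ _ ha) (hab ▸ hf _ _ hb)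
    exact Units.ext (ha.symm.trans ((class_congr (F.functor.preimageIso i)).trans hb))
  -- Full faithfulness makes the induced endomorphism injective, hence bijective on a finite group.
  let σ : MulAut (InvClasses B) :=
    MulEquiv.ofBijective (⟨f, map_mul⟩ : InvClasses B →ₙ* InvClasses B)
      ⟨inj, Finite.surjective_of_injective inj⟩
  refine ⟨⟨σ, fun a => ?_⟩, fun X a hX => hf a X hX⟩
  have ha := toSkeleton_fromSkeleton_obj (a : Skeleton B)
  obtain ⟨z, hz⟩ := exists_eq_smul_id (class_tensor ha ha) (β_ _ _).hom
  rw [selfBraiding_eq ha hz]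
  apply selfBraiding_eq (hf _ _ ha)
  rw [← cancel_mono (Functor.LaxMonoidal.μ F.functor _ _), ← Functor.LaxBraided.braided, hz,
    F.functor.map_smul]
  simp

open Functor.LaxMonoidal in
/-- Autoequivalences which induce the same automorphism of `A` are isomorphic. -/
theorem exists_iso_of_induces {F F' : BraidedAutoequiv B} {σ : MulAut (InvClasses B)}
    (hF : F.Induces σ) (hF' : F'.Induces σ) : F ≈ F' := by
  obtain ⟨P⟩ := nonempty_vecPresentation (B := B)
  have hP := P.class_X
  have v : ∀ a, F.functor.obj (P.X a) ≅ F'.functor.obj (P.X a) := fun a =>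
    (exists_iso_of_class (hF _ _ (hP a)) (hF' _ _ (hP a))).some
  let Y := P.frame.map F.functor fun _ _ h => exists_class_map _ h
  let Y' := P.frame.map F'.functor fun _ _ h => exists_class_map _ h
  have HY : Y.HasScalars _ _ := P.hasScalars.map F.functor fun _ _ h => exists_class_map _ h
  have HY' : Y'.HasScalars _ _ := P.hasScalars.map F'.functor fun _ _ h => exists_class_map _ h
  obtain ⟨t, ht⟩ := Frame.exists_scalars_compare (Y := Y) (Z := Y') v
  -- The images of the frame under both functors have the scalars of `P`, so the defect `t` of `v`
  -- has trivial abelian coboundary: it is a symmetric 2-cocycle.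
  obtain ⟨h1, h2⟩ := HY.unique (HY'.transfer v t ht)
  obtain ⟨η, hη⟩ := exists_symmetric_coboundary_mul t
    (fun a b d => by
      have := h1 a b d
      apply Units.ext
      push_cast
      have hω : (P.ω a b d : ℂ) ≠ 0 := Circle.coe_ne_zero _
      field_simp at this
      linear_combination this)
    (fun a b => by
      have := h2 a b
      apply Units.ext
      have hc : (P.c a b : ℂ) ≠ 0 := Circle.coe_ne_zero _
      field_simp at this
      exact this)
  have hη' : ∀ a b, (t a b : ℂ) * η (a * b) = η a * η b := by
    intro a b
    rw [hη]
    push_cast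
    field_simp
  -- Rescaling by `η`, whose coboundary is `t`, makes the comparison compatible with the tensor
  -- structures.
  let v' : ∀ a, F.functor.obj (P.X a) ≅ F'.functor.obj (P.X a) := fun a =>
    { hom := (η a : ℂ) • (v a).hom
      inv := ((η a)⁻¹ : ℂˣ) • (v a).inv
      hom_inv_id := by simp [Units.smul_def, smul_smul]
      inv_hom_id := by simp [Units.smul_def, smul_smul] }
  obtain ⟨τ, hτ, -⟩ := exists_monoidal_natIso (Z := P.frame) hP v' (by
    intro a b e h
    have := ht h
    subst h
    change μ F.functor (P.X a) (P.X b) ≫ F.functor.map (P.mul rfl).hom ≫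
        ((η (a * b) : ℂ) • (v (a * b)).hom) =
      (((η a : ℂ) • (v a).hom) ⊗ₘ ((η b : ℂ) • (v b).hom)) ≫
        μ F'.functor (P.X a) (P.X b) ≫ F'.functor.map (P.mul rfl).hom
    replace this : μ F.functor (P.X a) (P.X b) ≫ F.functor.map (P.mul rfl).hom ≫
        (v (a * b)).hom = (t a b : ℂ) • (((v a).hom ⊗ₘ (v b).hom) ≫
          μ F'.functor (P.X a) (P.X b) ≫ F'.functor.map (P.mul rfl).hom) :=
      (Category.assoc _ _ _).symm.trans this
    simp only [MonoidalCategory.tensorHom_def, MonoidalLinear.smul_whiskerRight,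
      MonoidalLinear.whiskerLeft_smul, Linear.smul_comp, Linear.comp_smul, smul_smul] at this ⊢
    rw [this, smul_smul, (mul_comm _ _).trans (hη' a b), mul_comm (η b : ℂ)])
  exact ⟨τ, hτ⟩

/-- A linear functor realizing `σ⁻¹` on representatives is a quasi-inverse, since agreement with the
identity on representatives already gives a natural isomorphism. -/
theorem isEquivalence_of_reps {X : InvClasses B → B}
    (hX : ∀ a, toSkeleton (X a) = (a : Skeleton B)) (F : B ⥤ B) [F.Additive] [F.Linear ℂ]
    (σ : MulAut (InvClasses B)) (u : ∀ a, F.obj (X a) ≅ X (σ a)) : F.IsEquivalence := by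
  have := Abelian.hasFiniteBiproducts (C := B)
  obtain ⟨G, _, _, ⟨w⟩⟩ := exists_functor_of_reps hX fun a => X (σ⁻¹ a)
  obtain ⟨η, -⟩ := exists_natIso_of_reps hX (𝟭 B) (F ⋙ G) fun a =>
    eqToIso (congrArg X (MulAut.inv_apply_self _ σ a).symm) ≪≫ (w (σ a)).symm ≪≫ G.mapIso (u a).symm
  obtain ⟨ε, -⟩ := exists_natIso_of_reps hX (G ⋙ F) (𝟭 B) fun a =>
    F.mapIso (w a) ≪≫ u _ ≪≫ eqToIso (congrArg X (MulAut.apply_inv_self _ σ a))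
  exact (CategoryTheory.Equivalence.mk F G η ε).isEquivalence_functor

open Functor.LaxMonoidal in
/-- The braided autoequivalence of `Vec_A^{ω,c}` defined by `(σ, ψ)`. -/
theorem exists_of_cochain (P : VecPresentation B) {σ : MulAut (InvClasses B)}
    {ψ : InvClasses B → InvClasses B → Circle}
    (h1 : ∀ a b d, P.ω a b d / P.ω (σ a) (σ b) (σ d) =
      (ψ b d * ψ a (b * d)) / (ψ (a * b) d * ψ a b))
    (h2 : ∀ a b, P.c a b / P.c (σ a) (σ b) = ψ a b / ψ b a) :
    ∃ (F : BraidedAutoequiv B) (u : ∀ a, F.functor.obj (P.X a) ≅ P.X (σ a)),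
      ∀ {a b e} (h : a * b = e) (h' : σ a * σ b = σ e),
        μ F.functor _ _ ≫ F.functor.map (P.mul h).hom ≫ (u e).hom =
          ((ψ a b : ℂ))⁻¹ • (((u a).hom ⊗ₘ (u b).hom) ≫ (P.mul h').hom) := by
  -- The frame permuted by `σ` has the pulled-back scalars; rescaling by `ψ⁻¹` restores `(ω, c)`, so
  -- it is the image of the original frame under a braided functor.
  have HY := (P.hasScalars.reindex σ).rescale fun a b => (Circle.toUnits (ψ a b))⁻¹
  have HY' : ((P.frame.reindex σ).rescale fun a b => (Circle.toUnits (ψ a b))⁻¹).HasScalars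
      (fun a b d => P.ω a b d) (fun a b => P.c a b) := by
    convert HY using 4 with a b d a b
    · have := congrArg (fun z : Circle => (z : ℂ)) (h1 a b d)
      simp only [Circle.coe_div, Circle.coe_mul] at this
      have n : ∀ x : Circle, (x : ℂ) ≠ 0 := Circle.coe_ne_zero
      have n1 := n (ψ a b)
      have n2 := n (ψ (a * b) d)
      have n3 := n (ψ b d)
      have n4 := n (ψ a (b * d))
      have n5 := n (P.ω (σ a) (σ b) (σ d))
      simp only [Units.val_inv_eq_inv_val, Circle.toUnits_apply, Units.val_mk0]
      field_simp at this ⊢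
      linear_combination this
    · have := congrArg (fun z : Circle => (z : ℂ)) (h2 a b)
      simp only [Circle.coe_div] at this
      have n : ∀ x : Circle, (x : ℂ) ≠ 0 := Circle.coe_ne_zero
      have n1 := n (ψ a b)
      have n2 := n (ψ b a)
      have n3 := n (P.c (σ a) (σ b))
      simp only [Units.val_inv_eq_inv_val, Circle.toUnits_apply, Units.val_mk0]
      field_simp at this ⊢
      linear_combination this
  obtain ⟨F, _, _, _, u, hu⟩ := exists_braidedFunctor_of_frame P.hasScalars HY' P.class_X (by
    have h1 : toSkeleton (P.X (σ 1)) = ((1 : InvClasses B) : Skeleton B) := by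
      rw [P.class_X, map_one]
    exact h1)
  have := isEquivalence_of_reps P.class_X F σ u
  refine ⟨⟨F⟩, u, fun {a b e} h h' => (hu h).trans ?_⟩
  have h3 : ∀ i : F.obj (P.X a) ⊗ F.obj (P.X b) ⟶ P.X (σ a) ⊗ P.X (σ b),
      i ≫ ((((Circle.toUnits (ψ a b))⁻¹ : ℂˣ) : ℂ) • (P.mul h').hom) =
        ((ψ a b : ℂ))⁻¹ • (i ≫ (P.mul h').hom) := fun i => by
    rw [Linear.comp_smul, Units.val_inv_eq_inv_val, Circle.toUnits_apply, Units.val_mk0]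
  exact h3 _

end BraidedAutoequiv

/-- Braided autoequivalences are classified by the induced automorphism. -/
theorem exists_autBr_mulEquiv [Abelian B] [Linear ℂ B] [MonoidalPreadditive B]
    [MonoidalLinear ℂ B] [IsPointedBraidedFusion B] :
    ∃ Φ : AutBr B ≃* orthogonalGroup (InvClasses B) (selfBraiding B),
      ∀ F : BraidedAutoequiv B, F.Induces (Φ F.toAutBr : MulAut (InvClasses B)) := by
  choose s hs using BraidedAutoequiv.exists_induces (B := B)
  let f : AutBr B →* orthogonalGroup (InvClasses B) (selfBraiding B) :=
    MonoidHom.mk' (Quotient.lift s fun F F' h =>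
        Subtype.ext (((hs F).congr h).unique (hs F'))) (by
      rintro ⟨F⟩ ⟨F'⟩
      exact Subtype.ext ((hs _).unique ((hs F).comp (hs F'))))
  refine ⟨MulEquiv.ofBijective f ⟨?_, ?_⟩, hs⟩
  · rintro ⟨F⟩ ⟨F'⟩ h
    have h' : s F = s F' := h
    exact Quotient.sound (BraidedAutoequiv.exists_iso_of_induces (hs F) (h' ▸ hs F'))
  · rintro ⟨σ, hσ⟩
    obtain ⟨P⟩ := nonempty_vecPresentation (B := B)
    obtain ⟨ψ, h1, h2⟩ := P.exists_cochain hσ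
    obtain ⟨F, u, -⟩ := BraidedAutoequiv.exists_of_cochain P h1 h2
    exact ⟨F.toAutBr, Subtype.ext ((hs F).unique (BraidedAutoequiv.induces_of_reps P.class_X u))⟩

end Autoequivalences

/-! ### Cochain lifts and the cocycle `δ_G θ` -/

section Cochains

variable {G : Type w} [Group G]

theorem deltaG₃_deltaG₂ {M : Type u} [CommGroup M] (r : Gᵐᵒᵖ →* Monoid.End M) (t : G → G → M)
    (g h l k : G) : deltaG₃ r (deltaG₂ r t) g h l k = 1 := by
  have hr : ∀ x, r (.op k) (r (.op l) x) = r (.op (l * k)) x := fun x => by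
    rw [MulOpposite.op_mul, map_mul]
    rfl
  have key : ∀ {N : Type u} [AddCommGroup N] (a b c d e f i j m n : N),
      (a + -b + c + -d) + -(a + -e + f + -i) + (b + -e + j + -m) +
        -(c + -f + j + -n) + (d + -i + m + -n) = 0 := fun _ _ _ _ _ _ _ _ _ _ => by abel
  simp only [deltaG₃, deltaG₂, map_mul, map_inv, hr]
  rw [mul_assoc g h l, mul_assoc h l k]
  exact key (N := Additive M) _ _ _ _ _ _ _ _ _ _

variable {B : Type u} [Category.{v} B] [Preadditive B] [Linear ℂ B] [MonoidalCategory B]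
  [BraidedCategory B] {P : VecPresentation B}
  {ρ : G →* orthogonalGroup (InvClasses B) (selfBraiding B)}
  {ψ : G → InvClasses B → InvClasses B → Circle} {θ : G → G → InvClasses B → Circle}

theorem actOn_mul_apply {A : Type u} [CommGroup A] {q : A → ℂ} (ρ : G →* orthogonalGroup A q)
    (g h : G) (a : A) : actOn ρ (g * h) a = actOn ρ g (actOn ρ h a) := by
  rw [map_mul, MulAut.mul_apply]

theorem VecPresentation.IsCochainLift.tensor (H : P.IsCochainLift ρ ψ θ) (g h : G)
    (a b : InvClasses B) :
    ψ h a b * (ψ (g * h) a b)⁻¹ * ψ g (actOn ρ h a) (actOn ρ h b) =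
      (θ g h b * (θ g h (a * b))⁻¹ * θ g h a)⁻¹ :=
  congrFun (congrFun (H.tensor_eq g h) a) b

/-- The cochain `ψ (g * h)` and the composite of `ψ g` and `ψ h` have the same abelian coboundary,
so their quotient is a symmetric 2-cocycle on `A`, and divisibility of `U(1)` provides `θ g h`. -/
theorem VecPresentation.exists_isCochainLift
    (hψ : ∀ g, (∀ a b d, P.ω a b d / P.ω (actOn ρ g a) (actOn ρ g b) (actOn ρ g d) =
        (ψ g b d * ψ g a (b * d)) / (ψ g (a * b) d * ψ g a b)) ∧
      ∀ a b, P.c a b / P.c (actOn ρ g a) (actOn ρ g b) = ψ g a b / ψ g b a) :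
    ∃ θ, P.IsCochainLift ρ ψ θ := by
  have key₁ : ∀ {N : Type} [AddCommGroup N] {w w' w'' p₁ p₂ p₃ p₄ q₁ q₂ q₃ q₄ r₁ r₂ r₃ r₄ : N},
      w - w' = p₁ + p₂ - (p₃ + p₄) → w - w'' = q₁ + q₂ - (q₃ + q₄) →
      w' - w'' = r₁ + r₂ - (r₃ + r₄) →
      -(p₁ + -q₁ + r₁) + -(p₂ + -q₂ + r₂) = -(p₃ + -q₃ + r₃) + -(p₄ + -q₄ + r₄) := by
    intros
    grind
  have key₂ : ∀ {N : Type} [AddCommGroup N] {w w' w'' p₁ p₂ q₁ q₂ r₁ r₂ : N},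
      w - w' = p₁ - p₂ → w - w'' = q₁ - q₂ → w' - w'' = r₁ - r₂ →
      -(p₁ + -q₁ + r₁) = -(p₂ + -q₂ + r₂) := by
    intros
    grind
  have key₃ : ∀ {N : Type} [AddCommGroup N] {x y z w : N}, -x = y + z - w →
      x = -(z + -w + y) := by
    intros
    grind
  have h : ∀ g h, ∃ η : InvClasses B → Circle, ∀ a b,
      (deltaG₁ (cochainAct₂ (actOn ρ)) ψ g h a b)⁻¹ = η a * η b / η (a * b) := by
    intro g h
    refine exists_symmetric_coboundary_mul
      (fun a b => (deltaG₁ (cochainAct₂ (actOn ρ)) ψ g h a b)⁻¹) (fun a b d => ?_) fun a b => ?_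
    · have e1 := (hψ h).1 a b d
      have e2 := (hψ (g * h)).1 a b d
      have e3 := (hψ g).1 (actOn ρ h a) (actOn ρ h b) (actOn ρ h d)
      simp only [actOn_mul_apply] at e2
      simp only [← map_mul (actOn ρ h)] at e3
      exact key₁ (N := Additive Circle) e1 e2 e3
    · have e1 := (hψ h).2 a b
      have e2 := (hψ (g * h)).2 a b
      have e3 := (hψ g).2 (actOn ρ h a) (actOn ρ h b)
      simp only [actOn_mul_apply] at e2
      exact key₂ (N := Additive Circle) e1 e2 e3
  choose θ hθ using h
  exact ⟨θ, fun g => (hψ g).1, fun g => (hψ g).2, fun g h => funext fun a => funext fun b =>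
    key₃ (N := Additive Circle) (hθ g h a b)⟩

/-- The differential of `θ` takes values in characters and is a 3-cocycle. -/
theorem VecPresentation.IsCochainLift.exists_cocycle (H : P.IsCochainLift ρ ψ θ) :
    ∃ z : Z3 (charAct (actOn ρ)),
      ∀ g h l a, z.1 g h l a = deltaG₂ (cochainAct₁ (actOn ρ)) θ g h l a := by
  have key : ∀ {N : Type} [AddCommGroup N]
      {p₁ p₂ p₃ p₄ p₅ p₆ a₁ b₁ c₁ a₂ b₂ c₂ a₃ b₃ c₃ a₄ b₄ c₄ : N},
      p₁ + -p₂ + p₃ = -(b₁ + -c₁ + a₁) → p₁ + -p₄ + p₅ = -(b₂ + -c₂ + a₂) →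
      p₂ + -p₄ + p₆ = -(b₃ + -c₃ + a₃) → p₃ + -p₅ + p₆ = -(b₄ + -c₄ + a₄) →
      c₁ + -c₂ + c₃ + -c₄ = (a₁ + -a₂ + a₃ + -a₄) + (b₁ + -b₂ + b₃ + -b₄) := by
    intros
    grind
  -- Multiplicativity is `δ_A δ_G θ = 1`. The four instances of the tensor condition rewrite this
  -- coboundary through `δ_G δ_G ψ`, where all values of `ψ` cancel.
  have hmul : ∀ g h l a b, deltaG₂ (cochainAct₁ (actOn ρ)) θ g h l (a * b) =
      deltaG₂ (cochainAct₁ (actOn ρ)) θ g h l a * deltaG₂ (cochainAct₁ (actOn ρ)) θ g h l b := by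
    intro g h l a b
    have e1 := H.tensor h l a b
    have e2 := H.tensor (g * h) l a b
    have e3 := H.tensor g (h * l) a b
    have e4 := H.tensor g h (actOn ρ l a) (actOn ρ l b)
    rw [mul_assoc g h l] at e2
    simp only [actOn_mul_apply] at e3
    rw [← map_mul (actOn ρ l)] at e4
    exact key (N := Additive Circle) e1 e2 e3 e4
  let z : G → G → G → (InvClasses B →* Circle) := fun g h l => MonoidHom.mk' _ (hmul g h l)
  exact ⟨⟨z, fun g h l k => MonoidHom.ext fun a =>
    congrFun (deltaG₃_deltaG₂ (cochainAct₁ (actOn ρ)) θ g h l k) a⟩, fun _ _ _ _ => rfl⟩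

end Cochains

/-! ### Autoequivalences in coordinates and their tensor isomorphisms -/

section Models

variable {B : Type u} [Category.{v} B] [MonoidalCategory B] [BraidedCategory B]
  [Abelian B] [Linear ℂ B]

/-- Isomorphisms which identify an autoequivalence with the autoequivalence `(σ, ψ)` of
`Vec_A^{ω,c}`. -/
structure VecPresentation.Model (P : VecPresentation B) (F : BraidedAutoequiv B)
    (σ : MulAut (InvClasses B)) (ψ : InvClasses B → InvClasses B → Circle) where
  u : ∀ {a a' : InvClasses B}, σ a = a' → (F.functor.obj (P.X a) ≅ P.X a')
  compat : ∀ {a b e a' b' e' : InvClasses B} (h : a * b = e) (ha : σ a = a') (hb : σ b = b')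
    (he : σ e = e') (h' : a' * b' = e'),
    Functor.LaxMonoidal.μ F.functor _ _ ≫ F.functor.map (P.mul h).hom ≫ (u he).hom =
      ((ψ a b : ℂ))⁻¹ • (((u ha).hom ⊗ₘ (u hb).hom) ≫ (P.mul h').hom)

variable {P : VecPresentation B} {F F' F'' : BraidedAutoequiv B}
  {σ σ' τ : MulAut (InvClasses B)} {ψ ψ' ψ'' : InvClasses B → InvClasses B → Circle}

theorem VecPresentation.Model.induces (M : P.Model F σ ψ) : F.Induces σ :=
  BraidedAutoequiv.induces_of_reps P.class_X fun _ => M.u rfl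

namespace VecPresentation.Model

/-- The composite of two models. -/
theorem compat_comp (M : P.Model F σ ψ) (M' : P.Model F' σ' ψ')
    {a b e a' b' e' a'' b'' e'' : InvClasses B} (h : a * b = e)
    (ha' : σ' a = a') (hb' : σ' b = b') (he' : σ' e = e')
    (ha : σ a' = a'') (hb : σ b' = b'') (he : σ e' = e'') (h'' : a'' * b'' = e'') :
    Functor.LaxMonoidal.μ (F'.functor ⋙ F.functor) _ _ ≫ (F'.functor ⋙ F.functor).map (P.mul h).hom ≫
        F.functor.map (M'.u he').hom ≫ (M.u he).hom =
      ((ψ' a b * ψ a' b' : Circle) : ℂ)⁻¹ • (((F.functor.map (M'.u ha').hom ≫ (M.u ha).hom) ⊗ₘ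
        (F.functor.map (M'.u hb').hom ≫ (M.u hb).hom)) ≫ (P.mul h'').hom) := by
  have h' : a' * b' = e' := by rw [← ha', ← hb', ← map_mul, h, he']
  have e1 := congrArg F.functor.map (M'.compat h ha' hb' he' h')
  have e2 := M.compat h' ha hb he h''
  simp only [Functor.map_comp, F.functor.map_smul] at e1
  simp only [Functor.LaxMonoidal.comp_μ, Functor.comp_map, Category.assoc]
  rw [reassoc_of% e1, Linear.smul_comp, Category.assoc, Linear.comp_smul, ← Functor.LaxMonoidal.μ_natural_assoc, e2,
    Linear.comp_smul, smul_smul, tensorHom_comp_tensorHom_assoc, Circle.coe_mul, mul_inv]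

variable [MonoidalPreadditive B] [MonoidalLinear ℂ B] [IsPointedBraidedFusion B]

/-- In coordinates the composite has tensor structure `ψ' · (ψ ∘ σ')` and the target has `ψ''`; `hθ`
is exactly the condition for multiplication by `θ` to intertwine them. -/
theorem exists_tensorIso (M : P.Model F σ ψ) (M' : P.Model F' σ' ψ') (N : P.Model F'' τ ψ'')
    (hτ : ∀ a, τ a = σ (σ' a)) (θ : InvClasses B → Circle)
    (hθ : ∀ a b, ψ' a b * (ψ'' a b)⁻¹ * ψ (σ' a) (σ' b) = (θ b * (θ (a * b))⁻¹ * θ a)⁻¹) :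
    ∃ Θ : F'.functor ⋙ F.functor ≅ F''.functor, NatTrans.IsMonoidal Θ.hom ∧
      ∀ {a a' a'' : InvClasses B} (h' : σ' a = a') (h : σ a' = a'') (k : τ a = a''),
        Θ.hom.app (P.X a) ≫ (N.u k).hom =
          (θ a : ℂ) • (F.functor.map (M'.u h').hom ≫ (M.u h).hom) := by
  let w : ∀ a, (F'.functor ⋙ F.functor).obj (P.X a) ≅ F''.functor.obj (P.X a) := fun a =>
    F.functor.mapIso (M'.u rfl) ≪≫ M.u rfl ≪≫ (N.u (hτ a)).symm
  let v : ∀ a, (F'.functor ⋙ F.functor).obj (P.X a) ≅ F''.functor.obj (P.X a) := fun a =>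
    { hom := (θ a : ℂ) • (w a).hom
      inv := ((θ a)⁻¹ : ℂ) • (w a).inv
      hom_inv_id := by simp [smul_smul]
      inv_hom_id := by simp [smul_smul] }
  have hv : ∀ a, (v a).hom ≫ (N.u (hτ a)).hom =
      (θ a : ℂ) • (F.functor.map (M'.u rfl).hom ≫ (M.u rfl).hom) := fun a => by
    simp [v, w]
  clear_value v
  obtain ⟨Θ, h1, h2⟩ := exists_monoidal_natIso (Z := P.frame) P.class_X
    (F := F'.functor ⋙ F.functor) (F' := F''.functor) v (by
      intro a b e h
      change Functor.LaxMonoidal.μ (F'.functor ⋙ F.functor) (P.X a) (P.X b) ≫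
          (F'.functor ⋙ F.functor).map (P.mul h).hom ≫ (v e).hom =
        ((v a).hom ⊗ₘ (v b).hom) ≫ Functor.LaxMonoidal.μ F''.functor (P.X a) (P.X b) ≫ F''.functor.map (P.mul h).hom
      have h'' : σ (σ' a) * σ (σ' b) = σ (σ' e) := by rw [← map_mul, ← map_mul, h]
      have e1 := M.compat_comp M' h rfl rfl rfl rfl rfl rfl h''
      have e2 := N.compat h (hτ a) (hτ b) (hτ e) h''
      rw [← cancel_mono (N.u (hτ e)).hom]
      simp only [Category.assoc]
      rw [hv, e2, Linear.comp_smul, Linear.comp_smul, Linear.comp_smul, e1,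
        tensorHom_comp_tensorHom_assoc, hv, hv]
      simp only [MonoidalCategory.tensorHom_def, MonoidalLinear.smul_whiskerRight,
        MonoidalLinear.whiskerLeft_smul, Linear.smul_comp, Linear.comp_smul, smul_smul]
      congr 1
      have := congrArg (fun z : Circle => (z : ℂ)) (hθ a b)
      have n : ∀ x : Circle, (x : ℂ) ≠ 0 := Circle.coe_ne_zero
      have n1 := n (ψ' a b)
      have n2 := n (ψ'' a b)
      have n3 := n (ψ (σ' a) (σ' b))
      have n4 := n (θ a)
      have n5 := n (θ b)
      have n6 := n (θ (a * b))
      simp only [Circle.coe_mul, Circle.coe_inv] at this ⊢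
      rw [← h]
      field_simp at this ⊢
      linear_combination -this)
  refine ⟨Θ, h1, ?_⟩
  rintro a _ _ rfl rfl k
  rw [← hv, ← h2]
  rfl

end VecPresentation.Model

variable [MonoidalPreadditive B] [MonoidalLinear ℂ B] [IsPointedBraidedFusion B]

theorem VecPresentation.exists_model (P : VecPresentation B)
    (h1 : ∀ a b d, P.ω a b d / P.ω (σ a) (σ b) (σ d) =
      (ψ b d * ψ a (b * d)) / (ψ (a * b) d * ψ a b))
    (h2 : ∀ a b, P.c a b / P.c (σ a) (σ b) = ψ a b / ψ b a) :
    ∃ F, Nonempty (P.Model F σ ψ) := by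
  obtain ⟨F, u, hu⟩ := BraidedAutoequiv.exists_of_cochain P h1 h2
  refine ⟨F, ⟨⟨fun h => u _ ≪≫ eqToIso (congrArg P.X h), ?_⟩⟩⟩
  rintro a b e _ _ _ h rfl rfl rfl h'
  simpa using hu h h'

end Models

/-! ### The obstruction class and its independence of choices -/

section Obstruction

variable {B : Type u} [Category.{v} B] [Abelian B] [Linear ℂ B]
  [MonoidalCategory B] [BraidedCategory B] {G : Type w} [Group G]
  {ρ : G →* orthogonalGroup (InvClasses B) (selfBraiding B)}

/-- The square defining the obstruction may be checked on representatives. -/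
theorem FunctorLift.represents_of_reps {X : InvClasses B → B}
    (hX : ∀ a, toSkeleton (X a) = (a : Skeleton B)) (D : FunctorLift ρ)
    {z : G → G → G → (InvClasses B →* Circle)}
    (hz : ∀ (g h l : G) (a : InvClasses B),
      (z g h l a : ℂ) • ((D.Θ g h).hom.app ((D.F l).functor.obj (X a)) ≫
          (D.Θ (g * h) l).hom.app (X a)) =
        (D.F g).functor.map ((D.Θ h l).hom.app (X a)) ≫ (D.Θ g (h * l)).hom.app (X a) ≫
          eqToHom (congrArg (fun x => (D.F x).functor.obj (X a)) (mul_assoc g h l).symm)) :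
    D.Represents z := by
  intro g h l U a hU
  obtain ⟨i⟩ := exists_iso_of_class (hX a) hU
  have e1 := (D.Θ g h).hom.naturality ((D.F l).functor.map i.hom)
  have e2 := (D.Θ (g * h) l).hom.naturality i.hom
  have e3 := congrArg (D.F g).functor.map ((D.Θ h l).hom.naturality i.hom)
  have e4 := (D.Θ g (h * l)).hom.naturality i.hom
  have e5 : ∀ {x y : G} (hxy : x = y),
      (D.F x).functor.map i.hom ≫ eqToHom (congrArg (fun x => (D.F x).functor.obj U) hxy) =
        eqToHom (congrArg (fun x => (D.F x).functor.obj (X a)) hxy) ≫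
          (D.F y).functor.map i.hom := by
    rintro x _ rfl
    simp
  simp only [Functor.map_comp, Functor.comp_map] at e1 e2 e3 e4
  rw [← cancel_epi ((D.F g).functor.map ((D.F h).functor.map ((D.F l).functor.map i.hom)))]
  simp only [Linear.comp_smul, Category.comp_id]
  rw [reassoc_of% e1, e2, reassoc_of% e3, reassoc_of% e4, e5 (mul_assoc g h l).symm,
    ← reassoc_of% hz, Linear.smul_comp,
    Category.assoc]

variable [MonoidalPreadditive B] [MonoidalLinear ℂ B] [IsPointedBraidedFusion B]

/-- The obstruction cocycles of two choices are cohomologous. -/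
theorem FunctorLift.Represents.exists_of_lift {D : FunctorLift ρ}
    {z : G → G → G → (InvClasses B →* Circle)} (hz : D.Represents z) (D' : FunctorLift ρ) :
    ∃ t : G → G → (InvClasses B →* Circle),
      D'.Represents fun g h l => z g h l * deltaG₂ (charAct (actOn ρ)) t g h l := by
  choose η hη using fun g => BraidedAutoequiv.exists_iso_of_induces (D.induces g) (D'.induces g)
  -- The isomorphisms `η` need not respect `D.Θ` and `D'.Θ`. The two resulting tensor isomorphisms
  -- from `F g ∘ F h` to `F' (g * h)` differ by a character.
  have hχ : ∀ g h, ∃ χ : InvClasses B →* Circle, ∀ (X : B) (a : InvClasses B),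
      toSkeleton X = (a : Skeleton B) →
        (NatIso.hcomp (η h) (η g) ≪≫ D'.Θ g h).hom.app X =
          (χ a : ℂ) • (D.Θ g h ≪≫ η (g * h)).hom.app X := by
    intro g h
    have := D.isMonoidal g h
    have := D'.isMonoidal g h
    have h1 : NatTrans.IsMonoidal (NatIso.hcomp (η h) (η g) ≪≫ D'.Θ g h).hom :=
      inferInstanceAs (NatTrans.IsMonoidal (((η h).hom ◫ (η g).hom) ≫ (D'.Θ g h).hom))
    have h2 : NatTrans.IsMonoidal (D.Θ g h ≪≫ η (g * h)).hom :=
      inferInstanceAs (NatTrans.IsMonoidal ((D.Θ g h).hom ≫ (η (g * h)).hom))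
    exact exists_character (fun X a hX => exists_class_map _ hX) _ _
  choose χ hχ using hχ
  have key : ∀ g h (X : B) (a : InvClasses B), toSkeleton X = (a : Skeleton B) →
      (η g).hom.app ((D.F h).functor.obj X) ≫ (D'.F g).functor.map ((η h).hom.app X) ≫
          (D'.Θ g h).hom.app X =
        (χ g h a : ℂ) • ((D.Θ g h).hom.app X ≫ (η (g * h)).hom.app X) := by
    intro g h X a hX
    have := hχ g h X a hX
    simpa using this
  refine ⟨χ, fun g h l X a hX => ?_⟩
  have e0 := hz g h l X a hX
  -- Here `χ g h` is evaluated at `F l X`, which lies in the class `ρ l a`; this is the origin of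
  -- the right action in `δ_G`.
  have left : (η g).hom.app ((D.F h).functor.obj ((D.F l).functor.obj X)) ≫
      (D'.F g).functor.map ((η h).hom.app ((D.F l).functor.obj X)) ≫
      (D'.F g).functor.map ((D'.F h).functor.map ((η l).hom.app X)) ≫
      (D'.Θ g h).hom.app ((D'.F l).functor.obj X) ≫ (D'.Θ (g * h) l).hom.app X =
        ((χ (g * h) l a : ℂ) * (χ g h (actOn ρ l a) : ℂ)) •
          ((D.Θ g h).hom.app ((D.F l).functor.obj X) ≫ (D.Θ (g * h) l).hom.app X ≫
            (η (g * h * l)).hom.app X) := by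
    have e1 := (D'.Θ g h).hom.naturality ((η l).hom.app X)
    have e2 := key g h _ _ (D.induces l X a hX)
    have e3 := key (g * h) l X a hX
    simp only [Functor.comp_map] at e1
    rw [reassoc_of% e1, reassoc_of% e2, Linear.smul_comp, Category.assoc, e3, Linear.comp_smul,
      smul_smul, mul_comm]
  have right : (η g).hom.app ((D.F h).functor.obj ((D.F l).functor.obj X)) ≫
      (D'.F g).functor.map ((η h).hom.app ((D.F l).functor.obj X)) ≫
      (D'.F g).functor.map ((D'.F h).functor.map ((η l).hom.app X)) ≫
      (D'.F g).functor.map ((D'.Θ h l).hom.app X) ≫ (D'.Θ g (h * l)).hom.app X =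
        ((χ h l a : ℂ) * (χ g (h * l) a : ℂ)) •
          ((D.F g).functor.map ((D.Θ h l).hom.app X) ≫ (D.Θ g (h * l)).hom.app X ≫
            (η (g * (h * l))).hom.app X) := by
    have e1 := congrArg (D'.F g).functor.map (key h l X a hX)
    have e2 : (D.F g).functor.map ((D.Θ h l).hom.app X) ≫ (η g).hom.app _ =
        (η g).hom.app ((D.F h).functor.obj ((D.F l).functor.obj X)) ≫
          (D'.F g).functor.map ((D.Θ h l).hom.app X) := (η g).hom.naturality ((D.Θ h l).hom.app X)
    have e3 := key g (h * l) X a hX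
    simp only [Functor.map_comp, Functor.map_smul] at e1
    rw [reassoc_of% e1]
    simp only [Linear.smul_comp, Linear.comp_smul, Category.assoc]
    rw [← reassoc_of% e2, e3, Linear.comp_smul, smul_smul]
  have e1 : (η (g * (h * l))).hom.app X ≫
      eqToHom (congrArg (fun x => (D'.F x).functor.obj X) (mul_assoc g h l).symm) =
        eqToHom (congrArg (fun x => (D.F x).functor.obj X) (mul_assoc g h l).symm) ≫
          (η (g * h * l)).hom.app X := by
    have : ∀ {x y : G} (hxy : x = y), (η x).hom.app X ≫
      eqToHom (congrArg (fun x => (D'.F x).functor.obj X) hxy) =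
        eqToHom (congrArg (fun x => (D.F x).functor.obj X) hxy) ≫ (η y).hom.app X := by
      rintro x _ rfl
      simp
    exact this (mul_assoc g h l).symm
  have e2 : (((z g h l * deltaG₂ (charAct (actOn ρ)) χ g h l) a : Circle) : ℂ) =
      z g h l a * (χ h l a * (χ (g * h) l a : ℂ)⁻¹ * χ g (h * l) a *
        (χ g h (actOn ρ l a) : ℂ)⁻¹) := by
    rw [← Circle.coe_inv, ← Circle.coe_inv, ← Circle.coe_mul, ← Circle.coe_mul, ← Circle.coe_mul,
      ← Circle.coe_mul]
    rfl
  have n1 : (χ (g * h) l a : ℂ) ≠ 0 := Circle.coe_ne_zero _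
  have n2 : (χ g h (actOn ρ l a) : ℂ) ≠ 0 := Circle.coe_ne_zero _
  simp only [Linear.comp_smul, Category.comp_id] at e0 ⊢
  rw [e2, ← cancel_epi ((η g).hom.app ((D.F h).functor.obj ((D.F l).functor.obj X)) ≫
    (D'.F g).functor.map ((η h).hom.app ((D.F l).functor.obj X)) ≫
    (D'.F g).functor.map ((D'.F h).functor.map ((η l).hom.app X)))]
  simp only [Linear.comp_smul, Category.assoc]
  rw [left, reassoc_of% right, Linear.smul_comp]
  simp only [Category.assoc]
  rw [e1, ← reassoc_of% e0]
  simp only [Linear.smul_comp, smul_smul, Category.assoc]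
  congr 1
  field_simp

/-- Once each `F g` is put in coordinates, `Θ g h` acts on representatives by `θ g h`. The two
routes from `F g ∘ F h ∘ F l` to `F (g * h * l)` then become products of two values of `θ`, whose
quotient is `δ_G θ`. -/
theorem VecPresentation.IsCochainLift.exists_functorLift {P : VecPresentation B}
    {ψ : G → InvClasses B → InvClasses B → Circle} {θ : G → G → InvClasses B → Circle}
    (H : P.IsCochainLift ρ ψ θ) :
    ∃ D : FunctorLift ρ, ∀ z : G → G → G → (InvClasses B →* Circle),
      (∀ g h l a, z g h l a = deltaG₂ (cochainAct₁ (actOn ρ)) θ g h l a) → D.Represents z := by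
  choose F M using fun g => P.exists_model (H.associator_eq g) (H.braiding_eq g)
  replace M := fun g => (M g).some
  choose Θ hΘ hu using fun g h => (M g).exists_tensorIso (M h) (M (g * h))
    (actOn_mul_apply ρ g h) (θ g h) (H.tensor g h)
  refine ⟨⟨F, fun g => (M g).induces, Θ, hΘ⟩, fun z hz => ?_⟩
  refine FunctorLift.represents_of_reps P.class_X _ fun g h l a => ?_
  change (z g h l a : ℂ) • ((Θ g h).hom.app ((F l).functor.obj (P.X a)) ≫
      (Θ (g * h) l).hom.app (P.X a)) =
    (F g).functor.map ((Θ h l).hom.app (P.X a)) ≫ (Θ g (h * l)).hom.app (P.X a) ≫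
      eqToHom (congrArg (fun x => (F x).functor.obj (P.X a)) (mul_assoc g h l).symm)
  have k : actOn ρ (g * h * l) a = actOn ρ g (actOn ρ h (actOn ρ l a)) := by
    rw [actOn_mul_apply, actOn_mul_apply]
  have k' : actOn ρ (g * (h * l)) a = actOn ρ g (actOn ρ h (actOn ρ l a)) := by
    rw [actOn_mul_apply, actOn_mul_apply]
  have e1 := hu (g * h) l (a := a) rfl (actOn_mul_apply ρ g h _) k
  have e2 := (Θ g h).hom.naturality ((M l).u (rfl : actOn ρ l a = _)).hom
  have e3 := hu g h (a := actOn ρ l a) rfl rfl (actOn_mul_apply ρ g h _)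
  have e4 := congrArg (F g).functor.map (hu h l (a := a) rfl rfl (actOn_mul_apply ρ h l a))
  have e5 := hu g (h * l) (a := a) (actOn_mul_apply ρ h l a) rfl k'
  have e6 : ∀ {x y : G} (hxy : x = y) {a' : InvClasses B} (hx : actOn ρ x a = a')
      (hy : actOn ρ y a = a'),
      eqToHom (congrArg (fun x => (F x).functor.obj (P.X a)) hxy) ≫ ((M y).u hy).hom =
        ((M x).u hx).hom := by
    rintro x _ rfl _ _ _
    simp
  simp only [Functor.map_comp, Functor.map_smul, Functor.comp_map] at e2 e4
  rw [← cancel_mono ((M (g * h * l)).u k).hom]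
  simp only [Linear.smul_comp, Category.assoc]
  rw [e6 (mul_assoc g h l).symm k' k, e1, e5, Linear.comp_smul, Linear.comp_smul, reassoc_of% e4,
    ← reassoc_of% e2, e3]
  simp only [Linear.smul_comp, Linear.comp_smul, Category.assoc, smul_smul]
  congr 1
  have h1 : z g h l a = θ h l a * (θ (g * h) l a)⁻¹ * θ g (h * l) a *
      (θ g h (actOn ρ l a))⁻¹ := hz g h l a
  simp only [h1, Circle.coe_mul, Circle.coe_inv]
  have n : ∀ x : Circle, (x : ℂ) ≠ 0 := Circle.coe_ne_zero
  have n1 := n (θ (g * h) l a)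
  have n2 := n (θ g h (actOn ρ l a))
  field_simp

end Obstruction

/-! ### The main theorem -/

theorem mainTheorem7 {B : Type u} [Category.{v} B] [Abelian B] [Linear ℂ B]
    [MonoidalCategory B] [MonoidalPreadditive B] [MonoidalLinear ℂ B] [BraidedCategory B]
    [IsPointedBraidedFusion B] :
    (∃ Φ : AutBr B ≃* orthogonalGroup (InvClasses B) (selfBraiding B),
      ∀ F : BraidedAutoequiv B, F.Induces (Φ F.toAutBr : MulAut (InvClasses B))) ∧
    Nonempty (VecPresentation B) ∧
    ∀ (P : VecPresentation B) {G : Type w} [Group G]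
      (ρ : G →* orthogonalGroup (InvClasses B) (selfBraiding B)),
      (∃ (ψ : G → InvClasses B → InvClasses B → Circle) (θ : G → G → InvClasses B → Circle),
        P.IsCochainLift ρ ψ θ) ∧
      ∀ (ψ : G → InvClasses B → InvClasses B → Circle) (θ : G → G → InvClasses B → Circle),
        P.IsCochainLift ρ ψ θ →
          ∃ z : Z3 (charAct (actOn ρ)),
            (∀ g h l a, z.1 g h l a = deltaG₂ (cochainAct₁ (actOn ρ)) θ g h l a) ∧
            IsH3Obstruction ρ (QuotientGroup.mk z) := by
  refine ⟨exists_autBr_mulEquiv, nonempty_vecPresentation, fun P G _ ρ => ⟨?_, ?_⟩⟩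
  · choose ψ hψ using fun g => P.exists_cochain (ρ g).2
    obtain ⟨θ, h⟩ := VecPresentation.exists_isCochainLift (P := P) (ρ := ρ) hψ
    exact ⟨ψ, θ, h⟩
  · intro ψ θ H
    obtain ⟨z, hz⟩ := H.exists_cocycle
    refine ⟨z, hz, ?_⟩
    obtain ⟨D, hD⟩ := H.exists_functorLift
    refine ⟨⟨D⟩, fun D' => ?_⟩
    have hDz : D.Represents z := hD _ hz
    obtain ⟨t, ht⟩ := hDz.exists_of_lift D'
    let y : Z3 (charAct (actOn ρ)) :=
      ⟨deltaG₂ (charAct (actOn ρ)) t, fun g h l k => deltaG₃_deltaG₂ _ t g h l k⟩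
    -- For the arbitrary choice `D'` the obstruction is `δ_G θ` times the coboundary of `t`, so its
    -- class is unchanged.
    refine ⟨z * y, ht, (QuotientGroup.eq.2 ?_).symm⟩
    rw [inv_mul_cancel_left]
    exact ⟨t, rfl⟩
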